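/- Let $Y=\prod_{I}\operatorname{Gr}_{|I|}(\mathbb C^4)$, where $I$ runs over the proper nonempty subsets of $\{1,2,3,4\}$, let $E_I\subset\mathbb C^4$ be the span of the standard basis vectors $e_i$, $i\in I$, let $X^\circ\subset Y$ be the $\operatorname{GL}_4(\mathbb C)$-orbit of the point $(E_I)_I$, and let $X=\overline{X^\circ}$ be its Zariski closure (the space of tetrahedra). Let $U\subset X$ be the affine open subset of all $p=(\pi_I)_I\in X$ such that every $\pi_I$ is transverse to $E_{4}$, $E_{34}$ and $E_{234}$. For $|I|=|J|=k$ let $f_{I,J}$ be the regular function on $U$ whose value at $p$ is the ratio of the $J$-th to the $\{1,\dots,k\}$-th Plücker coordinate of $\pi_I$; these functions generate the coordinate ring $\mathcal O(U)$. Order the subsets of $\{1,2,3,4\}$ by $1<2<3<4<12<13<14<23<24<34<123<124<134<234$. Let $\mathcal E=\mathcal E_1\cup\mathcal E_2\cup\mathcal E_3$, where $\mathcal E_k$ is the set of edges of the hypersimplex $\Delta_k$, i.e. of pairs $\alpha=\{I,J\}$ with $|I|=|J|=k$ and $|I\cap J|=k-1$. For $\alpha=\{I,J\}\in\mathcal E_k$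 with $I<J$ define the edge coordinate $x_\alpha=f_{J,K}-f_{I,K}$, where $K=2,\,13,\,124$ for $k=1,2,3$ respectively. The flag coordinates are $f_{1,2},f_{1,3},f_{1,4},f_{12,13},f_{12,14},f_{123,124}$. Let $\mathbb A_{op}\cong\mathbb A^6$ and $\mathbb A_{\mathcal E}\cong\mathbb A^{24}$ be the complex affine spaces whose coordinates are indexed by the flag coordinates and by the edges. (a) The flag and edge coordinates generate $\mathcal O(U)$ and define an embedding $U\subset\mathbb A_{op}\times\mathbb A_{\mathcal E}$. (b) As a set, $U$ is the common zero set in $\mathbb A_{op}\times\mathbb A_{\mathcal E}$ of the following polynomials. 1. (Linear) $x_{JK}-x_{IK}+x_{IJ}$ for all $I<J<K$ that are the vertices of a triangular face of a hypersimplex (equivalently, that are pairwise joined by edges); here $x_{IJ}$ stands for $x_{\{I,J\}}$. 2. (Quadric) $x_{\alpha_1}x_{\alpha_2^*}-x_{\alpha_2}x_{\alpha_1^*}$, where $\alpha_1=\{i,j\}$, $\alpha_2=\{j,k\}$, $\alpha_1^*=\{ik,jk\}$, $\alpha_2^*=\{ij,ik\}$ with $i,j,k$ distinct, or $\alpha_1=\{il,jl\}$,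 $\alpha_2=\{jl,kl\}$, $\alpha_1^*=\{ikl,jkl\}$, $\alpha_2^*=\{ijl,ikl\}$ with $i,j,k,l$ distinct. 3. (Cubic) $x_{\alpha_1}x_{\alpha_2}x_{\alpha_3}-x_{\alpha_1^*}x_{\alpha_2^*}x_{\alpha_3^*}$, where $\alpha_1=\{ij,il\}$, $\alpha_2=\{ik,kl\}$, $\alpha_3=\{jk,jl\}$, $\alpha_1^*=\{jk,kl\}$, $\alpha_2^*=\{ij,jl\}$, $\alpha_3^*=\{ik,il\}$ with $i,j,k,l$ distinct. 4. (Quartic) $x_{\alpha_1}x_{\alpha_3}x_{\alpha_2^*}x_{\alpha_4^*}-x_{\alpha_2}x_{\alpha_4}x_{\alpha_1^*}x_{\alpha_3^*}$, where $\alpha_1=\{i,j\}$, $\alpha_2=\{j,k\}$, $\alpha_3=\{k,l\}$, $\alpha_4=\{l,i\}$, $\alpha_1^*=\{ikl,jkl\}$, $\alpha_2^*=\{ijl,ikl\}$, $\alpha_3^*=\{ijk,ijl\}$, $\alpha_4^*=\{jkl,ijk\}$ with $i,j,k,l$ distinct. (c) The common zero set $U_{inc}$ of the linear and quadric polynomials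 alone has exactly three irreducible components (in the Zariski topology): $U$; the set of points satisfying the linear relations with $x_\alpha=0$ for all $\alpha\in\mathcal E_2$; and the set of points satisfying the linear relations with $x_\alpha=0$ for all $\alpha\in\mathcal E_1\cup\mathcal E_3$. -/

import Mathlib

noncomputable section

namespace Tetrahedra

/-! ## The space of tetrahedra in projective 3-space

The label set is `Fin 4`; the label `i : Fin 4` stands for `i + 1` in `{1, 2, 3, 4}`. -/

/-- The standard 4-dimensional complex vector space. -/
abbrev V4 : Type := Fin 4 → ℂ

/-- Proper nonempty subsets of the label set; these are the vertices of the hypersimplices. -/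
abbrev Vertex : Type := {I : Finset (Fin 4) // I.Nonempty ∧ I ≠ Finset.univ}

/-- The Grassmannian of `k`-dimensional subspaces. -/
abbrev Gr (k : ℕ) : Type := {W : Submodule ℂ V4 // Module.finrank ℂ W = k}

/-- The ambient product of Grassmannians, one factor of dimension `|I|` for each `I`. -/
abbrev Y : Type := (I : Vertex) → Gr I.1.card

/-- The coordinate subspace spanned by the basis vectors `e_i`, `i ∈ I`. -/
def E (I : Finset (Fin 4)) : Submodule ℂ V4 :=
  Submodule.span ℂ ((fun i => (Pi.single i 1 : V4)) '' (I : Set (Fin 4)))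

theorem finrank_E (I : Finset (Fin 4)) : Module.finrank ℂ (E I) = I.card := by
  have h : LinearIndependent ℂ (fun i : I => (Pi.single i.1 1 : V4)) := by
    have := (Pi.basisFun ℂ (Fin 4)).linearIndependent.comp (fun i : I => i.1)
      Subtype.val_injective
    convert this using 1
    funext i
    simp
  have h2 := finrank_span_eq_card h
  rw [E, Set.image_eq_range]
  simpa using h2

/-- The standard coordinate tetrahedron. -/
def p0 : Y := fun I => ⟨E I.1, finrank_E I.1⟩

/-- The action of the general linear group on the product of Grassmannians. -/
def act (g : V4 ≃ₗ[ℂ] V4) (p : Y) : Y := fun I =>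
  ⟨(p I).1.map (g : V4 →ₗ[ℂ] V4), by rw [LinearEquiv.finrank_map_eq]; exact (p I).2⟩

/-- Nondegenerate tetrahedra: the orbit of the coordinate tetrahedron. -/
def Xo : Set Y := Set.range (fun g => act g p0)

/-! ### Plücker coordinates and Zariski closure -/

/-- Labels of the Plücker coordinates on the Grassmannian of `k`-planes. -/
abbrev Minor (k : ℕ) : Type := {J : Finset (Fin 4) // J.card = k}

/-- A chosen basis of a `k`-plane. -/
def frame {k : ℕ} (W : Gr k) : Module.Basis (Fin k) ℂ W.1 :=
  Module.finBasisOfFinrankEq ℂ W.1 W.2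

/-- Homogeneous Plücker coordinates of a `k`-plane: the maximal minors of the matrix whose rows
are a chosen basis. Another basis multiplies all of them by one common nonzero scalar. -/
def plucker {k : ℕ} (W : Gr k) (J : Minor k) : ℂ :=
  Matrix.det (Matrix.of fun a b : Fin k => (frame W a : V4) (J.1.orderEmbOfFin J.2 b))

/-- Labels `(I, J)` of the Plücker coordinates of all factors of the product. -/
abbrev PluckerVar : Type := Σ I : Vertex, Minor I.1.card

/-- The multidegree of a Plücker coordinate of the factor `I`. -/
def multidegree (v : PluckerVar) : Vertex → ℕ := Pi.single v.1 1

/-- Zariski closure in the product of Grassmannians: the common zeros of all multihomogeneous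
polynomials in the Plücker coordinates of the factors that vanish on `S`. -/
def zariskiClosure (S : Set Y) : Set Y :=
  {p | ∀ (F : MvPolynomial PluckerVar ℂ) (d : Vertex → ℕ),
    MvPolynomial.IsWeightedHomogeneous multidegree F d →
    (∀ q ∈ S, MvPolynomial.eval (fun v => plucker (q v.1) v.2) F = 0) →
    MvPolynomial.eval (fun v => plucker (p v.1) v.2) F = 0}

/-- The space of tetrahedra. -/
def X : Set Y := zariskiClosure Xo

/-! ### The affine chart -/

/-- The flag at infinity: `flagAtInfinity k` is spanned by the last `k` basis vectors. -/
def flagAtInfinity (k : ℕ) : Submodule ℂ V4 :=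
  E (Finset.univ.filter fun i : Fin 4 => 4 ≤ (i : ℕ) + k)

/-- The chart of tetrahedra all of whose faces are transverse to the flag at infinity. The expected
dimension of an intersection is `max 0 (|I| + k - 4)`, which is what truncated subtraction gives. -/
def U : Set Y :=
  {p | p ∈ X ∧ ∀ (I : Vertex) (k : ℕ), 1 ≤ k → k ≤ 3 →
    Module.finrank ℂ ((p I).1 ⊓ flagAtInfinity k : Submodule ℂ V4) = I.1.card + k - 4}

/-- The subset `1`, `12` or `123` with as many elements as `I`. -/
def initialMinor (I : Vertex) : Minor I.1.card :=
  ⟨Finset.univ.filter fun i : Fin 4 => (i : ℕ) < I.1.card, by revert I; decide⟩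

/-- The subset `2`, `13` or `124` with as many elements as `I`. -/
def secondMinor (I : Vertex) : Minor I.1.card :=
  ⟨Finset.univ.filter fun i : Fin 4 => (i : ℕ) + 1 < I.1.card ∨ (i : ℕ) = I.1.card,
    by revert I; decide⟩

/-- The affine Plücker coordinate `f_{I,J}`: the ratio of the `J`-th and the initial Plücker
coordinates of the `I`-th face. On the chart the denominator is nonzero. -/
def f (p : Y) (I : Vertex) (J : Minor I.1.card) : ℂ :=
  plucker (p I) J / plucker (p I) (initialMinor I)

/-- The coordinate ring of the affine variety `U`, as a ring of complex functions on `U`. The chart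
is closed in a product of big cells, and it is generated by the affine coordinates of these cells. -/
def coordinateRing : Subalgebra ℂ (U → ℂ) :=
  Algebra.adjoin ℂ {h | ∃ (I : Vertex) (J : Minor I.1.card), h = fun p : U => f p.1 I J}

/-! ### Edges of the hypersimplices -/

/-- The total order on subsets: first by cardinality, then lexicographically, that is
`∅ < 1 < 2 < 3 < 4 < 12 < 13 < 14 < 23 < 24 < 34 < 123 < 124 < 134 < 234 < 1234`. -/
def precedes (I J : Finset (Fin 4)) : Prop :=
  I.card < J.card ∨
    (I.card = J.card ∧ ∃ i ∈ I, i ∉ J ∧ ∀ j < i, (j ∈ I ↔ j ∈ J))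

instance (I J : Finset (Fin 4)) : Decidable (precedes I J) := by
  unfold precedes; infer_instance

/-- `I` and `J` are joined by an edge of a hypersimplex: they have the same size and differ in
exactly one element (all pairs of vertices of the two tetrahedra, and all pairs of non-opposite
vertices of the octahedron). -/
def Adjacent (I J : Finset (Fin 4)) : Prop :=
  I.card = J.card ∧ (I ∩ J).card + 1 = I.card

/-- The edges `{I, J}` of the three hypersimplices, written with `I < J`. -/
structure Edge : Type where
  lo : Vertex
  hi : Vertex
  adjacent : Adjacent lo.1 hi.1
  lt : precedes lo.1 hi.1

/-- The rank `k` of the hypersimplex that contains the edge. -/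
def Edge.rank (α : Edge) : ℕ := α.lo.1.card

/-- `α` is the edge `{I, J}`. -/
def Edge.Joins (α : Edge) (I J : Finset (Fin 4)) : Prop :=
  s(α.lo.1, α.hi.1) = s(I, J)

/-- The edge coordinate `x_α = f_{J,K} - f_{I,K}` for `α = {I, J}`, `I < J`, where `K` is
`2`, `13` or `124`. -/
def edgeCoordinate (p : Y) (α : Edge) : ℂ :=
  f p α.hi (secondMinor α.hi) - f p α.lo (secondMinor α.lo)

/-- The flag coordinates `f_{1,2}, f_{1,3}, f_{1,4}, f_{12,13}, f_{12,14}, f_{123,124}`. -/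
def flagCoordinate (p : Y) : Fin 6 → ℂ :=
  ![f p ⟨{0}, by decide⟩ ⟨{1}, by decide⟩,
    f p ⟨{0}, by decide⟩ ⟨{2}, by decide⟩,
    f p ⟨{0}, by decide⟩ ⟨{3}, by decide⟩,
    f p ⟨{0, 1}, by decide⟩ ⟨{0, 2}, by decide⟩,
    f p ⟨{0, 1}, by decide⟩ ⟨{0, 3}, by decide⟩,
    f p ⟨{0, 1, 2}, by decide⟩ ⟨{0, 1, 3}, by decide⟩]

/-! ### The affine space of flag and edge coordinates -/

/-- Labels of the six flag coordinates and of the edge coordinates. -/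
abbrev CoordVar : Type := Fin 6 ⊕ Edge

/-- The affine space with these coordinates, with its Zariski topology. -/
def AffineSpace : Type := CoordVar → ℂ

/-- The Zariski topology: the closed sets are the zero sets of polynomials. It is induced from the
spectrum of the polynomial ring by sending a point to its maximal ideal. -/
instance : TopologicalSpace AffineSpace :=
  TopologicalSpace.induced
    (fun z : AffineSpace => MvPolynomial.pointToPoint (k := ℂ) (K := ℂ) (σ := CoordVar) z)
    inferInstance

/-- The flag and edge coordinates of a point of the chart. -/
def chartMap (p : U) : AffineSpace :=
  Sum.elim (flagCoordinate p.1) (edgeCoordinate p.1)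

/-- The variable `x_α` of the polynomial ring. -/
def x (α : Edge) : MvPolynomial CoordVar ℂ := MvPolynomial.X (Sum.inr α)

/-- The common zero set of a set of polynomials. -/
def zeroSet (S : Set (MvPolynomial CoordVar ℂ)) : Set AffineSpace :=
  {z | ∀ P ∈ S, MvPolynomial.eval (σ := CoordVar) z P = 0}

/-- `x_{JK} - x_{IK} + x_{IJ}` for a triangular face `{I, J, K}` with `I < J < K`. A triangular face
is a triple of vertices that are pairwise joined by edges. -/
def linearRelations : Set (MvPolynomial CoordVar ℂ) :=
  {P | ∃ (I J K : Finset (Fin 4)) (α₁ α₂ α₃ : Edge),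
    precedes I J ∧ precedes J K ∧
    α₁.Joins J K ∧ α₂.Joins I K ∧ α₃.Joins I J ∧
    P = x α₁ - x α₂ + x α₃}

/-- The quadric relations, for distinct `i, j, k` and for distinct `i, j, k, l`. -/
def quadricRelations : Set (MvPolynomial CoordVar ℂ) :=
  {P | ∃ (i j k : Fin 4) (α₁ α₂ β₁ β₂ : Edge), [i, j, k].Nodup ∧
    α₁.Joins {i} {j} ∧ α₂.Joins {j} {k} ∧
    β₁.Joins {i, k} {j, k} ∧ β₂.Joins {i, j} {i, k} ∧
    P = x α₁ * x β₂ - x α₂ * x β₁} ∪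
  {P | ∃ (i j k l : Fin 4) (α₁ α₂ β₁ β₂ : Edge), [i, j, k, l].Nodup ∧
    α₁.Joins {i, l} {j, l} ∧ α₂.Joins {j, l} {k, l} ∧
    β₁.Joins {i, k, l} {j, k, l} ∧ β₂.Joins {i, j, l} {i, k, l} ∧
    P = x α₁ * x β₂ - x α₂ * x β₁}

/-- The cubic relations, for distinct `i, j, k, l`. -/
def cubicRelations : Set (MvPolynomial CoordVar ℂ) :=
  {P | ∃ (i j k l : Fin 4) (α₁ α₂ α₃ β₁ β₂ β₃ : Edge), [i, j, k, l].Nodup ∧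
    α₁.Joins {i, j} {i, l} ∧ α₂.Joins {i, k} {k, l} ∧ α₃.Joins {j, k} {j, l} ∧
    β₁.Joins {j, k} {k, l} ∧ β₂.Joins {i, j} {j, l} ∧ β₃.Joins {i, k} {i, l} ∧
    P = x α₁ * x α₂ * x α₃ - x β₁ * x β₂ * x β₃}

/-- The quartic relations, for distinct `i, j, k, l`. -/
def quarticRelations : Set (MvPolynomial CoordVar ℂ) :=
  {P | ∃ (i j k l : Fin 4) (α₁ α₂ α₃ α₄ β₁ β₂ β₃ β₄ : Edge), [i, j, k, l].Nodup ∧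
    α₁.Joins {i} {j} ∧ α₂.Joins {j} {k} ∧ α₃.Joins {k} {l} ∧ α₄.Joins {l} {i} ∧
    β₁.Joins {i, k, l} {j, k, l} ∧ β₂.Joins {i, j, l} {i, k, l} ∧
    β₃.Joins {i, j, k} {i, j, l} ∧ β₄.Joins {j, k, l} {i, j, k} ∧
    P = x α₁ * x α₃ * x β₂ * x β₄ - x α₂ * x α₄ * x β₁ * x β₃}

/-- The topology of the affine space is the Zariski topology. -/
theorem isClosed_iff_zeroSet (Z : Set AffineSpace) : IsClosed Z ↔ ∃ S, Z = zeroSet S := by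
  have key : ∀ (S : Set (MvPolynomial CoordVar ℂ)),
      (fun z : AffineSpace => MvPolynomial.pointToPoint (k := ℂ) (K := ℂ) (σ := CoordVar) z) ⁻¹'
        PrimeSpectrum.zeroLocus S = zeroSet S := by
    intro S
    have aux : ∀ (w : CoordVar → ℂ) (P : MvPolynomial CoordVar ℂ),
        MvPolynomial.aeval w P = MvPolynomial.eval w P := fun w P => by
      rw [← MvPolynomial.coe_aeval_eq_eval]; rfl
    ext w
    constructor
    · intro h P hP
      exact (aux w P).symm.trans (h hP w (Set.mem_singleton _))
    · intro h P hP y hy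
      obtain rfl : y = w := hy
      exact (aux y P).trans (h P hP)
  rw [isClosed_induced_iff]
  constructor
  · rintro ⟨t, ht, rfl⟩
    obtain ⟨s, rfl⟩ := (PrimeSpectrum.isClosed_iff_zeroLocus t).1 ht
    exact ⟨s, key s⟩
  · rintro ⟨S, rfl⟩
    exact ⟨_, PrimeSpectrum.isClosed_zeroLocus S, key S⟩

/-- The variety defined by the linear and quadric relations alone. -/
def Uinc : Set AffineSpace := zeroSet (linearRelations ∪ quadricRelations)

/-- The irreducible components of a subset of the affine space, as subsets of the affine space. -/
def components (Z : Set AffineSpace) : Set (Set AffineSpace) :=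
  (fun s : Set Z => Subtype.val '' s) '' irreducibleComponents Z

end Tetrahedra

end

/-! A tetrahedron in the chart has vertices `(1, a_i, b_i, c_i)`, lines along which the next two
coordinates have slopes `s_ij` and `t_ij` against the first one, and planes whose equation for the
last coordinate has coefficient `-w_l` at the one before it. The edge coordinates are the
differences of the numbers `a_i`, `s_ij` and `-w_l`. Vertices lie on lines when `b_j - b_i = s_ij
(a_j - a_i)`, and lines lie in faces when `t_ik - t_ij = -w_l (s_ik - s_ij)`. Summing around a
triangle eliminates `b` and `t`, and what remains are the two kinds of quadrics. Conversely, the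
quadrics allow `b`, `t` and `c` to be rebuilt from `(a, s, w)` and three free numbers (`bVec_sub`,
`tMat_sub`, `cVec_sub`). So the chart is a set of configurations `(a, s, w)` times a 3-space, and
the nondegenerate tetrahedra correspond to the configurations `Gen` with all edge differences
nonzero (`gen_cfg`, `mem_Xo_of_gen`). The Euclidean closure `Lim` of `Gen` lands in the Zariski
closure, while polynomial identities on the orbit hold on all of `U`; it remains to show that the
listed relations force membership in `Lim` (`mem_Lim_of_relations`).

For distinct `a_i`, the `s_ij` are the first divided differences of `b`, and the second divided
difference over the face opposite `l` has the form `N_l = p + q a_l`. When enough `N_l` are nonzero,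
the second quadrics give `w_j - w_i = K N_k N_l (a_j - a_i)`. This is the polynomial parametrization
`fam`, whose values all lie in `Lim`. The cubic is, up to sign, a determinant of the first quadrics
read as a linear system for the differences of `a`; the quartic equates the cross-ratios of `a` and
`w`.

If `s` is not constant, quadrics and cubic suffice (`mem_Lim_of_cub`). When no adjacent values of
`s` agree, the cubic lets `a` be moved to distinct entries; when two agree, the cubic factors, and
each factor leads to an explicit degeneration. If `s` is constant, the quadrics are vacuous and the
quartic is what is needed (`const_mem_Lim`).

For the components: either `s` is constant, or the cubic holds and the point lies on `U`, or the
determinant is nonzero, which makes `a` constant and, by duality, `w` constant. Irreducibility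
follows because the polynomials vanishing on each piece are those vanishing on the image of an
entire map, and the ring of entire functions has no zero divisors. -/

namespace Tetrahedra

open Filter Topology

/-! ## Configurations -/

/-- A configuration: four numbers `a i` (vertices of `Δ₁`), a matrix `s i j` (vertices of `Δ₂`) and
four numbers `w i` (vertices of `Δ₃`, indexed by the complementary label). -/
abbrev Config : Type := (Fin 4 → ℂ) × (Fin 4 → Fin 4 → ℂ) × (Fin 4 → ℂ)

/-- The symmetric matrix with zero diagonal and given upper triangle. -/
def symm4 {R : Type*} [Zero R] (s01 s02 s03 s12 s13 s23 : R) : Fin 4 → Fin 4 → R :=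
  ![![0, s01, s02, s03], ![s01, 0, s12, s13], ![s02, s12, 0, s23], ![s03, s13, s23, 0]]

theorem eq_symm4 {R : Type*} [Zero R] {s : Fin 4 → Fin 4 → R} (h : ∀ i j, s i j = s j i)
    (h0 : ∀ i, s i i = 0) :
    s = symm4 (s 0 1) (s 0 2) (s 0 3) (s 1 2) (s 1 3) (s 2 3) := by
  funext i j
  fin_cases i <;> fin_cases j <;> simp [symm4, h0] <;> exact h _ _

/-- The incidence relations (the quadrics) for a configuration. -/
structure Inc (z : Config) : Prop where
  symm : ∀ i j, z.2.1 i j = z.2.1 j i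
  diag : ∀ i, z.2.1 i i = 0
  quad₁ : ∀ i j k, [i, j, k].Nodup →
    (z.1 j - z.1 i) * (z.2.1 i k - z.2.1 i j) = (z.1 k - z.1 j) * (z.2.1 j k - z.2.1 i k)
  quad₂ : ∀ i j k l, [i, j, k, l].Nodup →
    (z.2.1 j l - z.2.1 i l) * (z.2.2 k - z.2.2 j) = (z.2.1 k l - z.2.1 j l) * (z.2.2 j - z.2.2 i)

/-- The cubic relations. -/
def Cub (s : Fin 4 → Fin 4 → ℂ) : Prop :=
  ∀ i j k l, [i, j, k, l].Nodup →
    (s i l - s i j) * (s k l - s i k) * (s j l - s j k) =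
      (s k l - s j k) * (s j l - s i j) * (s i l - s i k)

/-- The quartic relations. -/
def Quar (a w : Fin 4 → ℂ) : Prop :=
  ∀ i j k l, [i, j, k, l].Nodup →
    (a j - a i) * (a l - a k) * (w k - w j) * (w i - w l) =
      (a k - a j) * (a i - a l) * (w j - w i) * (w l - w k)

/-- Up to sign the quadric depends only on the unordered triple, being the condition that the
increments of `b` around a triangle add up to zero. One equation for each omitted label is therefore
enough. -/
theorem quad₁_of {a : Fin 4 → ℂ} {s01 s02 s03 s12 s13 s23 : ℂ}
    (e3 : (a 1 - a 0) * (s02 - s01) = (a 2 - a 1) * (s12 - s02))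
    (e2 : (a 1 - a 0) * (s03 - s01) = (a 3 - a 1) * (s13 - s03))
    (e1 : (a 2 - a 0) * (s03 - s02) = (a 3 - a 2) * (s23 - s03))
    (e0 : (a 2 - a 1) * (s13 - s12) = (a 3 - a 2) * (s23 - s13)) (i j k : Fin 4)
    (h : [i, j, k].Nodup) :
    (a j - a i) * (symm4 s01 s02 s03 s12 s13 s23 i k - symm4 s01 s02 s03 s12 s13 s23 i j) =
      (a k - a j) * (symm4 s01 s02 s03 s12 s13 s23 j k - symm4 s01 s02 s03 s12 s13 s23 i k) := by
  fin_cases i <;> fin_cases j <;> fin_cases k <;> first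
    | exact absurd h (by decide)
    | (simp only [symm4, Fin.isValue, Fin.zero_eta, Fin.mk_one, Fin.reduceFinMk, Matrix.cons_val]
       first
        | linear_combination e0 | linear_combination -e0
        | linear_combination e1 | linear_combination -e1
        | linear_combination e2 | linear_combination -e2
        | linear_combination e3 | linear_combination -e3)

theorem quad₂_of {w : Fin 4 → ℂ} {s01 s02 s03 s12 s13 s23 : ℂ}
    (e3 : (s13 - s03) * (w 2 - w 1) = (s23 - s13) * (w 1 - w 0))
    (e2 : (s12 - s02) * (w 3 - w 1) = (s23 - s12) * (w 1 - w 0))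
    (e1 : (s12 - s01) * (w 3 - w 2) = (s13 - s12) * (w 2 - w 0))
    (e0 : (s02 - s01) * (w 3 - w 2) = (s03 - s02) * (w 2 - w 1)) (i j k l : Fin 4)
    (h : [i, j, k, l].Nodup) :
    (symm4 s01 s02 s03 s12 s13 s23 j l - symm4 s01 s02 s03 s12 s13 s23 i l) * (w k - w j) =
      (symm4 s01 s02 s03 s12 s13 s23 k l - symm4 s01 s02 s03 s12 s13 s23 j l) * (w j - w i) := by
  fin_cases i <;> fin_cases j <;> fin_cases k <;> fin_cases l <;> first
    | exact absurd h (by decide)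
    | (simp only [symm4, Fin.isValue, Fin.zero_eta, Fin.mk_one, Fin.reduceFinMk, Matrix.cons_val]
       first
        | linear_combination e0 | linear_combination -e0
        | linear_combination e1 | linear_combination -e1
        | linear_combination e2 | linear_combination -e2
        | linear_combination e3 | linear_combination -e3)

theorem cub_of {s01 s02 s03 s12 s13 s23 : ℂ}
    (e : (s03 - s01) * (s23 - s02) * (s13 - s12) = (s23 - s12) * (s13 - s01) * (s03 - s02)) :
    Cub (symm4 s01 s02 s03 s12 s13 s23) := by
  intro i j k l h
  fin_cases i <;> fin_cases j <;> fin_cases k <;> fin_cases l <;> first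
    | exact absurd h (by decide)
    | (simp only [symm4, Fin.isValue, Fin.zero_eta, Fin.mk_one, Fin.reduceFinMk, Matrix.cons_val]
       first
        | linear_combination e | linear_combination -e)

/-- The relation is a 2×2 minor in the products of opposite differences of `a` and of `w`, that is,
an equality of cross-ratios. Relabelling only changes its sign, so a single ordering suffices; the
cubic behaves in the same way. -/
theorem quar_of {a w : Fin 4 → ℂ}
    (e : (a 1 - a 0) * (a 3 - a 2) * (w 2 - w 1) * (w 0 - w 3) =
      (a 2 - a 1) * (a 0 - a 3) * (w 1 - w 0) * (w 3 - w 2)) : Quar a w := by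
  intro i j k l h
  fin_cases i <;> fin_cases j <;> fin_cases k <;> fin_cases l <;> first
    | exact absurd h (by decide)
    | (simp only [Fin.isValue, Fin.zero_eta, Fin.mk_one, Fin.reduceFinMk]
       first
        | linear_combination e | linear_combination -e)

/-- The action of permutations of the labels. -/
def permute (σ : Equiv.Perm (Fin 4)) (z : Config) : Config :=
  (fun i => z.1 (σ i), fun i j => z.2.1 (σ i) (σ j), fun i => z.2.2 (σ i))

/-- The duality exchanging `Δ₁` and `Δ₃`. -/
def dual (z : Config) : Config :=
  (z.2.2, symm4 (-z.2.1 2 3) (-z.2.1 1 3) (-z.2.1 1 2) (-z.2.1 0 3) (-z.2.1 0 2) (-z.2.1 0 1), z.1)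

theorem Inc.permute {z : Config} (h : Inc z) (σ : Equiv.Perm (Fin 4)) : Inc (permute σ z) where
  symm i j := h.symm _ _
  diag i := h.diag _
  quad₁ i j k hn := h.quad₁ _ _ _ (by simpa using hn.map σ.injective)
  quad₂ i j k l hn := h.quad₂ _ _ _ _ (by simpa using hn.map σ.injective)

theorem Cub.permute {z : Config} (h : Cub z.2.1) (σ : Equiv.Perm (Fin 4)) :
    Cub (permute σ z).2.1 :=
  fun i j k l hn => h _ _ _ _ (by simpa using hn.map σ.injective)

theorem Inc.eqs₂ {z : Config} (h : Inc z) :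
    (z.2.1 0 2 - z.2.1 0 1) * (z.2.2 3 - z.2.2 2) = (z.2.1 0 3 - z.2.1 0 2) * (z.2.2 2 - z.2.2 1) ∧
    (z.2.1 1 2 - z.2.1 0 1) * (z.2.2 3 - z.2.2 2) = (z.2.1 1 3 - z.2.1 1 2) * (z.2.2 2 - z.2.2 0) ∧
    (z.2.1 1 2 - z.2.1 0 2) * (z.2.2 3 - z.2.2 1) = (z.2.1 2 3 - z.2.1 1 2) * (z.2.2 1 - z.2.2 0) ∧
    (z.2.1 1 3 - z.2.1 0 3) * (z.2.2 2 - z.2.2 1) =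
      (z.2.1 2 3 - z.2.1 1 3) * (z.2.2 1 - z.2.2 0) := by
  have e0 := h.quad₂ 1 2 3 0 (by decide)
  have e1 := h.quad₂ 0 2 3 1 (by decide)
  have e2 := h.quad₂ 0 1 3 2 (by decide)
  have e3 := h.quad₂ 0 1 2 3 (by decide)
  rw [h.symm 2 0, h.symm 1 0, h.symm 3 0] at e0
  rw [h.symm 2 1, h.symm 3 1] at e1
  rw [h.symm 3 2] at e2
  exact ⟨e0, e1, e2, e3⟩

-- Projective duality: vertices and faces are exchanged and each line goes to the opposite one. The
-- minus sign on `s` turns the second quadrics into the first and conversely.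
set_option maxRecDepth 2000 in
theorem Inc.dual {z : Config} (h : Inc z) : Inc (dual z) where
  symm i j := by fin_cases i <;> fin_cases j <;> rfl
  diag i := by fin_cases i <;> rfl
  quad₁ := by
    obtain ⟨e0, e1, e2, e3⟩ := h.eqs₂
    refine quad₁_of (a := z.2.2) ?_ ?_ ?_ ?_
    · linear_combination -e3
    · linear_combination -e2
    · linear_combination -e1
    · linear_combination -e0
  quad₂ := by
    have e0 := h.quad₁ 1 2 3 (by decide)
    have e1 := h.quad₁ 0 2 3 (by decide)
    have e2 := h.quad₁ 0 1 3 (by decide)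
    have e3 := h.quad₁ 0 1 2 (by decide)
    refine quad₂_of (w := z.1) ?_ ?_ ?_ ?_
    · linear_combination -e3
    · linear_combination -e2
    · linear_combination -e1
    · linear_combination -e0

theorem Cub.dual {z : Config} (h : Cub z.2.1) : Cub (dual z).2.1 := by
  have e := h 0 1 2 3 (by decide)
  exact cub_of (by linear_combination -e)

theorem Quar.symm {a w : Fin 4 → ℂ} (h : Quar a w) : Quar w a := by
  have e := h 0 1 2 3 (by decide)
  exact quar_of (by linear_combination -e)

theorem dual_dual {z : Config} (h : Inc z) : dual (dual z) = z := by
  obtain ⟨a, s, w⟩ := z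
  have := eq_symm4 h.symm h.diag
  simp only at this
  simp only [dual]
  refine Prod.ext rfl (Prod.ext ?_ rfl)
  change _ = s
  rw [this]
  simp [symm4]

theorem permute_symm_permute (σ : Equiv.Perm (Fin 4)) (z : Config) :
    permute σ.symm (permute σ z) = z := by
  simp [permute]

/-- Configurations of nondegenerate tetrahedra. -/
structure Gen (z : Config) : Prop extends Inc z where
  a_ne : ∀ i j, i ≠ j → z.1 i ≠ z.1 j
  s_ne : ∀ i j k, [i, j, k].Nodup → z.2.1 i k ≠ z.2.1 j k
  w_ne : ∀ i j, i ≠ j → z.2.2 i ≠ z.2.2 j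

theorem Gen.permute {z : Config} (h : Gen z) (σ : Equiv.Perm (Fin 4)) : Gen (permute σ z) where
  toInc := h.toInc.permute σ
  a_ne i j hn := h.a_ne _ _ (σ.injective.ne hn)
  s_ne i j k hn := h.s_ne _ _ _ (by simpa using hn.map σ.injective)
  w_ne i j hn := h.w_ne _ _ (σ.injective.ne hn)

theorem Gen.dual {z : Config} (h : Gen z) : Gen (dual z) where
  toInc := h.toInc.dual
  a_ne i j hn := h.w_ne _ _ hn
  s_ne i j k hn := by
    fin_cases i <;> fin_cases j <;> fin_cases k <;> first
    | exact absurd hn (by decide)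
    | (simp only [Tetrahedra.dual, symm4, Fin.isValue, Fin.zero_eta, Fin.mk_one, Fin.reduceFinMk,
        Matrix.cons_val, ne_eq, neg_inj]
       first
        | exact h.s_ne _ _ _ (by decide)
        | (rw [h.symm]; exact h.s_ne _ _ _ (by decide))
        | (rw [h.symm, h.symm _ 3]; exact h.s_ne _ _ _ (by decide))
        | (rw [h.symm _ 3]; exact h.s_ne _ _ _ (by decide))
        | (rw [h.symm 0, h.symm 0]; exact h.s_ne _ _ _ (by decide))
        | (rw [h.symm 1, h.symm 1]; exact h.s_ne _ _ _ (by decide))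
        | (rw [h.symm 1]; exact h.s_ne _ _ _ (by decide)))
  w_ne i j hn := h.a_ne _ _ hn

/-- The limits of configurations of nondegenerate tetrahedra. -/
def Lim : Set Config := closure {z | Gen z}

theorem continuous_permute (σ : Equiv.Perm (Fin 4)) : Continuous (permute σ) := by
  unfold permute; fun_prop

theorem continuous_symm4 {T : Type*} [TopologicalSpace T] {f1 f2 f3 f4 f5 f6 : T → ℂ}
    (h1 : Continuous f1) (h2 : Continuous f2) (h3 : Continuous f3) (h4 : Continuous f4)
    (h5 : Continuous f5) (h6 : Continuous f6) :
    Continuous fun t => symm4 (f1 t) (f2 t) (f3 t) (f4 t) (f5 t) (f6 t) := by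
  refine continuous_pi fun i => continuous_pi fun j => ?_
  fin_cases i <;> fin_cases j <;> simp [symm4] <;> first | assumption | exact continuous_const

theorem continuous_dual : Continuous dual := by
  unfold dual
  exact Continuous.prodMk (by fun_prop) (Continuous.prodMk
    (continuous_symm4 (by fun_prop) (by fun_prop) (by fun_prop) (by fun_prop) (by fun_prop)
      (by fun_prop)) (by fun_prop))

theorem permute_mem_Lim {z : Config} (h : z ∈ Lim) (σ : Equiv.Perm (Fin 4)) :
    permute σ z ∈ Lim :=
  map_mem_closure (continuous_permute σ) h fun _ hz => Gen.permute hz σ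

theorem of_permute_mem_Lim {z : Config} (σ : Equiv.Perm (Fin 4)) (h : permute σ z ∈ Lim) :
    z ∈ Lim := by
  simpa [permute_symm_permute] using permute_mem_Lim h σ.symm

theorem of_dual_mem_Lim {z : Config} (hz : Inc z) (h : dual z ∈ Lim) : z ∈ Lim := by
  rw [← dual_dual hz]
  exact map_mem_closure continuous_dual h fun _ hz => Gen.dual hz

/-- As `Lim` is closed, the punctured curve only has to lie in `Lim`, not in `Gen`. This allows
degenerations to be performed one after another. -/
theorem mem_Lim_of_curve {γ : ℂ → Config} (hγ : Continuous γ)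
    (h : ∀ᶠ t in 𝓝[≠] (0 : ℂ), γ t ∈ Lim) : γ 0 ∈ Lim :=
  isClosed_closure.mem_of_tendsto (hγ.continuousAt.tendsto.mono_left nhdsWithin_le_nhds) h

theorem eventually_add_mul_ne {c d : ℂ} (hd : d ≠ 0) :
    ∀ᶠ t in 𝓝[≠] (0 : ℂ), c + t * d ≠ 0 := by
  have h : ∀ᶠ t in 𝓝[≠] (0 : ℂ), t ≠ -c / d := by
    by_cases hc : -c / d = 0
    · rw [hc]; exact eventually_mem_nhdsWithin
    · exact (eventually_ne_nhds (Ne.symm hc)).filter_mono nhdsWithin_le_nhds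
  filter_upwards [h] with t ht h0
  apply ht
  field_simp
  linear_combination h0

theorem exists_perm {i j k l : Fin 4} (h : [i, j, k, l].Nodup) :
    ∃ σ : Equiv.Perm (Fin 4), σ 0 = i ∧ σ 1 = j ∧ σ 2 = k ∧ σ 3 = l := by
  have hinj : Function.Injective ![i, j, k, l] := by
    have := List.nodup_iff_injective_get.1 h
    intro x y hxy
    apply this
    fin_cases x <;> fin_cases y <;> exact hxy
  exact ⟨Equiv.ofBijective _ (Finite.injective_iff_bijective.1 hinj), rfl, rfl, rfl, rfl⟩

end Tetrahedra

/-! ### The polynomial parametrization of nondegenerate configurations -/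

namespace Tetrahedra

open Filter Topology

/-- The family of configurations whose first component is `a` and whose differences are
`s_jk - s_ik = Y N_l (a_j - a_i)` and `w_j - w_i = K N_k N_l (a_j - a_i)`, where `N_i = p + q a_i`. -/
def fam (a : Fin 4 → ℂ) (p q K Y c d : ℂ) : Config :=
  (a, symm4 (c - Y * (p * (a 2 + a 3) + q * a 2 * a 3)) (c - Y * (p * (a 1 + a 3) + q * a 1 * a 3))
      (c - Y * (p * (a 1 + a 2) + q * a 1 * a 2)) (c - Y * (p * (a 0 + a 3) + q * a 0 * a 3))
      (c - Y * (p * (a 0 + a 2) + q * a 0 * a 2)) (c - Y * (p * (a 0 + a 1) + q * a 0 * a 1)),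
    ![d - K * (p ^ 2 * (a 1 + a 2 + a 3) + p * q * (a 1 * a 2 + a 1 * a 3 + a 2 * a 3) +
        q ^ 2 * (a 1 * a 2 * a 3)),
      d - K * (p ^ 2 * (a 0 + a 2 + a 3) + p * q * (a 0 * a 2 + a 0 * a 3 + a 2 * a 3) +
        q ^ 2 * (a 0 * a 2 * a 3)),
      d - K * (p ^ 2 * (a 0 + a 1 + a 3) + p * q * (a 0 * a 1 + a 0 * a 3 + a 1 * a 3) +
        q ^ 2 * (a 0 * a 1 * a 3)),
      d - K * (p ^ 2 * (a 0 + a 1 + a 2) + p * q * (a 0 * a 1 + a 0 * a 2 + a 1 * a 2) +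
        q ^ 2 * (a 0 * a 1 * a 2))])

theorem fam_s (a : Fin 4 → ℂ) (p q K Y c d : ℂ) (i j k l : Fin 4) (h : [i, j, k, l].Nodup) :
    (fam a p q K Y c d).2.1 j k - (fam a p q K Y c d).2.1 i k =
      Y * (p + q * a l) * (a j - a i) := by
  fin_cases i <;> fin_cases j <;> fin_cases k <;> fin_cases l <;> first
    | exact absurd h (by decide)
    | (simp only [fam, symm4, Fin.isValue, Fin.zero_eta, Fin.mk_one, Fin.reduceFinMk,
        Matrix.cons_val]
       ring)

theorem fam_w (a : Fin 4 → ℂ) (p q K Y c d : ℂ) (i j k l : Fin 4) (h : [i, j, k, l].Nodup) :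
    (fam a p q K Y c d).2.2 j - (fam a p q K Y c d).2.2 i =
      K * (p + q * a k) * (p + q * a l) * (a j - a i) := by
  fin_cases i <;> fin_cases j <;> fin_cases k <;> fin_cases l <;> first
    | exact absurd h (by decide)
    | (simp only [fam, Fin.isValue, Fin.zero_eta, Fin.mk_one, Fin.reduceFinMk,
        Matrix.cons_val]
       ring)

/-- Both sides of a first quadric are `Y N_l (a_j - a_i)(a_k - a_j)`, and both sides of a second one
are `Y K N_i N_k N_l (a_j - a_i)(a_k - a_j)`. -/
theorem fam_inc (a : Fin 4 → ℂ) (p q K Y c d : ℂ) : Inc (fam a p q K Y c d) where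
  symm i j := by fin_cases i <;> fin_cases j <;> rfl
  diag i := by fin_cases i <;> rfl
  quad₁ := by
    refine quad₁_of (a := a) ?_ ?_ ?_ ?_ <;> ring
  quad₂ := by
    refine quad₂_of ?_ ?_ ?_ ?_ <;>
    simp only [fam, Fin.isValue, Matrix.cons_val] <;> ring

theorem exists_fourth {i j k : Fin 4} (h : [i, j, k].Nodup) : ∃ l, [i, j, k, l].Nodup := by
  revert i j k; decide

theorem exists_third_fourth {i j : Fin 4} (h : i ≠ j) : ∃ k l, [i, j, k, l].Nodup := by
  revert i j; decide

theorem gen_fam {a : Fin 4 → ℂ} {p q K Y c d : ℂ} (ha : ∀ i j, i ≠ j → a i ≠ a j)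
    (hN : ∀ i, p + q * a i ≠ 0) (hK : K ≠ 0) (hY : Y ≠ 0) : Gen (fam a p q K Y c d) where
  toInc := fam_inc ..
  a_ne := ha
  s_ne i j k h := by
    obtain ⟨l, hl⟩ := exists_fourth h
    have := fam_s a p q K Y c d i j k l hl
    intro h0
    rw [h0, sub_self, eq_comm] at this
    have hij : i ≠ j := by rintro rfl; simp at h
    exact mul_ne_zero (mul_ne_zero hY (hN l)) (sub_ne_zero.2 (ha _ _ hij.symm)) this
  w_ne i j h := by
    obtain ⟨k, l, hl⟩ := exists_third_fourth h
    have := fam_w a p q K Y c d i j k l hl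
    intro h0
    rw [h0, sub_self, eq_comm] at this
    exact mul_ne_zero (mul_ne_zero (mul_ne_zero hK (hN k)) (hN l))
      (sub_ne_zero.2 (ha _ _ h.symm)) this

theorem continuous_fam {T : Type*} [TopologicalSpace T] {a : T → Fin 4 → ℂ}
    {p q K Y c d : T → ℂ} (ha : Continuous a) (hp : Continuous p) (hq : Continuous q)
    (hK : Continuous K) (hY : Continuous Y) (hc : Continuous c) (hd : Continuous d) :
    Continuous fun t => fam (a t) (p t) (q t) (K t) (Y t) (c t) (d t) := by
  unfold fam
  refine Continuous.prodMk ha (Continuous.prodMk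
    (continuous_symm4 (by fun_prop) (by fun_prop) (by fun_prop) (by fun_prop) (by fun_prop)
      (by fun_prop)) (continuous_pi fun i => ?_))
  fin_cases i <;> simp only [Fin.isValue, Fin.zero_eta, Fin.mk_one, Fin.reduceFinMk,
        Matrix.cons_val] <;> fun_prop

/-- Moving `p`, `K` and `Y` by `t` makes every `N_i`, `K` and `Y` nonzero for small `t ≠ 0`. `Y` is
kept beside `p`, `q`, `K` so that `Y = 0` gives constant `s` with nonconstant `w`. -/
theorem fam_mem_Lim_of_ne {a : Fin 4 → ℂ} (ha : ∀ i j, i ≠ j → a i ≠ a j) (p q K Y c d : ℂ) :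
    fam a p q K Y c d ∈ Lim := by
  have := mem_Lim_of_curve (γ := fun t => fam a (p + t * 1) q (K + t * 1) (Y + t * 1) c d)
    (continuous_fam (by fun_prop) (by fun_prop) (by fun_prop) (by fun_prop) (by fun_prop)
      (by fun_prop) (by fun_prop)) ?_
  · simpa using this
  · have h1 := fun i => eventually_add_mul_ne (c := p + q * a i) one_ne_zero
    rw [← eventually_all] at h1
    filter_upwards [eventually_add_mul_ne (c := K) one_ne_zero,
      eventually_add_mul_ne (c := Y) one_ne_zero, h1] with t hK hY hN
    refine subset_closure (gen_fam ha (fun i => ?_) hK hY)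
    convert hN i using 1
    ring

/-- The slopes used to separate the labels. -/
def sep : Fin 4 → ℂ := ![0, 1, 2, 3]

theorem sep_ne : ∀ i j, i ≠ j → sep j - sep i ≠ 0 := by
  intro i j h
  fin_cases i <;> fin_cases j <;> first | exact absurd rfl h | norm_num [sep]

theorem eventually_separated (a : Fin 4 → ℂ) :
    ∀ᶠ t in 𝓝[≠] (0 : ℂ), ∀ i j, i ≠ j → a i + t * sep i ≠ a j + t * sep j := by
  refine eventually_all.2 fun i => eventually_all.2 fun j => ?_
  by_cases hij : i = j
  · exact Eventually.of_forall fun t h => absurd hij h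
  · filter_upwards [eventually_add_mul_ne (c := a j - a i) (sep_ne i j hij)] with t ht _ h
    exact ht (by linear_combination -h)

/-- Since `fam` satisfies the quadrics for arbitrary `a`, coincidences among the `a i` are removed
by moving the labels at different speeds. -/
theorem fam_mem_Lim (a : Fin 4 → ℂ) (p q K Y c d : ℂ) : fam a p q K Y c d ∈ Lim := by
  have := mem_Lim_of_curve (γ := fun t => fam (fun i => a i + t * sep i) p q K Y c d)
    (continuous_fam (by fun_prop) (by fun_prop) (by fun_prop) (by fun_prop) (by fun_prop)
      (by fun_prop) (by fun_prop)) ?_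
  · simpa using this
  · filter_upwards [eventually_separated a] with t ht
    exact fam_mem_Lim_of_ne ht p q K Y c d

/-- Recognition criterion for the family: a spanning set of differences is tested, and the additive
constants `c` and `d` are read off from `s 0 1` and `w 0`. -/
theorem eq_fam {z : Config} (hz : Inc z) {p q K Y : ℂ}
    (h12 : z.2.1 1 2 - z.2.1 0 2 = Y * (p + q * z.1 3) * (z.1 1 - z.1 0))
    (h13 : z.2.1 1 3 - z.2.1 0 3 = Y * (p + q * z.1 2) * (z.1 1 - z.1 0))
    (h23 : z.2.1 2 3 - z.2.1 0 3 = Y * (p + q * z.1 1) * (z.1 2 - z.1 0))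
    (h02 : z.2.1 0 2 - z.2.1 0 1 = Y * (p + q * z.1 3) * (z.1 2 - z.1 1))
    (h03 : z.2.1 0 3 - z.2.1 0 1 = Y * (p + q * z.1 2) * (z.1 3 - z.1 1))
    (w1 : z.2.2 1 - z.2.2 0 = K * (p + q * z.1 2) * (p + q * z.1 3) * (z.1 1 - z.1 0))
    (w2 : z.2.2 2 - z.2.2 0 = K * (p + q * z.1 1) * (p + q * z.1 3) * (z.1 2 - z.1 0))
    (w3 : z.2.2 3 - z.2.2 0 = K * (p + q * z.1 1) * (p + q * z.1 2) * (z.1 3 - z.1 0)) :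
    ∃ c d, z = fam z.1 p q K Y c d := by
  refine ⟨z.2.1 0 1 + Y * (p * (z.1 2 + z.1 3) + q * z.1 2 * z.1 3), z.2.2 0 +
    K * (p ^ 2 * (z.1 1 + z.1 2 + z.1 3) + p * q * (z.1 1 * z.1 2 + z.1 1 * z.1 3 + z.1 2 * z.1 3) +
        q ^ 2 * (z.1 1 * z.1 2 * z.1 3)), ?_⟩
  refine Prod.ext rfl (Prod.ext ?_ ?_)
  · refine (eq_symm4 hz.symm hz.diag).trans ?_
    simp only [fam]
    congr 1
    · ring
    · linear_combination h02
    · linear_combination h03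
    · linear_combination h12 + h02
    · linear_combination h13 + h03
    · linear_combination h23 + h03
  · funext i
    fin_cases i <;> simp only [fam, Fin.isValue, Fin.zero_eta, Fin.mk_one, Fin.reduceFinMk,
        Matrix.cons_val]
    · ring
    · linear_combination w1
    · linear_combination w2
    · linear_combination w3

theorem Inc.eqs₁ {z : Config} (h : Inc z) :
    (z.1 2 - z.1 1) * (z.2.1 1 3 - z.2.1 1 2) = (z.1 3 - z.1 2) * (z.2.1 2 3 - z.2.1 1 3) ∧
    (z.1 2 - z.1 0) * (z.2.1 0 3 - z.2.1 0 2) = (z.1 3 - z.1 2) * (z.2.1 2 3 - z.2.1 0 3) ∧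
    (z.1 1 - z.1 0) * (z.2.1 0 3 - z.2.1 0 1) = (z.1 3 - z.1 1) * (z.2.1 1 3 - z.2.1 0 3) ∧
    (z.1 1 - z.1 0) * (z.2.1 0 2 - z.2.1 0 1) = (z.1 2 - z.1 1) * (z.2.1 1 2 - z.2.1 0 2) :=
  ⟨h.quad₁ 1 2 3 (by decide), h.quad₁ 0 2 3 (by decide), h.quad₁ 0 1 3 (by decide),
    h.quad₁ 0 1 2 (by decide)⟩

/-- If the `a i` are distinct, the first kind of quadrics determines `s` up to three parameters. -/
theorem exists_affine {z : Config} (hz : Inc z) (ha : ∀ i j, i ≠ j → z.1 i ≠ z.1 j) :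
    ∃ p q, z.2.1 1 2 - z.2.1 0 2 = (p + q * z.1 3) * (z.1 1 - z.1 0) ∧
      z.2.1 1 3 - z.2.1 0 3 = (p + q * z.1 2) * (z.1 1 - z.1 0) ∧
      z.2.1 2 3 - z.2.1 0 3 = (p + q * z.1 1) * (z.1 2 - z.1 0) ∧
      z.2.1 0 2 - z.2.1 0 1 = (p + q * z.1 3) * (z.1 2 - z.1 1) ∧
      z.2.1 0 3 - z.2.1 0 1 = (p + q * z.1 2) * (z.1 3 - z.1 1) := by
  obtain ⟨e0, e1, e2, e3⟩ := hz.eqs₁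
  have h10 := sub_ne_zero.2 (ha 1 0 (by decide))
  have h20 := sub_ne_zero.2 (ha 2 0 (by decide))
  have h32 := sub_ne_zero.2 (ha 3 2 (by decide))
  -- `r_l` is the second divided difference of `b` over the face opposite `l`; the quadric of that
  -- face says that it can be computed from any of its edges.
  obtain ⟨r3, hr3⟩ : ∃ r, z.2.1 1 2 - z.2.1 0 2 = r * (z.1 1 - z.1 0) :=
    ⟨(z.2.1 1 2 - z.2.1 0 2) / (z.1 1 - z.1 0), by field_simp⟩
  obtain ⟨r2, hr2⟩ : ∃ r, z.2.1 1 3 - z.2.1 0 3 = r * (z.1 1 - z.1 0) :=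
    ⟨(z.2.1 1 3 - z.2.1 0 3) / (z.1 1 - z.1 0), by field_simp⟩
  obtain ⟨r1, hr1⟩ : ∃ r, z.2.1 2 3 - z.2.1 0 3 = r * (z.1 2 - z.1 0) :=
    ⟨(z.2.1 2 3 - z.2.1 0 3) / (z.1 2 - z.1 0), by field_simp⟩
  have h02 : z.2.1 0 2 - z.2.1 0 1 = r3 * (z.1 2 - z.1 1) :=
    mul_left_cancel₀ h10 (by linear_combination e3 + (z.1 2 - z.1 1) * hr3)
  have h03 : z.2.1 0 3 - z.2.1 0 1 = r2 * (z.1 3 - z.1 1) :=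
    mul_left_cancel₀ h10 (by linear_combination e2 + (z.1 3 - z.1 1) * hr2)
  have h032 : z.2.1 0 3 - z.2.1 0 2 = r1 * (z.1 3 - z.1 2) :=
    mul_left_cancel₀ h20 (by linear_combination e1 + (z.1 3 - z.1 2) * hr1)
  -- Two ways of writing `s 0 3 - s 0 2` show that `r_1`, `r_2`, `r_3` are values of one affine
  -- function of `a`; `q` is its slope, minus the third divided difference of `b`.
  obtain ⟨q, hq⟩ : ∃ q, r3 - r2 = q * (z.1 3 - z.1 2) :=
    ⟨(r3 - r2) / (z.1 3 - z.1 2), by field_simp⟩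
  have hr : r1 = r2 + q * (z.1 1 - z.1 2) :=
    mul_left_cancel₀ h32 (by linear_combination -h032 + h03 - h02 - (z.1 2 - z.1 1) * hq)
  refine ⟨r2 - q * z.1 2, q, ?_, ?_, ?_, ?_, ?_⟩
  · linear_combination hr3 + (z.1 1 - z.1 0) * hq
  · linear_combination hr2
  · linear_combination hr1 + (z.1 2 - z.1 0) * hr
  · linear_combination h02 + (z.1 2 - z.1 1) * hq
  · linear_combination h03

/-- The hypotheses on `s` make `N_1`, `N_2`, `N_3` nonzero. Then `w 1 - w 0` defines `K`, and second
quadrics with nonzero leading factor propagate it to `w 2` and `w 3`. -/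
theorem exists_eq_fam {z : Config} (hz : Inc z) (ha : ∀ i j, i ≠ j → z.1 i ≠ z.1 j)
    (h1 : z.2.1 2 3 ≠ z.2.1 0 3) (h2 : z.2.1 1 3 ≠ z.2.1 0 3) (h3 : z.2.1 1 2 ≠ z.2.1 0 2) :
    ∃ p q K c d, z = fam z.1 p q K 1 c d := by
  obtain ⟨p, q, e12, e13, e23, e02, e03⟩ := exists_affine hz ha
  obtain ⟨e0, e1, e2, e3⟩ := hz.eqs₂
  have h10 := sub_ne_zero.2 (ha 1 0 (by decide))
  have h20 := sub_ne_zero.2 (ha 2 0 (by decide))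
  have n1 : p + q * z.1 1 ≠ 0 := fun h => h1 (sub_eq_zero.1 (by rw [e23, h, zero_mul]))
  have n2 : p + q * z.1 2 ≠ 0 := fun h => h2 (sub_eq_zero.1 (by rw [e13, h, zero_mul]))
  have n3 : p + q * z.1 3 ≠ 0 := fun h => h3 (sub_eq_zero.1 (by rw [e12, h, zero_mul]))
  obtain ⟨K, hK⟩ : ∃ K, z.2.2 1 - z.2.2 0 =
      K * (p + q * z.1 2) * (p + q * z.1 3) * (z.1 1 - z.1 0) :=
    ⟨(z.2.2 1 - z.2.2 0) / ((p + q * z.1 2) * (p + q * z.1 3) * (z.1 1 - z.1 0)), by field_simp⟩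
  have hW2 : z.2.2 2 - z.2.2 1 = K * (p + q * z.1 0) * (p + q * z.1 3) * (z.1 2 - z.1 1) := by
    refine mul_left_cancel₀ (sub_ne_zero.2 h2) ?_
    rw [e3, hK, e13, show z.2.1 2 3 - z.2.1 1 3 = (p + q * z.1 0) * (z.1 2 - z.1 1) by
      linear_combination e23 - e13]
    ring
  have hW3 : z.2.2 3 - z.2.2 1 = K * (p + q * z.1 0) * (p + q * z.1 2) * (z.1 3 - z.1 1) := by
    refine mul_left_cancel₀ (sub_ne_zero.2 h3) ?_
    rw [e2, hK, e12, show z.2.1 2 3 - z.2.1 1 2 = (p + q * z.1 0) * (z.1 3 - z.1 1) by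
      linear_combination e23 - e12 + e03 - e02]
    ring
  obtain ⟨c, d, h⟩ := eq_fam hz (Y := 1) (K := K) (p := p) (q := q) (by linear_combination e12)
    (by linear_combination e13) (by linear_combination e23) (by linear_combination e02)
    (by linear_combination e03) hK (by linear_combination hK + hW2) (by linear_combination hK + hW3)
  exact ⟨p, q, K, c, d, h⟩

/-- The second component of a configuration is constant. -/
def SConst (s : Fin 4 → Fin 4 → ℂ) : Prop := ∀ i j k, [i, j, k].Nodup → s j k = s i k

/-- With `a` distinct, a nonconstant `s` leaves at most one `N_i` equal to zero. Relabelling makes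
this index 0, after which the configuration is in the family. -/
theorem mem_Lim_of_a_ne {z : Config} (hz : Inc z) (ha : ∀ i j, i ≠ j → z.1 i ≠ z.1 j)
    (hs : ¬ SConst z.2.1) : z ∈ Lim := by
  obtain ⟨p, q, e12, e13, e23, e02, e03⟩ := exists_affine hz ha
  have hall : ∀ i j k l, [i, j, k, l].Nodup →
      z.2.1 j k - z.2.1 i k = (p + q * z.1 l) * (z.1 j - z.1 i) := by
    obtain ⟨a, s, w⟩ := z
    have hs' := eq_symm4 hz.symm hz.diag
    simp only at hs' e12 e13 e23 e02 e03 ⊢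
    rw [hs']
    intro i j k l h
    fin_cases i <;> fin_cases j <;> fin_cases k <;> fin_cases l <;> first
    | exact absurd h (by decide)
    | (simp only [symm4, Fin.isValue, Fin.zero_eta, Fin.mk_one, Fin.reduceFinMk,
        Matrix.cons_val]
       first
        | linear_combination e12 | linear_combination -e12
        | linear_combination e13 | linear_combination -e13
        | linear_combination e23 | linear_combination -e23
        | linear_combination e02 | linear_combination -e02
        | linear_combination e03 | linear_combination -e03
        | linear_combination e02 + e12 | linear_combination -e02 - e12
        | linear_combination e03 + e13 | linear_combination -e03 - e13
        | linear_combination e23 - e13 | linear_combination e13 - e23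
        | linear_combination e02 - e03 | linear_combination e03 - e02
        | linear_combination e03 + e13 - e02 - e12 | linear_combination e02 + e12 - e03 - e13
        | linear_combination e23 + e03 - e02 | linear_combination e02 - e23 - e03
        | linear_combination e23 + e03 - e02 - e12 | linear_combination e12 + e02 - e23 - e03)
  -- Two zeros of `p + q x` at distinct points would give `p = q = 0` and hence a constant `s`.
  obtain ⟨m, hm⟩ : ∃ m, ∀ i, i ≠ m → p + q * z.1 i ≠ 0 := by
    by_contra! hcon
    obtain ⟨i, -, hi⟩ := hcon 0
    obtain ⟨j, hj, hj'⟩ := hcon i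
    have hq : q = 0 := by
      have : q * (z.1 i - z.1 j) = 0 := by linear_combination hi - hj'
      exact (mul_eq_zero.1 this).resolve_right (sub_ne_zero.2 (ha _ _ hj.symm))
    have hp : p = 0 := by simpa [hq] using hi
    refine hs fun i j k h => ?_
    obtain ⟨l, hl⟩ := exists_fourth h
    have := hall i j k l hl
    rw [hp, hq] at this
    linear_combination this
  refine of_permute_mem_Lim (Equiv.swap 0 m) ?_
  have hne : ∀ i j k l : Fin 4, [i, j, k, l].Nodup → l ≠ 0 →
      (permute (Equiv.swap 0 m) z).2.1 j k ≠ (permute (Equiv.swap 0 m) z).2.1 i k := by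
    intro i j k l h hl
    have hn : [Equiv.swap 0 m i, Equiv.swap 0 m j, Equiv.swap 0 m k, Equiv.swap 0 m l].Nodup := by
      simpa using h.map (Equiv.swap 0 m).injective
    have := hall _ _ _ _ hn
    refine sub_ne_zero.1 ?_
    rw [show (permute (Equiv.swap 0 m) z).2.1 j k - (permute (Equiv.swap 0 m) z).2.1 i k = _
      from this]
    refine mul_ne_zero (hm _ fun h0 => hl ?_) (sub_ne_zero.2 (ha _ _ fun h0 => ?_))
    · rw [Equiv.swap_apply_eq_iff] at h0
      simpa using h0
    · simp [h0] at hn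
  obtain ⟨p', q', K, c, d, h⟩ := exists_eq_fam (hz.permute (Equiv.swap 0 m))
    (fun i j hij => ha _ _ ((Equiv.swap 0 m).injective.ne hij))
    (hne 0 2 3 1 (by decide) (by decide)) (hne 0 1 3 2 (by decide) (by decide))
    (hne 0 1 2 3 (by decide) (by decide))
  rw [h]
  exact fam_mem_Lim _ _ _ _ _ _ _

end Tetrahedra

/-! ### Degenerate configurations as limits along explicit curves -/

namespace Tetrahedra

open Filter Topology

theorem vec4_eq {a : Fin 4 → ℂ} {x0 x1 x2 x3 : ℂ} (h0 : a 0 = x0) (h1 : a 1 = x1) (h2 : a 2 = x2)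
    (h3 : a 3 = x3) : a = ![x0, x1, x2, x3] := by
  funext i; fin_cases i <;> assumption

theorem continuous_vec4 {T : Type*} [TopologicalSpace T] {f0 f1 f2 f3 : T → ℂ}
    (h0 : Continuous f0) (h1 : Continuous f1) (h2 : Continuous f2) (h3 : Continuous f3) :
    Continuous fun t => ![f0 t, f1 t, f2 t, f3 t] := by
  refine continuous_pi fun i => ?_
  fin_cases i <;> assumption

theorem continuous_config {T : Type*} [TopologicalSpace T]
    {f0 f1 f2 f3 g0 g1 g2 g3 g4 g5 h0 h1 h2 h3 : T → ℂ}
    (h : Continuous fun t => ![f0 t, f1 t, f2 t, f3 t, g0 t, g1 t, g2 t, g3 t, g4 t, g5 t, h0 t,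
      h1 t, h2 t, h3 t]) :
    Continuous fun t => ((![f0 t, f1 t, f2 t, f3 t],
      symm4 (g0 t) (g1 t) (g2 t) (g3 t) (g4 t) (g5 t), ![h0 t, h1 t, h2 t, h3 t]) : Config) := by
  have h' := fun i => (continuous_apply i).comp h
  exact (continuous_vec4 (h' 0) (h' 1) (h' 2) (h' 3)).prodMk
    ((continuous_symm4 (h' 4) (h' 5) (h' 6) (h' 7) (h' 8) (h' 9)).prodMk
      (continuous_vec4 (h' 10) (h' 11) (h' 12) (h' 13)))

theorem inc_of {a w : Fin 4 → ℂ} {s01 s02 s03 s12 s13 s23 : ℂ}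
    (e3 : (a 1 - a 0) * (s02 - s01) = (a 2 - a 1) * (s12 - s02))
    (e2 : (a 1 - a 0) * (s03 - s01) = (a 3 - a 1) * (s13 - s03))
    (e1 : (a 2 - a 0) * (s03 - s02) = (a 3 - a 2) * (s23 - s03))
    (e0 : (a 2 - a 1) * (s13 - s12) = (a 3 - a 2) * (s23 - s13))
    (f3 : (s13 - s03) * (w 2 - w 1) = (s23 - s13) * (w 1 - w 0))
    (f2 : (s12 - s02) * (w 3 - w 1) = (s23 - s12) * (w 1 - w 0))
    (f1 : (s12 - s01) * (w 3 - w 2) = (s13 - s12) * (w 2 - w 0))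
    (f0 : (s02 - s01) * (w 3 - w 2) = (s03 - s02) * (w 2 - w 1)) :
    Inc (a, symm4 s01 s02 s03 s12 s13 s23, w) where
  symm i j := by fin_cases i <;> fin_cases j <;> rfl
  diag i := by fin_cases i <;> rfl
  quad₁ := quad₁_of e3 e2 e1 e0
  quad₂ := quad₂_of f3 f2 f1 f0

theorem pairwise_ne4 {a : Fin 4 → ℂ} (h01 : a 1 - a 0 ≠ 0) (h02 : a 2 - a 0 ≠ 0)
    (h03 : a 3 - a 0 ≠ 0) (h12 : a 2 - a 1 ≠ 0) (h13 : a 3 - a 1 ≠ 0) (h23 : a 3 - a 2 ≠ 0) :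
    ∀ i j, i ≠ j → a i ≠ a j := by
  intro i j hij h
  fin_cases i <;> fin_cases j <;> first
    | exact absurd rfl hij
    | (simp only [Fin.isValue, Fin.zero_eta, Fin.mk_one, Fin.reduceFinMk] at h
       first | exact h01 (by rw [h, sub_self]) | exact h02 (by rw [h, sub_self])
             | exact h03 (by rw [h, sub_self]) | exact h12 (by rw [h, sub_self])
             | exact h13 (by rw [h, sub_self]) | exact h23 (by rw [h, sub_self]))

/-- Here `s` is constant on the three lines of a face and exceeds that value by `x`, `y`, `z` on the
others. The differences of `a` are products such as `k z (y - x)` and `k x y`, so a generic choice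
of `k, x, y, z` makes `a` distinct without leaving the quadrics. -/
theorem face_family_mem_Lim (m k c x y z w v : ℂ) :
    ((![m - k * y * z, m - k * x * z, m - k * x * y, m],
      symm4 c c (c + x) c (c + y) (c + z), ![w, w, w, v]) : Config) ∈ Lim := by
  -- The speeds 1, 2, 3 keep `x`, `y`, `z` nonzero and pairwise different for small `t ≠ 0`.
  have key := mem_Lim_of_curve (γ := fun t => ((![m - (k + t * 1) * (y + t * 2) * (z + t * 3),
      m - (k + t * 1) * (x + t * 1) * (z + t * 3), m - (k + t * 1) * (x + t * 1) * (y + t * 2), m],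
      symm4 c c (c + (x + t * 1)) c (c + (y + t * 2)) (c + (z + t * 3)), ![w, w, w, v]) : Config))
      (continuous_config (by fun_prop)) ?_
  · simpa using key
  · filter_upwards [eventually_add_mul_ne (c := k) (d := 1) (by norm_num),
      eventually_add_mul_ne (c := x) (d := 1) (by norm_num),
      eventually_add_mul_ne (c := y) (d := 2) (by norm_num),
      eventually_add_mul_ne (c := z) (d := 3) (by norm_num),
      eventually_add_mul_ne (c := y - x) (d := 1) (by norm_num),
      eventually_add_mul_ne (c := z - x) (d := 2) (by norm_num),
      eventually_add_mul_ne (c := z - y) (d := 1) (by norm_num)] with t hk hx hy hz hxy hxz hyz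
    refine mem_Lim_of_a_ne (inc_of ?_ ?_ ?_ ?_ ?_ ?_ ?_ ?_) (pairwise_ne4 ?_ ?_ ?_ ?_ ?_ ?_) ?_
    any_goals (simp only [Fin.isValue, Matrix.cons_val]; ring1)
    · convert mul_ne_zero (mul_ne_zero hk hz) hxy using 1
      simp only [Fin.isValue, Matrix.cons_val]; ring
    · convert mul_ne_zero (mul_ne_zero hk hy) hxz using 1
      simp only [Fin.isValue, Matrix.cons_val]; ring
    · convert mul_ne_zero (mul_ne_zero hk hy) hz using 1
      simp only [Fin.isValue, Matrix.cons_val]; ring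
    · convert mul_ne_zero (mul_ne_zero hk hx) hyz using 1
      simp only [Fin.isValue, Matrix.cons_val]; ring
    · convert mul_ne_zero (mul_ne_zero hk hx) hz using 1
      simp only [Fin.isValue, Matrix.cons_val]; ring
    · convert mul_ne_zero (mul_ne_zero hk hx) hy using 1
      simp only [Fin.isValue, Matrix.cons_val]; ring
    · intro h
      have := h 1 3 0 (by decide)
      simp [symm4] at this
      exact hx (by linear_combination this)

/-- Two nonzero increments of `s` force `w 0 = w 1 = w 2` by the second quadrics, and the first
quadrics then express the differences of `a` through one number `k`. -/
theorem face_mem_Lim {z : Config} (hz : Inc z) (h1 : z.2.1 0 2 = z.2.1 0 1)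
    (h2 : z.2.1 1 2 = z.2.1 0 1) (hx : z.2.1 0 3 ≠ z.2.1 0 1) (hy : z.2.1 1 3 ≠ z.2.1 0 1) :
    z ∈ Lim := by
  obtain ⟨e0, e1, e2, e3⟩ := hz.eqs₁
  obtain ⟨f0, f1, f2, f3⟩ := hz.eqs₂
  have hx' := sub_ne_zero.2 hx
  have hy' := sub_ne_zero.2 hy
  rw [h1] at f0 e1
  rw [h2] at f1 e0
  have hw2 : z.2.2 2 = z.2.2 1 := by
    have : (z.2.1 0 3 - z.2.1 0 1) * (z.2.2 2 - z.2.2 1) = 0 := by linear_combination -f0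
    exact sub_eq_zero.1 ((mul_eq_zero.1 this).resolve_left hx')
  have hw0 : z.2.2 2 = z.2.2 0 := by
    have : (z.2.1 1 3 - z.2.1 0 1) * (z.2.2 2 - z.2.2 0) = 0 := by linear_combination -f1
    exact sub_eq_zero.1 ((mul_eq_zero.1 this).resolve_left hy')
  obtain ⟨k, hk⟩ : ∃ k, z.1 3 - z.1 2 = k * (z.2.1 0 3 - z.2.1 0 1) * (z.2.1 1 3 - z.2.1 0 1) :=
    ⟨(z.1 3 - z.1 2) / ((z.2.1 0 3 - z.2.1 0 1) * (z.2.1 1 3 - z.2.1 0 1)), by field_simp⟩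
  have hk1 : z.1 3 - z.1 1 = k * (z.2.1 0 3 - z.2.1 0 1) * (z.2.1 2 3 - z.2.1 0 1) :=
    mul_left_cancel₀ hy' (by linear_combination e0 + (z.2.1 2 3 - z.2.1 0 1) * hk)
  have hk0 : z.1 3 - z.1 0 = k * (z.2.1 1 3 - z.2.1 0 1) * (z.2.1 2 3 - z.2.1 0 1) :=
    mul_left_cancel₀ hx' (by linear_combination e1 + (z.2.1 2 3 - z.2.1 0 1) * hk)
  have := face_family_mem_Lim (z.1 3) k (z.2.1 0 1) (z.2.1 0 3 - z.2.1 0 1) (z.2.1 1 3 - z.2.1 0 1)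
    (z.2.1 2 3 - z.2.1 0 1) (z.2.2 2) (z.2.2 3)
  convert this using 1
  refine Prod.ext (vec4_eq ?_ ?_ ?_ rfl) (Prod.ext ?_ (vec4_eq hw0.symm hw2.symm rfl rfl))
  · linear_combination -hk0
  · linear_combination -hk1
  · linear_combination -hk
  · refine (eq_symm4 hz.symm hz.diag).trans ?_
    simp only [h1, h2, add_sub_cancel]

/-- The limit lets `a 2` and `a 3` collide at the zero `m` of `N`, so that `N_2` and `N_3` are of
order `t`, while `K = 1 / t` blows up. The products `K N_1 N_3` and `K N_1 N_2` stay finite and `K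
N_2 N_3` tends to zero. -/
theorem vertex_family_mem_Lim_of_ne (a0 a1 m w v2 v3 c r : ℂ) (h0 : a0 - m ≠ 0)
    (h1 : a1 - m ≠ 0) :
    ((![a0, a1, m, m], symm4 c c c c c (c + r), ![w, w, w + v2, w + v3]) : Config) ∈ Lim := by
  -- The velocities `b2`, `b3` and the factor `y` are chosen so that the limits of `w 2 - w 0`, `w 3
  -- - w 0` and `s 2 3 - s 0 3` are `v2`, `v3` and `r`.
  set b3 := -v2 / ((a0 - m) * (a1 - m)) with hb3
  set b2 := -v3 / ((a0 - m) * (a1 - m)) with hb2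
  set y := -r / ((a0 - m) * (a1 - m)) with hy
  have hv2 : v2 = -(b3 * ((a0 - m) * (a1 - m))) := by rw [hb3]; field_simp
  have hv3 : v3 = -(b2 * ((a0 - m) * (a1 - m))) := by rw [hb2]; field_simp
  have hr : r = -(y * ((a0 - m) * (a1 - m))) := by rw [hy]; field_simp
  clear_value b3 b2 y
  subst hv2 hv3 hr
  have key := mem_Lim_of_curve (γ := fun t => ((![a0, a1, m + t * b2, m + t * b3],
      symm4 (c - y * t ^ 2 * b2 * b3) (c - y * (a1 - m) * t * b3) (c - y * (a1 - m) * t * b2)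
        (c - y * (a0 - m) * t * b3) (c - y * (a0 - m) * t * b2) (c - y * (a0 - m) * (a1 - m)),
      ![w, w + t * b2 * b3 * (a1 - a0), w + (a1 - m) * b3 * (m + t * b2 - a0),
        w + (a1 - m) * b2 * (m + t * b3 - a0)]) : Config))
      (continuous_config (by fun_prop)) ?_
  · convert key using 1
    simp only [zero_mul, add_zero, ne_eq, OfNat.ofNat_ne_zero, not_false_eq_true, zero_pow,
      mul_zero, sub_zero]
    congr 3 <;> ring_nf
  · filter_upwards [eventually_mem_nhdsWithin] with t (ht : t ≠ 0)
    obtain ⟨c', d, h⟩ := eq_fam (z := (![a0, a1, m + t * b2, m + t * b3],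
      symm4 (c - y * t ^ 2 * b2 * b3) (c - y * (a1 - m) * t * b3) (c - y * (a1 - m) * t * b2)
        (c - y * (a0 - m) * t * b3) (c - y * (a0 - m) * t * b2) (c - y * (a0 - m) * (a1 - m)),
      ![w, w + t * b2 * b3 * (a1 - a0), w + (a1 - m) * b3 * (m + t * b2 - a0),
        w + (a1 - m) * b2 * (m + t * b3 - a0)]))
      (by
        refine inc_of ?_ ?_ ?_ ?_ ?_ ?_ ?_ ?_ <;>
        (simp only [Fin.isValue, Matrix.cons_val]; ring))
      (p := -m) (q := 1) (K := 1 / t) (Y := y)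
      (by simp only [symm4, Fin.isValue, Matrix.cons_val]; ring)
      (by simp only [symm4, Fin.isValue, Matrix.cons_val]; ring)
      (by simp only [symm4, Fin.isValue, Matrix.cons_val]; ring)
      (by simp only [symm4, Fin.isValue, Matrix.cons_val]; ring)
      (by simp only [symm4, Fin.isValue, Matrix.cons_val]; ring)
      (by simp only [Fin.isValue, Matrix.cons_val]; field_simp; ring)
      (by simp only [Fin.isValue, Matrix.cons_val]; field_simp; ring)
      (by simp only [Fin.isValue, Matrix.cons_val]; field_simp; ring)
    rw [h]
    exact fam_mem_Lim _ _ _ _ _ _ _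

theorem vertex_family_mem_Lim (a0 a1 m w v2 v3 c r : ℂ) :
    ((![a0, a1, m, m], symm4 c c c c c (c + r), ![w, w, w + v2, w + v3]) : Config) ∈ Lim := by
  have key := mem_Lim_of_curve (γ := fun t => ((![a0 + t * 1, a1 + t * 1, m, m],
    symm4 c c c c c (c + r), ![w, w, w + v2, w + v3]) : Config)) (continuous_config (by fun_prop)) ?_
  · simpa using key
  · filter_upwards [eventually_add_mul_ne (c := a0 - m) one_ne_zero,
      eventually_add_mul_ne (c := a1 - m) one_ne_zero] with t h0 h1
    refine vertex_family_mem_Lim_of_ne _ _ _ _ _ _ _ _ ?_ ?_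
    · convert h0 using 1; ring
    · convert h1 using 1; ring

/-- Configurations in which `s` is constant except possibly at one vertex. -/
theorem vertex_mem_Lim {z : Config} (hz : Inc z) (h1 : z.2.1 0 2 = z.2.1 0 1)
    (h2 : z.2.1 1 2 = z.2.1 0 1) (h3 : z.2.1 0 3 = z.2.1 0 1) (h4 : z.2.1 1 3 = z.2.1 0 1)
    (ha : z.1 2 = z.1 3) (hw : z.2.2 1 = z.2.2 0) : z ∈ Lim := by
  convert vertex_family_mem_Lim (z.1 0) (z.1 1) (z.1 3) (z.2.2 0) (z.2.2 2 - z.2.2 0)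
    (z.2.2 3 - z.2.2 0) (z.2.1 0 1) (z.2.1 2 3 - z.2.1 0 1) using 1
  refine Prod.ext (vec4_eq rfl rfl ha rfl) (Prod.ext ?_ (vec4_eq rfl hw (by ring) (by ring)))
  refine (eq_symm4 hz.symm hz.diag).trans ?_
  simp only [h1, h2, h3, h4, add_sub_cancel]

/-- Lines `02, 12` share a slope and so do `03, 13`; vertices 0 and 1 have the same `a`. Once `k` is
made nonzero the configuration belongs to the family, without separating `a 0` from `a 1`. -/
theorem parallel_family_mem_Lim (a k m w al be ga de : ℂ) (h2 : be - de ≠ 0) (h3 : al - de ≠ 0) :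
    ((![a, a, a + k * (de - be), a + k * (de - al)], symm4 ga al be al be de,
      ![w, w, w + m * (al - ga), w + m * (be - ga)]) : Config) ∈ Lim := by
  have key := mem_Lim_of_curve (γ := fun t => ((![a, a, a + (k + t * 1) * (de - be),
      a + (k + t * 1) * (de - al)], symm4 ga al be al be de,
      ![w, w, w + m * (al - ga), w + m * (be - ga)]) : Config)) (continuous_config (by fun_prop)) ?_
  · simpa using key
  · filter_upwards [eventually_add_mul_ne (c := k) one_ne_zero] with t ht
    generalize k + t * 1 = k at ht
    have h2' : de - be ≠ 0 := by rw [← neg_sub]; exact neg_ne_zero.2 h2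
    have h3' : de - al ≠ 0 := by rw [← neg_sub]; exact neg_ne_zero.2 h3
    -- The normalization is `N_0 = N_1 = 1` with `Y = 1 / k`. Then `al - ga = (de - be) N_3`
    -- determines `q`, and `w 3 - w 2` determines `K`.
    obtain ⟨c', d, h⟩ := eq_fam (z := (![a, a, a + k * (de - be), a + k * (de - al)],
      symm4 ga al be al be de, ![w, w, w + m * (al - ga), w + m * (be - ga)]))
      (by
        refine inc_of ?_ ?_ ?_ ?_ ?_ ?_ ?_ ?_ <;>
        (simp only [Fin.isValue, Matrix.cons_val]; ring))
      (p := 1 - (al + be - ga - de) / (k * (de - be) * (de - al)) * a)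
      (q := (al + be - ga - de) / (k * (de - be) * (de - al))) (K := m / k) (Y := 1 / k)
      (by simp only [symm4, Fin.isValue, Matrix.cons_val]; ring)
      (by simp only [symm4, Fin.isValue, Matrix.cons_val]; ring)
      (by simp only [symm4, Fin.isValue, Matrix.cons_val]; field_simp; ring)
      (by simp only [symm4, Fin.isValue, Matrix.cons_val]; field_simp; ring)
      (by simp only [symm4, Fin.isValue, Matrix.cons_val]; field_simp; ring)
      (by simp only [Fin.isValue, Matrix.cons_val]; ring)
      (by simp only [Fin.isValue, Matrix.cons_val]; field_simp; ring)
      (by simp only [Fin.isValue, Matrix.cons_val]; field_simp; ring)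
    rw [h]
    exact fam_mem_Lim _ _ _ _ _ _ _

theorem parallel_mem_Lim {z : Config} (hz : Inc z) (h1 : z.2.1 1 2 = z.2.1 0 2)
    (h2 : z.2.1 1 3 = z.2.1 0 3) (h3 : z.2.1 0 2 ≠ z.2.1 0 1)
    (h5 : z.2.1 0 3 ≠ z.2.1 2 3) (h6 : z.2.1 0 2 ≠ z.2.1 2 3) : z ∈ Lim := by
  obtain ⟨e0, e1, e2, e3⟩ := hz.eqs₁
  obtain ⟨f0, f1, f2, f3⟩ := hz.eqs₂
  have h3' := sub_ne_zero.2 h3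
  have h5' := sub_ne_zero.2 h5
  have h6' := sub_ne_zero.2 h6
  have ha : z.1 1 = z.1 0 := by
    rw [h1, sub_self, mul_zero] at e3
    exact sub_eq_zero.1 ((mul_eq_zero.1 e3).resolve_right h3')
  have hw : z.2.2 1 = z.2.2 0 := by
    rw [h2, sub_self, zero_mul, eq_comm] at f3
    refine sub_eq_zero.1 ((mul_eq_zero.1 f3).resolve_left ?_)
    exact sub_ne_zero.2 h5.symm
  obtain ⟨k, hk⟩ : ∃ k, z.1 2 - z.1 0 = k * (z.2.1 0 3 - z.2.1 2 3) :=
    ⟨(z.1 2 - z.1 0) / (z.2.1 0 3 - z.2.1 2 3), by field_simp⟩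
  obtain ⟨m, hm⟩ : ∃ m, z.2.2 2 - z.2.2 0 = m * (z.2.1 0 2 - z.2.1 0 1) :=
    ⟨(z.2.2 2 - z.2.2 0) / (z.2.1 0 2 - z.2.1 0 1), by field_simp⟩
  have hk3 : z.1 3 - z.1 0 = k * (z.2.1 0 2 - z.2.1 2 3) :=
    mul_left_cancel₀ h5' (by linear_combination e1 + (z.2.1 0 2 - z.2.1 2 3) * hk)
  have hm3 : z.2.2 3 - z.2.2 0 = m * (z.2.1 0 3 - z.2.1 0 1) :=
    mul_left_cancel₀ h3' (by
      rw [hw] at f0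
      linear_combination f0 + (z.2.1 0 3 - z.2.1 0 1) * hm)
  convert parallel_family_mem_Lim (z.1 0) (-k) m (z.2.2 0) (z.2.1 0 2) (z.2.1 0 3) (z.2.1 0 1)
    (z.2.1 2 3) h5' h6' using 1
  refine Prod.ext (vec4_eq rfl ha ?_ ?_) (Prod.ext ?_ (vec4_eq rfl hw ?_ ?_))
  · linear_combination hk
  · linear_combination hk3
  · refine (eq_symm4 hz.symm hz.diag).trans ?_
    simp only [h1, h2]
  · linear_combination hm
  · linear_combination hm3

/-- For fixed `s` the first quadrics are linear in `a`, and the cubic makes this system consistent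
with nonconstant `a`. Adding `t` times such a solution makes the `a i` distinct while `s` and `w`
stay fixed. -/
theorem generic_mem_Lim {z : Config} (hz : Inc z) (hc : Cub z.2.1)
    (hs : ∀ i j k, [i, j, k].Nodup → z.2.1 i k ≠ z.2.1 j k) : z ∈ Lim := by
  obtain ⟨e0, e1, e2, e3⟩ := hz.eqs₁
  obtain ⟨f0, f1, f2, f3⟩ := hz.eqs₂
  have hH := hc 0 1 2 3 (by decide)
  have n1 := sub_ne_zero.2 (hs 1 0 2 (by decide))
  have n2 := sub_ne_zero.2 (hs 2 0 1 (by decide))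
  have n3 := sub_ne_zero.2 (hs 3 0 1 (by decide))
  have n4 := sub_ne_zero.2 (hs 1 0 3 (by decide))
  have n5 := sub_ne_zero.2 (hs 2 1 0 (by decide))
  have n6 := sub_ne_zero.2 (hs 3 1 0 (by decide))
  have n7 := sub_ne_zero.2 (hs 2 1 3 (by decide))
  have n8 := sub_ne_zero.2 (hs 2 0 3 (by decide))
  have n9 := sub_ne_zero.2 (hs 3 0 2 (by decide))
  have n10 := sub_ne_zero.2 (hs 3 2 1 (by decide))
  rw [hz.symm 3 1, hz.symm 2 1] at n10
  rw [hz.symm 2 1] at n2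
  rw [hz.symm 3 1] at n3
  rw [hz.symm 2 0, hz.symm 1 0] at n5
  rw [hz.symm 3 0, hz.symm 1 0] at n6
  rw [hz.symm 3 2] at n9
  obtain ⟨a, s, w⟩ := z
  simp only at *
  have hs4 : s = _ := eq_symm4 hz.symm hz.diag
  generalize s 0 1 = s01 at *
  generalize s 0 2 = s02 at *
  generalize s 0 3 = s03 at *
  generalize s 1 2 = s12 at *
  generalize s 1 3 = s13 at *
  generalize s 2 3 = s23 at *
  subst hs4
  -- The direction solves the equations of the triangles `012` and `013`, which give the ratios of
  -- `a 2 - a 0` and `a 3 - a 0` to `a 1 - a 0`. The other two triangles then follow from the cubic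
  -- `hH`.
  have key := mem_Lim_of_curve (γ := fun t => ((![a 0,
      a 1 + t * ((s12 - s02) * (s13 - s03)), a 2 + t * ((s12 - s01) * (s13 - s03)),
      a 3 + t * ((s12 - s02) * (s13 - s01))],
      symm4 s01 s02 s03 s12 s13 s23, ![w 0, w 1, w 2, w 3]) : Config))
      (continuous_config (by fun_prop)) ?_
  · convert key using 1
    refine Prod.ext (vec4_eq ?_ ?_ ?_ ?_) (Prod.ext rfl (vec4_eq rfl rfl rfl rfl)) <;> ring
  · have m12 : (s12 - s01) * (s13 - s03) - (s12 - s02) * (s13 - s03) ≠ 0 := by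
      convert mul_ne_zero n4 n5 using 1; ring
    have m13 : (s12 - s02) * (s13 - s01) - (s12 - s02) * (s13 - s03) ≠ 0 := by
      convert mul_ne_zero n1 n6 using 1; ring
    -- This is the only difference of the direction that does not visibly factor; by the cubic, its
    -- vanishing would kill a product of nonzero slope differences.
    have m23 : (s12 - s02) * (s13 - s01) - (s12 - s01) * (s13 - s03) ≠ 0 := by
      intro h
      refine mul_ne_zero (mul_ne_zero n5 n4) n10 ?_
      linear_combination (s23 - s13) * h + hH
    filter_upwards [eventually_add_mul_ne (c := a 1 - a 0) (mul_ne_zero n1 n4),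
      eventually_add_mul_ne (c := a 2 - a 0) (mul_ne_zero n2 n4),
      eventually_add_mul_ne (c := a 3 - a 0) (mul_ne_zero n1 n3),
      eventually_add_mul_ne (c := a 2 - a 1) m12,
      eventually_add_mul_ne (c := a 3 - a 1) m13,
      eventually_add_mul_ne (c := a 3 - a 2) m23] with t k1 k2 k3 k12 k13 k23
    refine mem_Lim_of_a_ne (inc_of ?_ ?_ ?_ ?_ ?_ ?_ ?_ ?_) (pairwise_ne4 ?_ ?_ ?_ ?_ ?_ ?_) ?_ <;>
      simp only [Fin.isValue, Matrix.cons_val]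
    · linear_combination e3
    · linear_combination e2
    · linear_combination e1 + t * hH
    · linear_combination e0 + t * hH
    · exact f3
    · exact f2
    · exact f1
    · exact f0
    · convert k1 using 1; ring
    · convert k2 using 1; ring
    · convert k3 using 1; ring
    · convert k12 using 1; ring
    · convert k13 using 1; ring
    · convert k23 using 1; ring
    · intro h
      exact hs _ _ _ (by decide) (h 1 2 3 (by decide))

end Tetrahedra

/-! ### Classification of the configurations with nonconstant second component -/

namespace Tetrahedra

open Filter Topology

theorem SConst.of_eqs {z : Config} (hz : Inc z) (h1 : z.2.1 0 2 = z.2.1 0 1)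
    (h2 : z.2.1 0 3 = z.2.1 0 1) (h3 : z.2.1 1 2 = z.2.1 0 1) (h4 : z.2.1 1 3 = z.2.1 0 1)
    (h5 : z.2.1 2 3 = z.2.1 0 1) : SConst z.2.1 := by
  obtain ⟨a, s, w⟩ := z
  have hs := eq_symm4 hz.symm hz.diag
  simp only at *
  rw [hs, h1, h2, h3, h4, h5]
  intro i j k h
  fin_cases i <;> fin_cases j <;> fin_cases k <;> first
    | exact absurd h (by decide)
    | simp [symm4]

theorem SConst.permute {z : Config} (h : SConst z.2.1) (σ : Equiv.Perm (Fin 4)) :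
    SConst (permute σ z).2.1 :=
  fun i j k hn => h _ _ _ (by simpa using hn.map σ.injective)

theorem SConst.of_permute {z : Config} {σ : Equiv.Perm (Fin 4)}
    (h : SConst (Tetrahedra.permute σ z).2.1) : SConst z.2.1 := by
  simpa [permute_symm_permute] using h.permute σ.symm

theorem SConst.eq {z : Config} (hz : Inc z) (h : SConst z.2.1) :
    z.2.1 0 2 = z.2.1 0 1 ∧ z.2.1 0 3 = z.2.1 0 1 ∧ z.2.1 1 2 = z.2.1 0 1 ∧
      z.2.1 1 3 = z.2.1 0 1 ∧ z.2.1 2 3 = z.2.1 0 1 := by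
  have h1 := h 1 2 0 (by decide)
  have h2 := h 1 3 0 (by decide)
  have h3 := h 0 2 1 (by decide)
  have h4 := h 0 3 1 (by decide)
  have h5 := h 0 3 2 (by decide)
  rw [hz.symm 2 0, hz.symm 1 0] at h1
  rw [hz.symm 3 0, hz.symm 1 0] at h2
  rw [hz.symm 2 1] at h3
  rw [hz.symm 3 1] at h4
  rw [hz.symm 3 2] at h5
  exact ⟨h1, h2, h3, h4, h5.trans h1⟩

theorem SConst.of_dual {z : Config} (hz : Inc z) (h : SConst (dual z).2.1) : SConst z.2.1 := by
  obtain ⟨h1, h2, h3, h4, h5⟩ := SConst.eq hz.dual h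
  simp [dual, symm4] at h1 h2 h3 h4 h5
  exact SConst.of_eqs hz (by rw [h4, h5]) (by rw [h3, h5]) (by rw [h2, h5]) (by rw [h1, h5])
    (by rw [h5])

/-- The quadrics force the cubic relations unless the first component is constant. -/
theorem cub_of_a_ne {z : Config} (hz : Inc z) {i j : Fin 4} (h : z.1 i ≠ z.1 j) : Cub z.2.1 := by
  obtain ⟨e0, e1, e2, e3⟩ := hz.eqs₁
  obtain ⟨a, s, w⟩ := z
  have hs := eq_symm4 hz.symm hz.diag
  simp only at *
  rw [hs]
  generalize s 0 1 = s01 at *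
  generalize s 0 2 = s02 at *
  generalize s 0 3 = s03 at *
  generalize s 1 2 = s12 at *
  generalize s 1 3 = s13 at *
  generalize s 2 3 = s23 at *
  refine cub_of (sub_eq_zero.1 ?_)
  by_contra hD
  -- Cramer's rule for the quadrics of the triangles `012`, `013`, `023`: their determinant is, up
  -- to sign, the difference of the two sides of the cubic.
  have h1 : a 1 = a 0 := sub_eq_zero.1 <| (mul_eq_zero.1 (show
    (a 1 - a 0) * ((s03 - s01) * (s23 - s02) * (s13 - s12) -
      (s23 - s12) * (s13 - s01) * (s03 - s02)) = 0 by
    linear_combination (s23 - s02) * (s13 - s03) * e3 -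
      (s23 - s03) * (s12 - s02) * e2 + (s12 - s02) * (s13 - s03) * e1)).resolve_right hD
  have h2 : a 2 = a 0 := sub_eq_zero.1 <| (mul_eq_zero.1 (show
    (a 2 - a 0) * ((s03 - s01) * (s23 - s02) * (s13 - s12) -
      (s23 - s12) * (s13 - s01) * (s03 - s02)) = 0 by
    linear_combination (s13 - s01) * (s23 - s03) * e3 -
      (s23 - s03) * (s12 - s01) * e2 + (s13 - s03) * (s12 - s01) * e1)).resolve_right hD
  have h3 : a 3 = a 0 := sub_eq_zero.1 <| (mul_eq_zero.1 (show
    (a 3 - a 0) * ((s03 - s01) * (s23 - s02) * (s13 - s12) -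
      (s23 - s12) * (s13 - s01) * (s03 - s02)) = 0 by
    linear_combination (s13 - s01) * (s23 - s02) * e3 -
      (s23 - s02) * (s12 - s01) * e2 + (s13 - s01) * (s12 - s02) * e1)).resolve_right hD
  apply h
  fin_cases i <;> fin_cases j <;> simp [h1, h2, h3]

/-- The cubic is self-dual, so `w` can play the role of `a`. -/
theorem cub_of_w_ne {z : Config} (hz : Inc z) {i j : Fin 4} (h : z.2.2 i ≠ z.2.2 j) :
    Cub z.2.1 := by
  have := (cub_of_a_ne hz.dual (i := i) (j := j) h).dual
  rwa [dual_dual hz] at this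

/-- Only `s 2 3` differs from the other values; the quadrics containing this difference give `a 2 =
a 3` and `w 1 = w 0`. -/
theorem edge_face_mem_Lim {z : Config} (hz : Inc z) (hs : ¬ SConst z.2.1)
    (h1 : z.2.1 0 2 = z.2.1 0 1) (h2 : z.2.1 1 2 = z.2.1 0 1) (hx : z.2.1 0 3 = z.2.1 0 1)
    (hy : z.2.1 1 3 = z.2.1 0 1) : z ∈ Lim := by
  have hzc : z.2.1 2 3 ≠ z.2.1 0 1 := fun h => hs (SConst.of_eqs hz h1 hx h2 hy h)
  obtain ⟨e0, e1, e2, e3⟩ := hz.eqs₁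
  obtain ⟨f0, f1, f2, f3⟩ := hz.eqs₂
  rw [hy, h2] at e0
  rw [hy, hx] at f3
  refine vertex_mem_Lim hz h1 h2 hx hy ?_ ?_
  · refine (sub_eq_zero.1 ((mul_eq_zero.1 ?_).resolve_right (sub_ne_zero.2 hzc))).symm
    linear_combination -e0
  · refine sub_eq_zero.1 ((mul_eq_zero.1 ?_).resolve_left (sub_ne_zero.2 hzc))
    linear_combination -f3

/-- The face `012` has constant slope, and `s` being nonconstant, at least one of the three
remaining lines deviates. One deviation is the case of a single exceptional line, two or more allow
`face_mem_Lim` after relabelling. -/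
theorem const_face_mem_Lim {z : Config} (hz : Inc z) (hs : ¬ SConst z.2.1)
    (h1 : z.2.1 0 2 = z.2.1 0 1) (h2 : z.2.1 1 2 = z.2.1 0 1) : z ∈ Lim := by
  have h10 := hz.symm 1 0
  have h20 := hz.symm 2 0
  have h21 := hz.symm 2 1
  by_cases hx : z.2.1 0 3 = z.2.1 0 1 <;> by_cases hy : z.2.1 1 3 = z.2.1 0 1
  · exact edge_face_mem_Lim hz hs h1 h2 hx hy
  · by_cases hzc : z.2.1 2 3 = z.2.1 0 1
    · refine of_permute_mem_Lim (Equiv.swap 1 2) (edge_face_mem_Lim (hz.permute _)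
        (fun h => hs h.of_permute) ?_ ?_ ?_ ?_)
      · change z.2.1 0 1 = z.2.1 0 2; rw [h1]
      · change z.2.1 2 1 = z.2.1 0 2; rw [h21, h1, h2]
      · change z.2.1 0 3 = z.2.1 0 2; rw [hx, h1]
      · change z.2.1 2 3 = z.2.1 0 2; rw [hzc, h1]
    · refine of_permute_mem_Lim (Equiv.swap 0 2) (face_mem_Lim (hz.permute _) ?_ ?_ ?_ ?_)
      · change z.2.1 2 0 = z.2.1 2 1; rw [h20, h21, h1, h2]
      · change z.2.1 1 0 = z.2.1 2 1; rw [h10, h21, h2]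
      · change z.2.1 2 3 ≠ z.2.1 2 1; rwa [h21, h2]
      · change z.2.1 1 3 ≠ z.2.1 2 1; rwa [h21, h2]
  · by_cases hzc : z.2.1 2 3 = z.2.1 0 1
    · refine of_permute_mem_Lim (Equiv.swap 0 2) (edge_face_mem_Lim (hz.permute _)
        (fun h => hs h.of_permute) ?_ ?_ ?_ ?_)
      · change z.2.1 2 0 = z.2.1 2 1; rw [h20, h21, h1, h2]
      · change z.2.1 1 0 = z.2.1 2 1; rw [h10, h21, h2]
      · change z.2.1 2 3 = z.2.1 2 1; rw [hzc, h21, h2]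
      · change z.2.1 1 3 = z.2.1 2 1; rw [hy, h21, h2]
    · refine of_permute_mem_Lim (Equiv.swap 1 2) (face_mem_Lim (hz.permute _) ?_ ?_ ?_ ?_)
      · change z.2.1 0 1 = z.2.1 0 2; rw [h1]
      · change z.2.1 2 1 = z.2.1 0 2; rw [h21, h1, h2]
      · change z.2.1 0 3 ≠ z.2.1 0 2; rwa [h1]
      · change z.2.1 2 3 ≠ z.2.1 0 2; rwa [h1]
  · exact face_mem_Lim hz h1 h2 hx hy

theorem const_face_mem_Lim' {z : Config} (hz : Inc z) (hs : ¬ SConst z.2.1)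
    (h1 : z.2.1 0 3 = z.2.1 0 1) (h2 : z.2.1 1 3 = z.2.1 0 1) : z ∈ Lim := by
  refine of_permute_mem_Lim (Equiv.swap 2 3) (const_face_mem_Lim (hz.permute _)
    (fun h => hs h.of_permute) ?_ ?_)
  · exact h1
  · exact h2

/-- The three lines through a vertex have equal slope; their opposites bound a face, so this is dual
to the preceding case. -/
theorem const_vertex_mem_Lim {z : Config} (hz : Inc z) (hs : ¬ SConst z.2.1)
    (h1 : z.2.1 1 2 = z.2.1 0 2) (h2 : z.2.1 2 3 = z.2.1 0 2) : z ∈ Lim := by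
  refine of_dual_mem_Lim hz (const_face_mem_Lim' hz.dual (fun h => hs (.of_dual hz h)) ?_ ?_)
  · simp [dual, symm4, h1, h2]
  · simp [dual, symm4, h2]

theorem const_vertex_mem_Lim' {z : Config} (hz : Inc z) (hs : ¬ SConst z.2.1)
    (h1 : z.2.1 1 3 = z.2.1 0 3) (h2 : z.2.1 2 3 = z.2.1 0 3) : z ∈ Lim := by
  refine of_permute_mem_Lim (Equiv.swap 2 3) (const_vertex_mem_Lim (hz.permute _)
    (fun h => hs h.of_permute) ?_ ?_)
  · exact h1
  · exact (hz.symm 3 2).trans h2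

/-- A configuration satisfying the quadrics and the cubics whose second component is not constant
is a limit of configurations of nondegenerate tetrahedra. -/
theorem mem_Lim_of_cub {z : Config} (hz : Inc z) (hc : Cub z.2.1) (hs : ¬ SConst z.2.1) :
    z ∈ Lim := by
  by_cases hall : ∀ i j k, [i, j, k].Nodup → z.2.1 i k ≠ z.2.1 j k
  · exact generic_mem_Lim hz hc hall
  push Not at hall
  obtain ⟨i, j, k, hn, h⟩ := hall
  obtain ⟨l, hl⟩ := exists_fourth hn
  obtain ⟨σ, h0, h1, h2, h3⟩ := exists_perm hl
  refine of_permute_mem_Lim σ ?_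
  have h02 : (permute σ z).2.1 1 2 = (permute σ z).2.1 0 2 := by
    simp [permute, h0, h1, h2, h]
  replace hs : ¬ SConst (permute σ z).2.1 := fun h => hs h.of_permute
  replace hc := hc.permute σ
  replace hz := hz.permute σ
  generalize permute σ z = z at *
  have hH := hc 0 1 2 3 (by decide)
  -- With `s 1 2 = s 0 2` the cubic factors as `(s 1 3 - s 0 3)(s 0 2 - s 0 1)(s 2 3 - s 0 2) = 0`.
  -- The three factors correspond to a constant face, a constant vertex star, and a second
  -- coincidence on the parallel edge of the octahedron.
  by_cases c1 : z.2.1 0 2 = z.2.1 0 1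
  · exact const_face_mem_Lim hz hs c1 (h02.trans c1)
  by_cases c2 : z.2.1 2 3 = z.2.1 0 2
  · exact const_vertex_mem_Lim hz hs h02 c2
  have c3 : z.2.1 1 3 = z.2.1 0 3 := by
    rw [h02] at hH
    refine sub_eq_zero.1 ((mul_eq_zero.1 ?_).resolve_right
      (mul_ne_zero (sub_ne_zero.2 c1) (sub_ne_zero.2 c2)))
    linear_combination hH
  by_cases c5 : z.2.1 2 3 = z.2.1 0 3
  · exact const_vertex_mem_Lim' hz hs c3 c5
  exact parallel_mem_Lim hz h02 c3 c1 (Ne.symm c5) (Ne.symm c2)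

/-! ### Configurations with constant second component -/

theorem inc_const (a w : Fin 4 → ℂ) (c : ℂ) : Inc (a, symm4 c c c c c c, w) := by
  refine inc_of ?_ ?_ ?_ ?_ ?_ ?_ ?_ ?_ <;> simp

theorem permute_const (a w : Fin 4 → ℂ) (c : ℂ) (σ : Equiv.Perm (Fin 4)) :
    permute σ (a, symm4 c c c c c c, w) =
      (fun i => a (σ i), symm4 c c c c c c, fun i => w (σ i)) := by
  refine Prod.ext rfl (Prod.ext ?_ rfl)
  have hs : ∀ i j, symm4 c c c c c c i j = if i = j then 0 else c := by
    intro i j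
    fin_cases i <;> fin_cases j <;> simp [symm4]
  funext i j
  simp [permute, hs]

/-- Placing the zero of `N` at `a 3` kills every difference of `w` not involving label 3, and `K` is
adjusted to the remaining one. The choice `Y = 0` makes `s` constant. -/
theorem const_mem_Lim_of_triple {a w : Fin 4 → ℂ} (c : ℂ) (ha : ∀ i j, i ≠ j → a i ≠ a j)
    (h1 : w 1 = w 0) (h2 : w 2 = w 0) : ((a, symm4 c c c c c c, w) : Config) ∈ Lim := by
  have n1 := sub_ne_zero.2 (ha 1 3 (by decide))
  have n2 := sub_ne_zero.2 (ha 2 3 (by decide))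
  have n0 := sub_ne_zero.2 (ha 3 0 (by decide))
  obtain ⟨c', d, h⟩ := eq_fam (inc_const a w c) (p := -a 3) (q := 1) (Y := 0)
    (K := (w 3 - w 0) / ((a 1 - a 3) * (a 2 - a 3) * (a 3 - a 0)))
    (by simp [symm4]) (by simp [symm4]) (by simp [symm4]) (by simp [symm4]) (by simp [symm4])
    (by simp [h1]) (by simp [h2])
    (by simp only [neg_add_eq_sub, one_mul]; field_simp)
  rw [h]
  exact fam_mem_Lim _ _ _ _ _ _ _

theorem const_mem_Lim_of_a_w_ne {a w : Fin 4 → ℂ} (c : ℂ) (hq : Quar a w)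
    (ha : ∀ i j, i ≠ j → a i ≠ a j) (hw : ∀ i j, i ≠ j → w i ≠ w j) :
    ((a, symm4 c c c c c c, w) : Config) ∈ Lim := by
  have q1 := hq 0 1 2 3 (by decide)
  have q2 := hq 0 2 1 3 (by decide)
  have a10 := sub_ne_zero.2 (ha 1 0 (by decide))
  have a20 := sub_ne_zero.2 (ha 2 0 (by decide))
  have a30 := sub_ne_zero.2 (ha 3 0 (by decide))
  have a21 := sub_ne_zero.2 (ha 2 1 (by decide))
  have a31 := sub_ne_zero.2 (ha 3 1 (by decide))
  have a32 := sub_ne_zero.2 (ha 3 2 (by decide))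
  have w10 := sub_ne_zero.2 (hw 1 0 (by decide))
  have w21 := sub_ne_zero.2 (hw 2 1 (by decide))
  have w31 := sub_ne_zero.2 (hw 3 1 (by decide))
  obtain ⟨v01, h01⟩ : ∃ v, w 1 - w 0 = v * (a 1 - a 0) := ⟨_, (div_mul_cancel₀ _ a10).symm⟩
  obtain ⟨v02, h02⟩ : ∃ v, w 2 - w 0 = v * (a 2 - a 0) := ⟨_, (div_mul_cancel₀ _ a20).symm⟩
  obtain ⟨v03, h03⟩ : ∃ v, w 3 - w 0 = v * (a 3 - a 0) := ⟨_, (div_mul_cancel₀ _ a30).symm⟩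
  obtain ⟨v12, h12⟩ : ∃ v, w 2 - w 1 = v * (a 2 - a 1) := ⟨_, (div_mul_cancel₀ _ a21).symm⟩
  obtain ⟨v13, h13⟩ : ∃ v, w 3 - w 1 = v * (a 3 - a 1) := ⟨_, (div_mul_cancel₀ _ a31).symm⟩
  have n01 : v01 ≠ 0 := fun h => w10 (by rw [h01, h, zero_mul])
  have n12 : v12 ≠ 0 := fun h => w21 (by rw [h12, h, zero_mul])
  have n13 : v13 ≠ 0 := fun h => w31 (by rw [h13, h, zero_mul])
  -- Equality of cross-ratios, written in terms of the slopes `v_ij` of `w` against `a`.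
  have hcr : v12 * v03 = v02 * v13 := by
    have hne : (a 2 - a 0) * (a 3 - a 1) * ((a 2 - a 1) * (a 3 - a 0)) ≠ 0 :=
      mul_ne_zero (mul_ne_zero a20 a31) (mul_ne_zero a21 a30)
    refine mul_left_cancel₀ hne ?_
    rw [show w 1 - w 2 = -(v12 * (a 2 - a 1)) by linear_combination -h12,
      show w 0 - w 3 = -(v03 * (a 3 - a 0)) by linear_combination -h03, h02, h13] at q2
    linear_combination q2
  have cy2 : v01 * (a 1 - a 0) - v02 * (a 2 - a 0) + v12 * (a 2 - a 1) = 0 := by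
    rw [← h01, ← h02, ← h12]; ring
  have cy3 : v01 * (a 1 - a 0) - v03 * (a 3 - a 0) + v13 * (a 3 - a 1) = 0 := by
    rw [← h01, ← h03, ← h13]; ring
  -- The requirement is `v_ij = K N_k N_l`. It is solved by `N_0 = v12 v13`, `N_1 = v02 v13`, `N_2 =
  -- v01 v13`, `N_3 = v01 v12`, `K = 1 / (v01 v12 v13)`, where `hcr` handles `v03`. The cycle
  -- relations `cy2`, `cy3` show that these `N_i` are affine in `a`.
  obtain ⟨q, hq⟩ : ∃ q, v02 * v13 - v12 * v13 = q * (a 1 - a 0) :=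
    ⟨_, (div_mul_cancel₀ _ a10).symm⟩
  obtain ⟨p, hp⟩ : ∃ p, p = v12 * v13 - q * a 0 := ⟨_, rfl⟩
  have N1 : p + q * a 1 = v02 * v13 := by linear_combination hp - hq
  have N2 : p + q * a 2 = v01 * v13 :=
    mul_right_cancel₀ a10 (by linear_combination (a 1 - a 0) * hp - (a 2 - a 0) * hq - v13 * cy2)
  have N3 : p + q * a 3 = v01 * v12 :=
    mul_right_cancel₀ a10 (by
      linear_combination (a 1 - a 0) * hp - (a 3 - a 0) * hq - v12 * cy3 - (a 3 - a 0) * hcr)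
  obtain ⟨c', d, h⟩ := eq_fam (inc_const a w c) (p := p) (q := q) (Y := 0)
    (K := 1 / (v01 * v12 * v13))
    (by simp [symm4]) (by simp [symm4]) (by simp [symm4]) (by simp [symm4]) (by simp [symm4])
    (by simp only [N2, N3]; rw [h01]; field_simp)
    (by simp only [N1, N3]; rw [h02]; field_simp)
    (by
      simp only [N1, N2]
      rw [h03]
      field_simp
      linear_combination hcr)
  rw [h]
  exact fam_mem_Lim _ _ _ _ _ _ _

theorem Quar.comp {a w : Fin 4 → ℂ} (h : Quar a w) (σ : Equiv.Perm (Fin 4)) :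
    Quar (fun i => a (σ i)) (fun i => w (σ i)) :=
  fun i j k l hn => h _ _ _ _ (by simpa using hn.map σ.injective)

/-- If two of the `w i` coincide while the `a i` are distinct, equality of cross-ratios forces a
third one to coincide with them. -/
theorem const_mem_Lim_of_a_ne {a w : Fin 4 → ℂ} (c : ℂ) (hq : Quar a w)
    (ha : ∀ i j, i ≠ j → a i ≠ a j) : ((a, symm4 c c c c c c, w) : Config) ∈ Lim := by
  by_cases hw : ∀ i j, i ≠ j → w i ≠ w j
  · exact const_mem_Lim_of_a_w_ne c hq ha hw
  push Not at hw
  obtain ⟨i, j, hij, h⟩ := hw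
  obtain ⟨k, l, hl⟩ := exists_third_fourth hij
  obtain ⟨σ, h0, h1, h2, h3⟩ := exists_perm hl
  refine of_permute_mem_Lim σ ?_
  rw [permute_const]
  replace hq := hq.comp σ
  replace ha := fun i j hij => ha (σ i) (σ j) (σ.injective.ne hij)
  have hw : w (σ 1) = w (σ 0) := by rw [h0, h1, h]
  have q := hq 0 1 2 3 (by decide)
  simp only [hw, sub_self, mul_zero, zero_mul, mul_eq_zero, or_assoc, sub_eq_zero] at q
  rcases q with q | q | q | q
  · exact absurd q (ha _ _ (by decide))
  · exact absurd q (ha _ _ (by decide))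
  · exact const_mem_Lim_of_triple c ha hw q
  · refine of_permute_mem_Lim (Equiv.swap 2 3) ?_
    rw [permute_const]
    exact const_mem_Lim_of_triple c
      (fun i j hij => ha _ _ ((Equiv.swap (2 : Fin 4) 3).injective.ne hij)) hw q.symm

theorem const_mem_Lim_of_dual {a w : Fin 4 → ℂ} {c : ℂ}
    (h : ((w, symm4 (-c) (-c) (-c) (-c) (-c) (-c), a) : Config) ∈ Lim) :
    ((a, symm4 c c c c c c, w) : Config) ∈ Lim :=
  of_dual_mem_Lim (inc_const a w c) h

/-- All products of differences over opposite edges vanish: at least three of the four numbers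
coincide. -/
def TripleEq (a : Fin 4 → ℂ) : Prop :=
  (a 1 - a 0) * (a 3 - a 2) = 0 ∧ (a 2 - a 0) * (a 3 - a 1) = 0

theorem const_mem_Lim_of_tripleEq {a w : Fin 4 → ℂ} (c : ℂ) (ha : TripleEq a) :
    ((a, symm4 c c c c c c, w) : Config) ∈ Lim := by
  have key := mem_Lim_of_curve (γ := fun t => ((a, symm4 c c c c c c,
    fun i => w i + t * sep i) : Config)) (by fun_prop) ?_
  · simpa using key
  · filter_upwards [eventually_separated w] with t ht
    -- When three of the `a i` agree, both sides of the quartic vanish for every `w`, so `w` may be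
    -- made distinct and the dual of the previous case applies.
    refine const_mem_Lim_of_dual (const_mem_Lim_of_a_ne _ (Quar.symm (quar_of ?_)) ht)
    have h3 : (a 2 - a 1) * (a 0 - a 3) = 0 := by linear_combination ha.1 - ha.2
    rw [ha.1, h3]
    ring

theorem const_mem_Lim_of_eq {a w : Fin 4 → ℂ} (c : ℂ) (hq : Quar a w) (ha : a 1 = a 0) :
    ((a, symm4 c c c c c c, w) : Config) ∈ Lim := by
  by_cases ht : TripleEq a
  · exact const_mem_Lim_of_tripleEq c ht
  by_cases ht' : TripleEq w
  · exact const_mem_Lim_of_dual (const_mem_Lim_of_tripleEq _ ht')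
  have a20 : a 2 - a 0 ≠ 0 := fun h => ht ⟨by rw [ha]; ring, by rw [h]; ring⟩
  have a30 : a 3 - a 0 ≠ 0 := fun h => ht ⟨by rw [ha]; ring, by rw [ha, h]; ring⟩
  have a03 : a 0 - a 3 ≠ 0 := by rw [← neg_sub]; exact neg_ne_zero.2 a30
  -- Given `a 1 = a 0` and no triple coincidence, the quartic leaves `w 3 = w 2` or `w 1 = w 0`. The
  -- first, and the second together with `a 2 = a 3`, are collision limits of `vertex_mem_Lim` with
  -- constant `s`.
  by_cases hw3 : w 3 = w 2
  · refine of_permute_mem_Lim (Equiv.swap 0 2 * Equiv.swap 1 3) ?_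
    rw [permute_const]
    refine vertex_mem_Lim (inc_const _ _ _) rfl rfl rfl rfl ?_ ?_
    · exact ha.symm
    · exact hw3
  have hw : w 1 = w 0 := by
    have q := hq 0 1 2 3 (by decide)
    rw [ha, sub_self, zero_mul, zero_mul, zero_mul, eq_comm, mul_eq_zero] at q
    exact sub_eq_zero.1 ((mul_eq_zero.1 (q.resolve_right (sub_ne_zero.2 hw3))).resolve_left
      (mul_ne_zero a20 a03))
  by_cases ha3 : a 2 = a 3
  · exact vertex_mem_Lim (inc_const _ _ _) rfl rfl rfl rfl ha3 hw
  have w20 : w 2 - w 0 ≠ 0 := fun h => ht' ⟨by rw [hw]; ring, by rw [h]; ring⟩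
  have a32 := sub_ne_zero.2 (Ne.symm ha3)
  have w32 := sub_ne_zero.2 hw3
  -- Normalizing `N_0 = N_1 = 1`, the difference `w 3 - w 2` gives `K`, the difference `w 2 - w 0`
  -- gives `N_3 = n`, and `q` is the resulting slope.
  obtain ⟨K, hK⟩ : ∃ K, w 3 - w 2 = K * (a 3 - a 2) := ⟨_, (div_mul_cancel₀ _ a32).symm⟩
  have hK0 : K ≠ 0 := fun h => w32 (by rw [hK, h, zero_mul])
  obtain ⟨n, hn⟩ : ∃ n, w 2 - w 0 = n * (K * (a 2 - a 0)) :=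
    ⟨_, (div_mul_cancel₀ _ (mul_ne_zero hK0 a20)).symm⟩
  obtain ⟨q, hq'⟩ : ∃ q, n - 1 = q * (a 3 - a 0) := ⟨_, (div_mul_cancel₀ _ a30).symm⟩
  obtain ⟨c', d, h⟩ := eq_fam (inc_const a w c) (p := 1 - q * a 0) (q := q) (Y := 0) (K := K)
    (by simp [symm4]) (by simp [symm4]) (by simp [symm4]) (by simp [symm4]) (by simp [symm4])
    (by simp [hw, ha])
    (by
      simp only [ha]
      rw [hn]
      linear_combination K * (a 2 - a 0) * hq')
    (by
      simp only [ha]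
      linear_combination hK + hn + K * (a 2 - a 0) * hq')
  rw [h]
  exact fam_mem_Lim _ _ _ _ _ _ _

/-- A configuration with constant second component satisfying the quartics is a limit of
configurations of nondegenerate tetrahedra. -/
theorem const_mem_Lim {a w : Fin 4 → ℂ} (c : ℂ) (hq : Quar a w) :
    ((a, symm4 c c c c c c, w) : Config) ∈ Lim := by
  by_cases ha : ∀ i j, i ≠ j → a i ≠ a j
  · exact const_mem_Lim_of_a_ne c hq ha
  push Not at ha
  obtain ⟨i, j, hij, h⟩ := ha
  obtain ⟨k, l, hl⟩ := exists_third_fourth hij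
  obtain ⟨σ, h0, h1, h2, h3⟩ := exists_perm hl
  refine of_permute_mem_Lim σ ?_
  rw [permute_const]
  replace hq := hq.comp σ
  have ha : a (σ 1) = a (σ 0) := by rw [h0, h1, h]
  exact const_mem_Lim_of_eq c hq ha

end Tetrahedra

namespace Tetrahedra

/-! ## Affine coordinates on the big cells of the Grassmannians -/

theorem mem_E {I : Finset (Fin 4)} {v : V4} : v ∈ E I ↔ ∀ i ∉ I, v i = 0 := by
  constructor
  · intro h i hi
    have hle : E I ≤ LinearMap.ker (LinearMap.proj (R := ℂ) (φ := fun _ : Fin 4 => ℂ) i) := by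
      refine Submodule.span_le.2 ?_
      rintro _ ⟨j, hj, rfl⟩
      have hij : i ≠ j := by rintro rfl; exact hi hj
      simp [hij]
    exact hle h
  · intro h
    rw [← Finset.univ_sum_single v]
    refine Submodule.sum_mem _ fun i _ => ?_
    by_cases hi : i ∈ I
    · have : (Pi.single i (v i) : V4) = v i • Pi.single i 1 := by
        simp [← Pi.single_smul]
      rw [this]
      exact Submodule.smul_mem _ _ (Submodule.subset_span ⟨i, hi, rfl⟩)
    · rw [h i hi, Pi.single_zero]
      exact Submodule.zero_mem _

/-- A maximal minor vanishes exactly when some nontrivial combination of the basis vectors is zero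
in all columns of `J`. -/
theorem plucker_ne_zero_iff {k : ℕ} (W : Gr k) (J : Minor k) :
    plucker W J ≠ 0 ↔ ∀ v ∈ W.1, (∀ j ∈ J.1, v j = 0) → v = 0 := by
  have hJ : ∀ j ∈ J.1, ∃ b, J.1.orderEmbOfFin J.2 b = j := fun j hj => by
    have : j ∈ Set.range (J.1.orderEmbOfFin J.2) := by
      rw [Finset.range_orderEmbOfFin]; exact hj
    exact this
  rw [not_iff_comm, plucker, ← Matrix.exists_vecMul_eq_zero_iff]
  push Not
  constructor
  · rintro ⟨v, hv, hv0, hne⟩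
    refine ⟨fun a => (frame W).repr ⟨v, hv⟩ a, ?_, ?_⟩
    · intro h
      have : (⟨v, hv⟩ : W.1) = 0 := by
        rw [← (frame W).sum_repr ⟨v, hv⟩]
        exact Finset.sum_eq_zero fun a _ => by rw [congrFun h a]; simp
      exact hne (congrArg Subtype.val this)
    · funext b
      have h1 := congrArg Subtype.val ((frame W).sum_repr ⟨v, hv⟩)
      have h2 := congrFun h1 (J.1.orderEmbOfFin J.2 b)
      simp only [Submodule.coe_sum, Submodule.coe_smul, Finset.sum_apply, Pi.smul_apply,
        smul_eq_mul] at h2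
      rw [hv0 _ (Finset.orderEmbOfFin_mem _ _ _)] at h2
      exact h2
  · rintro ⟨c, hc, h⟩
    refine ⟨((∑ a, c a • frame W a : W.1) : V4), Subtype.property _, ?_, ?_⟩
    · intro j hj
      obtain ⟨b, rfl⟩ := hJ j hj
      have := congrFun h b
      simpa [Matrix.vecMul, dotProduct] using this
    · intro h0
      have h0' : (∑ a, c a • frame W a : W.1) = 0 := Subtype.ext h0
      exact hc (funext fun a => Fintype.linearIndependent_iff.1 (frame W).linearIndependent c h0' a)

theorem plucker_eq_det {k : ℕ} (W : Gr k) (J : Minor k) (c : Fin k → Fin 4) (hc : StrictMono c)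
    (h : ∀ b, c b ∈ J.1) :
    plucker W J = Matrix.det (Matrix.of fun a b : Fin k => (frame W a : V4) (c b)) := by
  rw [plucker, Finset.orderEmbOfFin_unique J.2 h hc]

theorem exists_mem_coords {k : ℕ} (W : Gr k) (J : Minor k) (h : plucker W J ≠ 0) (u : V4) :
    ∃ v ∈ W.1, ∀ j ∈ J.1, v j = u j := by
  let T : W.1 →ₗ[ℂ] (J.1 → ℂ) := (LinearMap.funLeft ℂ ℂ (fun j : J.1 => (j : Fin 4))) ∘ₗ W.1.subtype
  have hinj : Function.Injective T := by
    rw [← LinearMap.ker_eq_bot, LinearMap.ker_eq_bot']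
    intro v hv
    refine Subtype.ext ((plucker_ne_zero_iff W J).1 h v.1 v.2 fun j hj => ?_)
    exact congrFun hv ⟨j, hj⟩
  have hsurj : Function.Surjective T := by
    refine (LinearMap.injective_iff_surjective_of_finrank_eq_finrank ?_).1 hinj
    rw [W.2, Module.finrank_fintype_fun_eq_card, Fintype.card_coe, J.2]
  obtain ⟨v, hv⟩ := hsurj fun j => u j
  exact ⟨v.1, v.2, fun j hj => congrFun hv ⟨j, hj⟩⟩

/-- The subset `{1, ..., k}`. -/
def std (k : ℕ) : Finset (Fin 4) := Finset.univ.filter fun i : Fin 4 => (i : ℕ) < k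

/-- Plücker coordinates with unrestricted index. -/
noncomputable def coord {k : ℕ} (W : Gr k) (S : Finset (Fin 4)) : ℂ :=
  if h : S.card = k then plucker W ⟨S, h⟩ else 0

/-- Affine Plücker coordinates. -/
noncomputable def aff {k : ℕ} (W : Gr k) (S : Finset (Fin 4)) : ℂ := coord W S / coord W (std k)

/-- The `k`-plane is transverse to the coordinate subspace of complementary dimension of the flag
at infinity. -/
def InCell {k : ℕ} (W : Gr k) : Prop := coord W (std k) ≠ 0

theorem coord_eq {k : ℕ} (W : Gr k) (J : Minor k) : coord W J.1 = plucker W J := by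
  simp [coord, J.2]

theorem f_eq_aff (p : Y) (I : Vertex) (J : Minor I.1.card) : f p I J = aff (p I) J.1 := by
  rw [f, ← coord_eq, ← coord_eq]
  rfl

theorem card_std : ∀ k ≤ 4, (std k).card = k := by
  intro k hk
  interval_cases k <;> decide

theorem inCell_iff {k : ℕ} (hk : k ≤ 4) (W : Gr k) :
    InCell W ↔ ∀ v ∈ W.1, (∀ j : Fin 4, (j : ℕ) < k → v j = 0) → v = 0 := by
  rw [InCell, coord, dif_pos (card_std k hk), plucker_ne_zero_iff]
  simp [std]

theorem mem_flagAtInfinity {m : ℕ} {v : V4} :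
    v ∈ flagAtInfinity m ↔ ∀ i : Fin 4, (i : ℕ) + m < 4 → v i = 0 := by
  simp [flagAtInfinity, mem_E]

theorem finrank_flagAtInfinity {m : ℕ} (hm : m ≤ 4) :
    Module.finrank ℂ (flagAtInfinity m) = m := by
  rw [flagAtInfinity, finrank_E]
  interval_cases m <;> decide

theorem flagAtInfinity_mono {m n : ℕ} (h : m ≤ n) : flagAtInfinity m ≤ flagAtInfinity n := by
  intro v hv
  rw [mem_flagAtInfinity] at hv ⊢
  exact fun i hi => hv i (by omega)

theorem inCell_iff_inf {k : ℕ} (hk : k ≤ 4) (W : Gr k) :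
    InCell W ↔ W.1 ⊓ flagAtInfinity (4 - k) = ⊥ := by
  rw [inCell_iff hk, Submodule.eq_bot_iff]
  simp only [Submodule.mem_inf, mem_flagAtInfinity, and_imp]
  refine forall₂_congr fun v _ => ?_
  have : ∀ i : Fin 4, ((i : ℕ) + (4 - k) < 4 ↔ (i : ℕ) < k) := fun i => by omega
  simp only [this]

/-- Only the flag member of complementary dimension matters. Smaller members then also meet the
plane in zero, and larger ones span the whole space together with it, so the dimension formula
applies. -/
theorem transverse_iff {k : ℕ} (hk1 : 1 ≤ k) (hk3 : k ≤ 3) (W : Gr k) :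
    (∀ m : ℕ, 1 ≤ m → m ≤ 3 →
      Module.finrank ℂ (W.1 ⊓ flagAtInfinity m : Submodule ℂ V4) = k + m - 4) ↔ InCell W := by
  rw [inCell_iff_inf (by omega)]
  constructor
  · intro h
    have := h (4 - k) (by omega) (by omega)
    rw [show k + (4 - k) - 4 = 0 by omega] at this
    exact Submodule.finrank_eq_zero.1 this
  · intro h m hm1 hm3
    rcases le_total m (4 - k) with hm | hm
    · have hle : W.1 ⊓ flagAtInfinity m ≤ ⊥ := by
        rw [← h]; exact inf_le_inf_left _ (flagAtInfinity_mono hm)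
      rw [le_bot_iff.1 hle, finrank_bot]
      omega
    · have hsup : W.1 ⊔ flagAtInfinity m = ⊤ := by
        refine top_le_iff.1 (le_trans (le_of_eq ?_) (sup_le_sup_left (flagAtInfinity_mono hm) _))
        refine (Submodule.eq_top_of_finrank_eq ?_).symm
        have := Submodule.finrank_sup_add_finrank_inf_eq W.1 (flagAtInfinity (4 - k))
        rw [h, finrank_bot, W.2, finrank_flagAtInfinity (by omega)] at this
        simp; omega
      have := Submodule.finrank_sup_add_finrank_inf_eq W.1 (flagAtInfinity m)
      rw [hsup, finrank_top, W.2, finrank_flagAtInfinity (by omega)] at this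
      simp at this
      omega

theorem exists_mem_of_inCell {k : ℕ} {W : Gr k} (hk : k ≤ 4) (hW : InCell W) (u : V4) :
    ∃ v ∈ W.1, ∀ j : Fin 4, (j : ℕ) < k → v j = u j := by
  rw [InCell, coord, dif_pos (card_std k hk)] at hW
  obtain ⟨v, hv, h⟩ := exists_mem_coords W _ hW u
  exact ⟨v, hv, fun j hj => h j (by simp [std, hj])⟩

theorem exists_combination {k : ℕ} (W : Gr k) {v : V4} (hv : v ∈ W.1) :
    ∃ c : Fin k → ℂ, ∀ j, v j = ∑ a, c a * (frame W a : V4) j := by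
  refine ⟨fun a => (frame W).repr ⟨v, hv⟩ a, fun j => ?_⟩
  have h2 := congrFun (congrArg Subtype.val ((frame W).sum_repr ⟨v, hv⟩)) j
  simp only [Submodule.coe_sum, Submodule.coe_smul, Finset.sum_apply, Pi.smul_apply,
    smul_eq_mul] at h2
  exact h2.symm

theorem coord_one (W : Gr 1) (j : Fin 4) : coord W {j} = (frame W 0 : V4) j := by
  rw [coord, dif_pos (by simp), plucker_eq_det W ⟨{j}, by simp⟩ ![j] (Subsingleton.strictMono _)
    (by intro b; simp)]
  simp

theorem coord_two (W : Gr 2) {i j : Fin 4} (h : i < j) :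
    coord W {i, j} = (frame W 0 : V4) i * (frame W 1 : V4) j -
      (frame W 0 : V4) j * (frame W 1 : V4) i := by
  rw [coord, dif_pos (Finset.card_pair h.ne), plucker_eq_det W ⟨{i, j}, _⟩ ![i, j]
    (by simpa [Fin.strictMono_iff_lt_succ] using h) (by intro b; fin_cases b <;> simp),
    Matrix.det_fin_two]
  simp

theorem coord_three (W : Gr 3) {i j l : Fin 4} (h : i < j) (h' : j < l) :
    coord W {i, j, l} = Matrix.det (Matrix.of fun a b : Fin 3 =>
      (frame W a : V4) (![i, j, l] b)) := by
  have hcard : ({i, j, l} : Finset (Fin 4)).card = 3 :=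
    Finset.card_eq_three.2 ⟨i, j, l, h.ne, (h.trans h').ne, h'.ne, rfl⟩
  rw [coord, dif_pos hcard, plucker_eq_det W ⟨{i, j, l}, hcard⟩ ![i, j, l]
    (by rw [Fin.strictMono_iff_lt_succ]; intro b; fin_cases b; exacts [h, h'])
    (by intro b; fin_cases b <;> simp)]

theorem std_one : std 1 = {0} := by decide
theorem std_two : std 2 = {0, 1} := by decide
theorem std_three : std 3 = {0, 1, 2} := by decide

theorem aff_std {k : ℕ} {W : Gr k} (hW : InCell W) : aff W (std k) = 1 := div_self hW

theorem eqs_of_mem_one {W : Gr 1} (hW : InCell W) {v : V4} (hv : v ∈ W.1) :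
    v 1 = aff W {1} * v 0 ∧ v 2 = aff W {2} * v 0 ∧ v 3 = aff W {3} * v 0 := by
  obtain ⟨c, hc⟩ := exists_combination W hv
  have h0 : (frame W 0 : V4) 0 ≠ 0 := by
    rw [InCell, std_one, coord_one] at hW; exact hW
  simp only [aff, std_one, coord_one, hc, Fin.sum_univ_one]
  refine ⟨?_, ?_, ?_⟩ <;> field_simp

/-- Appending `v` as a row to the frame makes the 3×3 minors vanish; expanding along that row
expresses the last coordinates of `v` through the first two. The other ranks follow the same
pattern. -/
theorem eqs_of_mem_two {W : Gr 2} (hW : InCell W) {v : V4} (hv : v ∈ W.1) :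
    v 2 = -aff W {1, 2} * v 0 + aff W {0, 2} * v 1 ∧
      v 3 = -aff W {1, 3} * v 0 + aff W {0, 3} * v 1 := by
  obtain ⟨c, hc⟩ := exists_combination W hv
  rw [InCell, std_two, coord_two W (by decide)] at hW
  simp only [aff, std_two]
  rw [coord_two W (show (0 : Fin 4) < 1 by decide), coord_two W (show (1 : Fin 4) < 2 by decide),
    coord_two W (show (0 : Fin 4) < 2 by decide), coord_two W (show (1 : Fin 4) < 3 by decide),
    coord_two W (show (0 : Fin 4) < 3 by decide)]
  simp only [hc, Fin.sum_univ_two]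
  constructor <;>
  · rw [← neg_div, div_mul_eq_mul_div, div_mul_eq_mul_div, ← add_div, eq_div_iff hW]
    ring

theorem aff_two_three {W : Gr 2} (hW : InCell W) :
    aff W {2, 3} = aff W {0, 2} * aff W {1, 3} - aff W {1, 2} * aff W {0, 3} := by
  rw [InCell, std_two, coord_two W (by decide)] at hW
  simp only [aff, std_two]
  rw [coord_two W (show (0 : Fin 4) < 1 by decide), coord_two W (show (1 : Fin 4) < 2 by decide),
    coord_two W (show (0 : Fin 4) < 2 by decide), coord_two W (show (1 : Fin 4) < 3 by decide),
    coord_two W (show (0 : Fin 4) < 3 by decide), coord_two W (show (2 : Fin 4) < 3 by decide)]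
  field_simp
  ring

theorem eqs_of_mem_three {W : Gr 3} (hW : InCell W) {v : V4} (hv : v ∈ W.1) :
    v 3 = aff W {1, 2, 3} * v 0 - aff W {0, 2, 3} * v 1 + aff W {0, 1, 3} * v 2 := by
  obtain ⟨c, hc⟩ := exists_combination W hv
  rw [InCell, std_three, coord_three W (by decide) (by decide), Matrix.det_fin_three] at hW
  simp only [aff, std_three]
  rw [coord_three W (show (0 : Fin 4) < 1 by decide) (show (1 : Fin 4) < 2 by decide),
    coord_three W (show (1 : Fin 4) < 2 by decide) (show (2 : Fin 4) < 3 by decide),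
    coord_three W (show (0 : Fin 4) < 2 by decide) (show (2 : Fin 4) < 3 by decide),
    coord_three W (show (0 : Fin 4) < 1 by decide) (show (1 : Fin 4) < 3 by decide)]
  simp only [Matrix.det_fin_three, hc, Fin.sum_univ_three, Matrix.of_apply, Matrix.cons_val] at hW ⊢
  generalize (frame W 0 : V4) = x at *
  generalize (frame W 1 : V4) = y at *
  generalize (frame W 2 : V4) = z at *
  rw [div_mul_eq_mul_div, div_mul_eq_mul_div, div_mul_eq_mul_div, ← sub_div, ← add_div,
    eq_div_iff hW]
  ring

/-- For the converse, the plane contains a vector with the same leading coordinates as `v`, and the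
equations determine the remaining ones. -/
theorem mem_one_iff {W : Gr 1} (hW : InCell W) {v : V4} :
    v ∈ W.1 ↔ v 1 = aff W {1} * v 0 ∧ v 2 = aff W {2} * v 0 ∧ v 3 = aff W {3} * v 0 := by
  refine ⟨eqs_of_mem_one hW, fun ⟨h1, h2, h3⟩ => ?_⟩
  obtain ⟨w, hw, h⟩ := exists_mem_of_inCell (by norm_num) hW v
  obtain ⟨k1, k2, k3⟩ := eqs_of_mem_one hW hw
  have h0 := h 0 (by decide)
  convert hw
  funext i
  fin_cases i
  · exact h0.symm
  · simp only [Fin.mk_one]; rw [h1, k1, h0]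
  · simp only [Fin.reduceFinMk]; rw [h2, k2, h0]
  · simp only [Fin.reduceFinMk]; rw [h3, k3, h0]

theorem mem_two_iff {W : Gr 2} (hW : InCell W) {v : V4} :
    v ∈ W.1 ↔ v 2 = -aff W {1, 2} * v 0 + aff W {0, 2} * v 1 ∧
      v 3 = -aff W {1, 3} * v 0 + aff W {0, 3} * v 1 := by
  refine ⟨eqs_of_mem_two hW, fun ⟨h2, h3⟩ => ?_⟩
  obtain ⟨w, hw, h⟩ := exists_mem_of_inCell (by norm_num) hW v
  obtain ⟨k2, k3⟩ := eqs_of_mem_two hW hw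
  have h0 := h 0 (by decide)
  have h1 := h 1 (by decide)
  convert hw
  funext i
  fin_cases i
  · exact h0.symm
  · exact h1.symm
  · simp only [Fin.reduceFinMk]; rw [h2, k2, h0, h1]
  · simp only [Fin.reduceFinMk]; rw [h3, k3, h0, h1]

theorem mem_three_iff {W : Gr 3} (hW : InCell W) {v : V4} :
    v ∈ W.1 ↔
      v 3 = aff W {1, 2, 3} * v 0 - aff W {0, 2, 3} * v 1 + aff W {0, 1, 3} * v 2 := by
  refine ⟨eqs_of_mem_three hW, fun h3 => ?_⟩
  obtain ⟨w, hw, h⟩ := exists_mem_of_inCell (by norm_num) hW v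
  have k3 := eqs_of_mem_three hW hw
  have h0 := h 0 (by decide)
  have h1 := h 1 (by decide)
  have h2 := h 2 (by decide)
  convert hw
  funext i
  fin_cases i
  · exact h0.symm
  · exact h1.symm
  · exact h2.symm
  · simp only [Fin.reduceFinMk]; rw [h3, k3, h0, h1, h2]

theorem exists_gr_one (a b c : ℂ) :
    ∃ W : Gr 1, InCell W ∧ aff W {1} = a ∧ aff W {2} = b ∧ aff W {3} = c := by
  have hne : (![1, a, b, c] : V4) ≠ 0 := fun h => one_ne_zero (congrFun h 0)
  refine ⟨⟨Submodule.span ℂ {![1, a, b, c]}, finrank_span_singleton hne⟩, ?_⟩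
  have hcell : InCell (⟨Submodule.span ℂ {![1, a, b, c]}, finrank_span_singleton hne⟩ : Gr 1) := by
    rw [inCell_iff (by norm_num)]
    intro v hv h
    obtain ⟨r, rfl⟩ := Submodule.mem_span_singleton.1 hv
    have := h 0 (by decide)
    simp at this
    simp [this]
  have := eqs_of_mem_one hcell (Submodule.mem_span_singleton_self _)
  simp at this
  exact ⟨hcell, this.1.symm, this.2.1.symm, this.2.2.symm⟩

theorem exists_gr_two (u v s t : ℂ) :
    ∃ W : Gr 2, InCell W ∧ -aff W {1, 2} = u ∧ -aff W {1, 3} = v ∧ aff W {0, 2} = s ∧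
      aff W {0, 3} = t := by
  have hli : LinearIndependent ℂ (![![1, 0, u, v], ![0, 1, s, t]] : Fin 2 → V4) := by
    rw [Fintype.linearIndependent_iff]
    intro g hg i
    have h0 := congrFun hg 0
    have h1 := congrFun hg 1
    simp [Fin.sum_univ_two] at h0 h1
    fin_cases i <;> assumption
  have hcell : InCell (⟨Submodule.span ℂ (Set.range ![![1, 0, u, v], ![0, 1, s, t]]),
      finrank_span_eq_card hli⟩ : Gr 2) := by
    rw [inCell_iff (by norm_num)]
    intro w hw h
    obtain ⟨c, rfl⟩ := (Submodule.mem_span_range_iff_exists_fun ℂ).1 hw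
    have h0 := h 0 (by decide)
    have h1 := h 1 (by decide)
    simp [Fin.sum_univ_two] at h0 h1
    simp [Fin.sum_univ_two, h0, h1]
  have key : ∀ W : Gr 2, InCell W → ![1, 0, u, v] ∈ W.1 → ![0, 1, s, t] ∈ W.1 →
      InCell W ∧ -aff W {1, 2} = u ∧ -aff W {1, 3} = v ∧ aff W {0, 2} = s ∧ aff W {0, 3} = t := by
    intro W hW h1 h2
    replace h1 := eqs_of_mem_two hW h1
    replace h2 := eqs_of_mem_two hW h2
    simp at h1 h2
    exact ⟨hW, h1.1.symm, h1.2.symm, h2.1.symm, h2.2.symm⟩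
  exact ⟨_, key _ hcell (Submodule.subset_span ⟨0, rfl⟩) (Submodule.subset_span ⟨1, rfl⟩)⟩

theorem exists_gr_three (x y w : ℂ) :
    ∃ W : Gr 3, InCell W ∧ aff W {1, 2, 3} = x ∧ -aff W {0, 2, 3} = y ∧ aff W {0, 1, 3} = w := by
  have hli : LinearIndependent ℂ (![![1, 0, 0, x], ![0, 1, 0, y], ![0, 0, 1, w]] : Fin 3 → V4) := by
    rw [Fintype.linearIndependent_iff]
    intro g hg i
    have h0 := congrFun hg 0
    have h1 := congrFun hg 1
    have h2 := congrFun hg 2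
    simp [Fin.sum_univ_three] at h0 h1 h2
    fin_cases i <;> assumption
  have hcell : InCell (⟨Submodule.span ℂ (Set.range ![![1, 0, 0, x], ![0, 1, 0, y], ![0, 0, 1, w]]),
      finrank_span_eq_card hli⟩ : Gr 3) := by
    rw [inCell_iff (by norm_num)]
    intro w hw h
    obtain ⟨c, rfl⟩ := (Submodule.mem_span_range_iff_exists_fun ℂ).1 hw
    have h0 := h 0 (by decide)
    have h1 := h 1 (by decide)
    have h2 := h 2 (by decide)
    simp [Fin.sum_univ_three] at h0 h1 h2
    simp [Fin.sum_univ_three, h0, h1, h2]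
  have key : ∀ W : Gr 3, InCell W → ![1, 0, 0, x] ∈ W.1 → ![0, 1, 0, y] ∈ W.1 →
      ![0, 0, 1, w] ∈ W.1 →
      InCell W ∧ aff W {1, 2, 3} = x ∧ -aff W {0, 2, 3} = y ∧ aff W {0, 1, 3} = w := by
    intro W hW h1 h2 h3
    replace h1 := eqs_of_mem_three hW h1
    replace h2 := eqs_of_mem_three hW h2
    replace h3 := eqs_of_mem_three hW h3
    simp at h1 h2 h3
    exact ⟨hW, h1.symm, h2.symm, h3.symm⟩
  exact ⟨_, key _ hcell (Submodule.subset_span ⟨0, rfl⟩) (Submodule.subset_span ⟨1, rfl⟩)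
    (Submodule.subset_span ⟨2, rfl⟩)⟩

end Tetrahedra

namespace Tetrahedra

open MvPolynomial

/-! ## The space of tetrahedra in the big cell -/

theorem card_vertex (I : Vertex) : 1 ≤ I.1.card ∧ I.1.card ≤ 3 := by
  revert I; decide

/-- All faces lie in the big cells. -/
def InCells (p : Y) : Prop := ∀ I, InCell (p I)

theorem mem_U_iff {p : Y} : p ∈ U ↔ p ∈ X ∧ InCells p := by
  refine and_congr_right fun _ => forall_congr' fun I => ?_
  exact transverse_iff (card_vertex I).1 (card_vertex I).2 (p I)

/-- The label of the initial Plücker coordinate of the factor `I`. -/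
abbrev initVar (I : Vertex) : PluckerVar := ⟨I, initialMinor I⟩

/-- All affine Plücker coordinates of a point. -/
noncomputable def affCoords (p : Y) (v : PluckerVar) : ℂ := f p v.1 v.2

theorem inCells_iff {p : Y} : InCells p ↔ ∀ I, plucker (p I) (initialMinor I) ≠ 0 := by
  refine forall_congr' fun I => ?_
  rw [← coord_eq]
  rfl

theorem isWeightedHomogeneous_init (d : Vertex → ℕ) :
    IsWeightedHomogeneous multidegree
      (∏ I, (MvPolynomial.X (initVar I) : MvPolynomial PluckerVar ℂ) ^ d I) d := by
  have := IsWeightedHomogeneous.prod (w := multidegree) (s := Finset.univ)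
    (φ := fun I => (MvPolynomial.X (initVar I) : MvPolynomial PluckerVar ℂ) ^ d I)
    (fun I => d I • multidegree (initVar I))
    (fun I _ => (isWeightedHomogeneous_X ℂ _ _).pow _)
  convert this using 1
  funext J
  simp [multidegree, Finset.sum_apply, Pi.single_apply]

/-- Every degree above a bound is provided, so that two summands can be brought to a common degree.
-/
theorem exists_homogenization (F : MvPolynomial PluckerVar ℂ) :
    ∃ d₀ : Vertex → ℕ, ∀ d, d₀ ≤ d → ∃ G : MvPolynomial PluckerVar ℂ,
      IsWeightedHomogeneous multidegree G d ∧
      ∀ y : PluckerVar → ℂ, (∀ I, y (initVar I) ≠ 0) →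
        eval y G = (∏ I, y (initVar I) ^ d I) * eval (fun v => y v / y (initVar v.1)) F := by
  induction F using MvPolynomial.induction_on with
  | C a =>
    refine ⟨0, fun d _ => ⟨C a * ∏ I, MvPolynomial.X (initVar I) ^ d I, ?_, fun y _ => ?_⟩⟩
    · simpa using (isWeightedHomogeneous_C multidegree a).mul (isWeightedHomogeneous_init d)
    · simp [mul_comm]
  | add F₁ F₂ h₁ h₂ =>
    obtain ⟨d₁, h₁⟩ := h₁
    obtain ⟨d₂, h₂⟩ := h₂
    refine ⟨d₁ ⊔ d₂, fun d hd => ?_⟩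
    obtain ⟨G₁, hG₁, e₁⟩ := h₁ d (le_trans le_sup_left hd)
    obtain ⟨G₂, hG₂, e₂⟩ := h₂ d (le_trans le_sup_right hd)
    refine ⟨G₁ + G₂, hG₁.add hG₂, fun y hy => ?_⟩
    rw [map_add, map_add, e₁ y hy, e₂ y hy, mul_add]
  | mul_X F v h =>
    obtain ⟨d₀, h⟩ := h
    refine ⟨d₀ + multidegree v, fun d hd => ?_⟩
    obtain ⟨e, rfl⟩ := exists_add_of_le hd
    obtain ⟨G, hG, eG⟩ := h (d₀ + e) le_self_add
    refine ⟨G * MvPolynomial.X v, ?_, fun y hy => ?_⟩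
    · rw [add_right_comm]
      exact hG.mul (isWeightedHomogeneous_X ℂ _ _)
    · have hprod : ∏ I, y (initVar I) ^ (d₀ + multidegree v + e) I =
          (∏ I, y (initVar I) ^ (d₀ + e) I) * y (initVar v.1) := by
        rw [add_right_comm]
        simp only [Pi.add_apply (d₀ + e), pow_add _ ((d₀ + e) _), Finset.prod_mul_distrib]
        congr 1
        rw [Finset.prod_eq_single v.1]
        · simp [multidegree]
        · intro I _ hI
          simp [multidegree, Pi.single_eq_of_ne hI]
        · simp
      rw [map_mul, map_mul, eval_X, eval_X, eG y hy, hprod]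
      field_simp [hy v.1]

theorem eval_of_isWeightedHomogeneous {F : MvPolynomial PluckerVar ℂ} {d : Vertex → ℕ}
    (hF : IsWeightedHomogeneous multidegree F d) {y : PluckerVar → ℂ}
    (hy : ∀ I, y (initVar I) ≠ 0) :
    eval y F = (∏ I, y (initVar I) ^ d I) * eval (fun v => y v / y (initVar v.1)) F := by
  rw [eval_eq', eval_eq', Finset.mul_sum]
  refine Finset.sum_congr rfl fun m hm => ?_
  have hd : ∀ I, d I = ∑ v, m v * multidegree v I := by
    intro I
    rw [← hF (mem_support_iff.1 hm), Finsupp.weight_apply, Finsupp.sum_fintype _ _ (by simp)]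
    simp [Finset.sum_apply]
  have hprod : ∏ I, y (initVar I) ^ d I = ∏ v : PluckerVar, y (initVar v.1) ^ m v := by
    simp only [hd, ← Finset.prod_pow_eq_pow_sum]
    rw [Finset.prod_comm]
    refine Finset.prod_congr rfl fun v _ => ?_
    rw [Finset.prod_eq_single v.1]
    · simp [multidegree]
    · intro I _ hI
      simp [multidegree, Pi.single_eq_of_ne hI]
    · simp
  rw [hprod, mul_left_comm, ← Finset.prod_mul_distrib]
  congr 1
  refine Finset.prod_congr rfl fun v _ => ?_
  rw [← mul_pow, mul_div_cancel₀ _ (hy v.1)]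

/-- The affine Plücker coordinates of the nondegenerate tetrahedra in the big cells. -/
def affXo : Set (PluckerVar → ℂ) := affCoords '' {q | q ∈ Xo ∧ InCells q}

/-- The orbit points in the big cell detect polynomial identities on `U`: an inhomogeneous identity
is homogenized and tested on the whole orbit. -/
theorem eval_eq_zero_of_mem_U {p : Y} (hp : p ∈ U) {F : MvPolynomial PluckerVar ℂ}
    (hF : ∀ y ∈ affXo, eval y F = 0) : eval (affCoords p) F = 0 := by
  obtain ⟨hX, hc⟩ := mem_U_iff.1 hp
  obtain ⟨d, h⟩ := exists_homogenization F
  obtain ⟨G, hG, e⟩ := h d le_rfl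
  -- One more factor of each initial Plücker coordinate makes the polynomial vanish at the orbit
  -- points outside the big cell, where nothing is known about `F`.
  have hG' := hG.mul (isWeightedHomogeneous_init fun _ => 1)
  have h0 := hX _ _ hG' fun q hq => by
    rw [map_mul]
    by_cases hqc : ∀ I, plucker (q I) (initialMinor I) ≠ 0
    · rw [e (fun v => plucker (q v.1) v.2) hqc]
      rw [show (fun v : PluckerVar => plucker (q v.1) v.2 / plucker (q v.1) (initialMinor v.1)) =
        affCoords q from rfl, hF _ ⟨q, ⟨hq, inCells_iff.2 hqc⟩, rfl⟩, mul_zero, zero_mul]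
    · push Not at hqc
      obtain ⟨I, hI⟩ := hqc
      rw [map_prod, Finset.prod_eq_zero (Finset.mem_univ I) (by simp [hI]), mul_zero]
  rw [inCells_iff] at hc
  rw [map_mul, e (fun v => plucker (p v.1) v.2) hc, mul_eq_zero, mul_eq_zero] at h0
  rcases h0 with (h0 | h0) | h0
  · exact absurd h0 (Finset.prod_ne_zero_iff.2 fun I _ => pow_ne_zero _ (hc I))
  · exact h0
  · rw [map_prod] at h0
    exact absurd h0 (Finset.prod_ne_zero_iff.2 fun I _ => by simpa using hc I)

/-- A multihomogeneous polynomial vanishing on the orbit dehomogenizes to a polynomial, hence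
continuous, function of the affine coordinates, so it also vanishes at Euclidean limits. -/
theorem mem_U_of_closure {p : Y} (hc : InCells p) (hp : affCoords p ∈ closure affXo) : p ∈ U := by
  refine mem_U_iff.2 ⟨fun F d hF h => ?_, hc⟩
  rw [inCells_iff] at hc
  rw [eval_of_isWeightedHomogeneous hF (y := fun v => plucker (p v.1) v.2) hc]
  refine mul_eq_zero_of_right _ ?_
  have hclosed : IsClosed {y : PluckerVar → ℂ | eval y F = 0} :=
    isClosed_eq (continuous_eval F) continuous_const
  refine closure_minimal ?_ hclosed hp
  rintro _ ⟨q, ⟨hq, hqc⟩, rfl⟩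
  rw [inCells_iff] at hqc
  have := h q hq
  rw [eval_of_isWeightedHomogeneous hF (y := fun v => plucker (q v.1) v.2) hqc, mul_eq_zero] at this
  exact this.resolve_left (Finset.prod_ne_zero_iff.2 fun I _ => pow_ne_zero _ (hqc I))

end Tetrahedra

namespace Tetrahedra

open MvPolynomial

/-! ## Incidence relations -/

/-- Affine Plücker coordinates with unrestricted indices. -/
noncomputable def af (p : Y) (I S : Finset (Fin 4)) : ℂ :=
  if h : (I.Nonempty ∧ I ≠ Finset.univ) ∧ S.card = I.card then f p ⟨I, h.1⟩ ⟨S, h.2⟩ else 0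

/-- The variable of an affine Plücker coordinate with unrestricted indices. -/
noncomputable def pv (I S : Finset (Fin 4)) : MvPolynomial PluckerVar ℂ :=
  if h : (I.Nonempty ∧ I ≠ Finset.univ) ∧ S.card = I.card then
    MvPolynomial.X ⟨⟨I, h.1⟩, ⟨S, h.2⟩⟩ else 0

theorem eval_pv (p : Y) (I S : Finset (Fin 4)) : eval (affCoords p) (pv I S) = af p I S := by
  rw [pv, af]
  split
  · rw [eval_X]; rfl
  · simp

theorem af_eq_aff (p : Y) (I : Vertex) {S : Finset (Fin 4)} (hS : S.card = I.1.card) :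
    af p I.1 S = aff (p I) S := by
  rw [af, dif_pos ⟨I.2, hS⟩, f_eq_aff]

theorem f_eq_af (p : Y) (I : Vertex) (J : Minor I.1.card) : f p I J = af p I.1 J.1 := by
  rw [af, dif_pos ⟨I.2, J.2⟩]

theorem eq_zero_of_mem_U {p : Y} (hp : p ∈ U) (F : MvPolynomial PluckerVar ℂ)
    (hF : ∀ q ∈ Xo, InCells q → eval (affCoords q) F = 0) : eval (affCoords p) F = 0 :=
  eval_eq_zero_of_mem_U hp fun _ ⟨q, hq, e⟩ => e ▸ hF q hq.1 hq.2

theorem le_of_mem_Xo {q : Y} (hq : q ∈ Xo) {I J : Vertex} (h : I.1 ⊆ J.1) : (q I).1 ≤ (q J).1 := by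
  obtain ⟨g, rfl⟩ := hq
  refine Submodule.map_mono (Submodule.span_mono (Set.image_mono ?_))
  exact_mod_cast h

theorem eq_of_mem_Xo {q : Y} (hq : q ∈ Xo) {I J : Vertex} (h : (q I).1 = (q J).1) :
    I.1 = J.1 := by
  obtain ⟨g, rfl⟩ := hq
  have hE : E I.1 = E J.1 := Submodule.map_injective_of_injective g.injective h
  have key : ∀ (S : Finset (Fin 4)) (i : Fin 4), (Pi.single i 1 : V4) ∈ E S ↔ i ∈ S := by
    intro S i
    rw [mem_E]
    constructor
    · intro h
      by_contra hi
      simpa using h i hi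
    · intro hi j hj
      have : j ≠ i := by rintro rfl; exact hj hi
      simp [this]
  ext i
  rw [← key, ← key, hE]

theorem mem_iff_of_card_one {p : Y} (hp : InCells p) {I : Vertex} (hI : I.1.card = 1) {v : V4} :
    v ∈ (p I).1 ↔
      v 1 = af p I.1 {1} * v 0 ∧ v 2 = af p I.1 {2} * v 0 ∧ v 3 = af p I.1 {3} * v 0 := by
  have aux : ∀ {k : ℕ} (_ : k = 1) {W : Gr k} (_ : InCell W), v ∈ W.1 ↔
      v 1 = aff W {1} * v 0 ∧ v 2 = aff W {2} * v 0 ∧ v 3 = aff W {3} * v 0 := by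
    rintro k rfl W hW
    exact mem_one_iff hW
  rw [af_eq_aff p I (by simp [hI]), af_eq_aff p I (by simp [hI]), af_eq_aff p I (by simp [hI])]
  exact aux hI (hp I)

theorem mem_iff_of_card_two {p : Y} (hp : InCells p) {I : Vertex} (hI : I.1.card = 2) {v : V4} :
    v ∈ (p I).1 ↔
      v 2 = -af p I.1 {1, 2} * v 0 + af p I.1 {0, 2} * v 1 ∧
        v 3 = -af p I.1 {1, 3} * v 0 + af p I.1 {0, 3} * v 1 := by
  have aux : ∀ {k : ℕ} (_ : k = 2) {W : Gr k} (_ : InCell W), v ∈ W.1 ↔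
      v 2 = -aff W {1, 2} * v 0 + aff W {0, 2} * v 1 ∧
        v 3 = -aff W {1, 3} * v 0 + aff W {0, 3} * v 1 := by
    rintro k rfl W hW
    exact mem_two_iff hW
  rw [af_eq_aff p I (by rw [hI]; decide), af_eq_aff p I (by rw [hI]; decide),
    af_eq_aff p I (by rw [hI]; decide), af_eq_aff p I (by rw [hI]; decide)]
  exact aux hI (hp I)

theorem mem_iff_of_card_three {p : Y} (hp : InCells p) {I : Vertex} (hI : I.1.card = 3) {v : V4} :
    v ∈ (p I).1 ↔ v 3 = af p I.1 {1, 2, 3} * v 0 - af p I.1 {0, 2, 3} * v 1 +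
      af p I.1 {0, 1, 3} * v 2 := by
  have aux : ∀ {k : ℕ} (_ : k = 3) {W : Gr k} (_ : InCell W), v ∈ W.1 ↔
      v 3 = aff W {1, 2, 3} * v 0 - aff W {0, 2, 3} * v 1 + aff W {0, 1, 3} * v 2 := by
    rintro k rfl W hW
    exact mem_three_iff hW
  rw [af_eq_aff p I (by rw [hI]; decide), af_eq_aff p I (by rw [hI]; decide),
    af_eq_aff p I (by rw [hI]; decide)]
  exact aux hI (hp I)

theorem af_std {p : Y} (hp : InCells p) (I : Vertex) : af p I.1 (std I.1.card) = 1 := by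
  rw [af_eq_aff p I (card_std _ (by have := (card_vertex I).2; omega))]
  exact aff_std (hp I)

theorem af_two_three {p : Y} (hp : InCells p) {I : Vertex} (hI : I.1.card = 2) :
    af p I.1 {2, 3} = af p I.1 {0, 2} * af p I.1 {1, 3} - af p I.1 {1, 2} * af p I.1 {0, 3} := by
  have aux : ∀ {k : ℕ} (_ : k = 2) {W : Gr k} (_ : InCell W),
      aff W {2, 3} = aff W {0, 2} * aff W {1, 3} - aff W {1, 2} * aff W {0, 3} := by
    rintro k rfl W hW
    exact aff_two_three hW
  rw [af_eq_aff p I (by rw [hI]; decide), af_eq_aff p I (by rw [hI]; decide),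
    af_eq_aff p I (by rw [hI]; decide), af_eq_aff p I (by rw [hI]; decide),
    af_eq_aff p I (by rw [hI]; decide)]
  exact aux hI (hp I)

theorem point_on_line_of_le {q : Y} (hc : InCells q) {I J : Vertex} (hI : I.1.card = 1)
    (hJ : J.1.card = 2) (hle : (q I).1 ≤ (q J).1) :
    af q I.1 {2} = -af q J.1 {1, 2} + af q J.1 {0, 2} * af q I.1 {1} ∧
      af q I.1 {3} = -af q J.1 {1, 3} + af q J.1 {0, 3} * af q I.1 {1} := by
  have h : ![1, af q I.1 {1}, af q I.1 {2}, af q I.1 {3}] ∈ (q I).1 := by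
    rw [mem_iff_of_card_one hc hI]
    simp
  have := (mem_iff_of_card_two hc hJ).1 (hle h)
  simpa using this

theorem line_in_plane_of_le {q : Y} (hc : InCells q) {I J : Vertex} (hI : I.1.card = 2)
    (hJ : J.1.card = 3) (hle : (q I).1 ≤ (q J).1) :
    -af q I.1 {1, 3} = af q J.1 {1, 2, 3} - af q J.1 {0, 1, 3} * af q I.1 {1, 2} ∧
      af q I.1 {0, 3} = -af q J.1 {0, 2, 3} + af q J.1 {0, 1, 3} * af q I.1 {0, 2} := by
  have h1 : ![1, 0, -af q I.1 {1, 2}, -af q I.1 {1, 3}] ∈ (q I).1 := by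
    rw [mem_iff_of_card_two hc hI]
    simp
  have h2 : ![0, 1, af q I.1 {0, 2}, af q I.1 {0, 3}] ∈ (q I).1 := by
    rw [mem_iff_of_card_two hc hI]
    simp
  have e1 := (mem_iff_of_card_three hc hJ).1 (hle h1)
  have e2 := (mem_iff_of_card_three hc hJ).1 (hle h2)
  simp at e1 e2
  exact ⟨by linear_combination e1, e2⟩

/-- Incidence is a polynomial condition on the affine coordinates and is inherited from the orbit.
-/
theorem point_on_line {p : Y} (hp : p ∈ U) {I J : Vertex} (hI : I.1.card = 1)
    (hJ : J.1.card = 2) (h : I.1 ⊆ J.1) :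
    af p I.1 {2} = -af p J.1 {1, 2} + af p J.1 {0, 2} * af p I.1 {1} ∧
      af p I.1 {3} = -af p J.1 {1, 3} + af p J.1 {0, 3} * af p I.1 {1} := by
  constructor
  · have := eq_zero_of_mem_U hp (pv I.1 {2} - (-pv J.1 {1, 2} + pv J.1 {0, 2} * pv I.1 {1}))
      fun q hq hc => by
        simp only [map_sub, map_add, map_neg, map_mul, eval_pv, sub_eq_zero]
        exact (point_on_line_of_le hc hI hJ (le_of_mem_Xo hq h)).1
    simpa only [map_sub, map_add, map_neg, map_mul, eval_pv, sub_eq_zero] using this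
  · have := eq_zero_of_mem_U hp (pv I.1 {3} - (-pv J.1 {1, 3} + pv J.1 {0, 3} * pv I.1 {1}))
      fun q hq hc => by
        simp only [map_sub, map_add, map_neg, map_mul, eval_pv, sub_eq_zero]
        exact (point_on_line_of_le hc hI hJ (le_of_mem_Xo hq h)).2
    simpa only [map_sub, map_add, map_neg, map_mul, eval_pv, sub_eq_zero] using this

theorem line_in_plane {p : Y} (hp : p ∈ U) {I J : Vertex} (hI : I.1.card = 2)
    (hJ : J.1.card = 3) (h : I.1 ⊆ J.1) :
    -af p I.1 {1, 3} = af p J.1 {1, 2, 3} - af p J.1 {0, 1, 3} * af p I.1 {1, 2} ∧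
      af p I.1 {0, 3} = -af p J.1 {0, 2, 3} + af p J.1 {0, 1, 3} * af p I.1 {0, 2} := by
  constructor
  · have := eq_zero_of_mem_U hp
      (-pv I.1 {1, 3} - (pv J.1 {1, 2, 3} - pv J.1 {0, 1, 3} * pv I.1 {1, 2}))
      fun q hq hc => by
        simp only [map_sub, map_neg, map_mul, eval_pv]
        exact sub_eq_zero.2 (line_in_plane_of_le hc hI hJ (le_of_mem_Xo hq h)).1
    simp only [map_sub, map_neg, map_mul, eval_pv] at this
    exact sub_eq_zero.1 this
  · have := eq_zero_of_mem_U hp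
      (pv I.1 {0, 3} - (-pv J.1 {0, 2, 3} + pv J.1 {0, 1, 3} * pv I.1 {0, 2}))
      fun q hq hc => by
        simp only [map_sub, map_add, map_neg, map_mul, eval_pv]
        exact sub_eq_zero.2 (line_in_plane_of_le hc hI hJ (le_of_mem_Xo hq h)).2
    simp only [map_sub, map_add, map_neg, map_mul, eval_pv] at this
    exact sub_eq_zero.1 this

/-- The vertex `{i}`. -/
def vert (i : Fin 4) : Vertex := ⟨{i}, by revert i; decide⟩

/-- The vertex `{i, j}`. -/
def line (i j : Fin 4) : Vertex := ⟨{i, j}, by revert i j; decide⟩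

/-- The complement of `{i}`. -/
def face (i : Fin 4) : Vertex := ⟨{i}ᶜ, by revert i; decide⟩

theorem card_vert (i : Fin 4) : (vert i).1.card = 1 := by revert i; decide

theorem card_line {i j : Fin 4} (h : i ≠ j) : (line i j).1.card = 2 := Finset.card_pair h

theorem card_face (i : Fin 4) : (face i).1.card = 3 := by revert i; decide

theorem line_comm (i j : Fin 4) : line i j = line j i := Subtype.ext (Finset.pair_comm _ _)

theorem vert_subset_line (i j : Fin 4) : (vert i).1 ⊆ (line i j).1 := by revert i j; decide

theorem line_subset_face {i j l : Fin 4} (hi : i ≠ l) (hj : j ≠ l) :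
    (line i j).1 ⊆ (face l).1 := by
  revert i j l; decide

/-- The configuration of a point. -/
noncomputable def cfg (p : Y) : Config :=
  (fun i => af p (vert i).1 {1}, fun i j => if i = j then 0 else af p (line i j).1 {0, 2},
    fun i => -af p (face i).1 {0, 1, 3})

theorem cfg_s {p : Y} {i j : Fin 4} (h : i ≠ j) : (cfg p).2.1 i j = af p (line i j).1 {0, 2} :=
  if_neg h

/-- Incidence of vertices and lines in affine coordinates. -/
theorem vert_line {p : Y} (hp : p ∈ U) {i j : Fin 4} (h : i ≠ j) :
    af p (vert i).1 {2} = -af p (line i j).1 {1, 2} + (cfg p).2.1 i j * (cfg p).1 i ∧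
      af p (vert i).1 {3} =
        -af p (line i j).1 {1, 3} + af p (line i j).1 {0, 3} * (cfg p).1 i := by
  rw [cfg_s h]
  exact point_on_line hp (card_vert i) (card_line h) (vert_subset_line i j)

/-- Incidence of lines and faces in affine coordinates. -/
theorem line_face {p : Y} (hp : p ∈ U) {i j l : Fin 4} (h : i ≠ j) (hi : i ≠ l) (hj : j ≠ l) :
    -af p (line i j).1 {1, 3} =
      af p (face l).1 {1, 2, 3} + (cfg p).2.2 l * af p (line i j).1 {1, 2} ∧
      af p (line i j).1 {0, 3} = -af p (face l).1 {0, 2, 3} - (cfg p).2.2 l * (cfg p).2.1 i j := by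
  rw [cfg_s h]
  obtain ⟨h1, h2⟩ := line_in_plane hp (card_line h) (card_face l) (line_subset_face hi hj)
  simp only [cfg]
  exact ⟨by linear_combination h1, by linear_combination h2⟩

theorem cfg_symm (p : Y) (i j : Fin 4) : (cfg p).2.1 i j = (cfg p).2.1 j i := by
  simp only [cfg, line_comm i j, eq_comm]

/-- Both vertices satisfy the equations of their common line; the intercepts cancel in the
difference. -/
theorem vert_sub_vert {p : Y} (hp : p ∈ U) {i j : Fin 4} (h : i ≠ j) :
    af p (vert j).1 {2} - af p (vert i).1 {2} = (cfg p).2.1 i j * ((cfg p).1 j - (cfg p).1 i) ∧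
    af p (vert j).1 {3} - af p (vert i).1 {3} =
      af p (line i j).1 {0, 3} * ((cfg p).1 j - (cfg p).1 i) := by
  obtain ⟨h1, h2⟩ := vert_line hp h
  obtain ⟨h3, h4⟩ := vert_line hp h.symm
  rw [cfg_symm] at h3
  rw [line_comm] at h3 h4
  exact ⟨by linear_combination h3 - h1, by linear_combination h4 - h2⟩

theorem line_sub_line {p : Y} (hp : p ∈ U) {i j k l m : Fin 4} (h : i ≠ j) (h' : k ≠ l)
    (hi : i ≠ m) (hj : j ≠ m) (hk : k ≠ m) (hl : l ≠ m) :
    af p (line k l).1 {0, 3} - af p (line i j).1 {0, 3} =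
      -(cfg p).2.2 m * ((cfg p).2.1 k l - (cfg p).2.1 i j) := by
  linear_combination (line_face hp h' hk hl).2 - (line_face hp h hi hj).2

/-- The quadrics are closing conditions: the increments of the second vertex coordinate around `i,
j, k`, respectively of the second slope around the lines `il, jl, kl`, add up to zero. -/
theorem inc_cfg {p : Y} (hp : p ∈ U) : Inc (cfg p) where
  symm := cfg_symm p
  diag i := if_pos rfl
  quad₁ i j k h := by
    have hij : i ≠ j := by rintro rfl; simp at h
    have hik : i ≠ k := by rintro rfl; simp at h
    have hjk : j ≠ k := by rintro rfl; simp at h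
    linear_combination (vert_sub_vert hp hij).1 + (vert_sub_vert hp hjk).1 -
      (vert_sub_vert hp hik).1
  quad₂ i j k l h := by
    have hij : i ≠ j := by rintro rfl; simp at h
    have hik : i ≠ k := by rintro rfl; simp at h
    have hil : i ≠ l := by rintro rfl; simp at h
    have hjk : j ≠ k := by rintro rfl; simp at h
    have hjl : j ≠ l := by rintro rfl; simp at h
    have hkl : k ≠ l := by rintro rfl; simp at h
    linear_combination line_sub_line hp hil hjl hik hkl.symm hjk hkl.symm +
      line_sub_line hp hjl hkl hij.symm hil.symm hik.symm hil.symm -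
      line_sub_line hp hil hkl hij hjl.symm hjk.symm hjl.symm

theorem mem_U_of_mem_Xo {q : Y} (hq : q ∈ Xo) (hc : InCells q) : q ∈ U :=
  mem_U_of_closure hc (subset_closure ⟨q, ⟨hq, hc⟩, rfl⟩)

/-- Equal values on an edge propagate to all affine coordinates: two vertices share a line, two
lines share a vertex and a face, two faces share a line. The two subspaces would then coincide,
which does not happen in the orbit. -/
theorem gen_cfg {q : Y} (hq : q ∈ Xo) (hc : InCells q) : Gen (cfg q) := by
  have hU := mem_U_of_mem_Xo hq hc
  refine ⟨inc_cfg hU, fun i j h ha => ?_, fun i j k h hs => ?_, fun i j h hw => ?_⟩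
  · obtain ⟨h1, h2⟩ := vert_sub_vert hU h
    rw [ha, sub_self, mul_zero, sub_eq_zero] at h1 h2
    have : (vert i).1 = (vert j).1 := eq_of_mem_Xo hq <| by
      ext v
      rw [mem_iff_of_card_one hc (card_vert i), mem_iff_of_card_one hc (card_vert j), h1, h2,
        show af q (vert i).1 {1} = af q (vert j).1 {1} from ha]
    exact h (Finset.singleton_injective this)
  · have hij : i ≠ j := by rintro rfl; simp at h
    have hik : i ≠ k := by rintro rfl; simp at h
    have hjk : j ≠ k := by rintro rfl; simp at h
    obtain ⟨l, hl⟩ := exists_fourth h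
    have hil : i ≠ l := by rintro rfl; simp at hl
    have hjl : j ≠ l := by rintro rfl; simp at hl
    have hkl : k ≠ l := by rintro rfl; simp at hl
    have h1 := line_sub_line hU hik hjk hil hkl hjl hkl
    rw [hs, sub_self, mul_zero, sub_eq_zero] at h1
    obtain ⟨h2, h3⟩ := vert_line hU hik.symm
    obtain ⟨h4, h5⟩ := vert_line hU hjk.symm
    rw [cfg_symm, line_comm] at h2 h4
    rw [line_comm] at h3 h5
    rw [hs] at h2
    rw [← h1] at h3
    have h6 : -af q (line i k).1 {1, 2} = -af q (line j k).1 {1, 2} := by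
      linear_combination h4 - h2
    have h7 : -af q (line i k).1 {1, 3} = -af q (line j k).1 {1, 3} := by
      linear_combination h5 - h3
    rw [cfg_s hik, cfg_s hjk] at hs
    have : (line i k).1 = (line j k).1 := eq_of_mem_Xo hq <| by
      ext v
      rw [mem_iff_of_card_two hc (card_line hik), mem_iff_of_card_two hc (card_line hjk), h1, h6,
        h7, hs]
    have hi : i ∈ (line j k).1 := by rw [← this]; simp [line]
    simp [line, hij, hik] at hi
  · obtain ⟨k, l, hn⟩ := exists_third_fourth h
    have hik : i ≠ k := by rintro rfl; simp at hn
    have hil : i ≠ l := by rintro rfl; simp at hn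
    have hjk : j ≠ k := by rintro rfl; simp at hn
    have hjl : j ≠ l := by rintro rfl; simp at hn
    have hkl : k ≠ l := by rintro rfl; simp at hn
    obtain ⟨h1, h2⟩ := line_face hU hkl hik.symm hil.symm
    obtain ⟨h3, h4⟩ := line_face hU hkl hjk.symm hjl.symm
    rw [hw] at h1 h2
    have h5 : af q (face i).1 {1, 2, 3} = af q (face j).1 {1, 2, 3} := by linear_combination h3 - h1
    have h6 : af q (face i).1 {0, 2, 3} = af q (face j).1 {0, 2, 3} := by linear_combination h2 - h4
    have h7 : af q (face i).1 {0, 1, 3} = af q (face j).1 {0, 1, 3} := neg_injective hw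
    have : (face i).1 = (face j).1 := eq_of_mem_Xo hq <| by
      ext v
      rw [mem_iff_of_card_three hc (card_face i), mem_iff_of_card_three hc (card_face j), h5, h6,
        h7]
    exact h (Finset.singleton_injective (compl_injective this))

theorem Gen.cub {z : Config} (h : Gen z) : Cub z.2.1 :=
  cub_of_a_ne h.toInc (h.a_ne 0 1 (by decide))

theorem Gen.exists_eq_fam {z : Config} (h : Gen z) : ∃ p q K c d, z = fam z.1 p q K 1 c d :=
  Tetrahedra.exists_eq_fam h.toInc h.a_ne (h.s_ne 2 0 3 (by decide)) (h.s_ne 1 0 3 (by decide))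
    (h.s_ne 1 0 2 (by decide))

/-- In the parametrization both sides equal `K ^ 2 N_0 N_1 N_2 N_3` times the same product of
differences of `a`. -/
theorem Gen.quar {z : Config} (h : Gen z) : Quar z.1 z.2.2 := by
  obtain ⟨p, q, K, c, d, e⟩ := h.exists_eq_fam
  intro i j k l hn
  have h1 := fam_w z.1 p q K 1 c d j k i l (by
    clear * - hn; revert i j k l; decide)
  have h2 := fam_w z.1 p q K 1 c d l i j k (by
    clear * - hn; revert i j k l; decide)
  have h3 := fam_w z.1 p q K 1 c d i j k l hn
  have h4 := fam_w z.1 p q K 1 c d k l i j (by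
    clear * - hn; revert i j k l; decide)
  rw [← e] at h1 h2 h3 h4
  rw [h1, h2, h3, h4]
  ring

theorem cub_cfg {p : Y} (hp : p ∈ U) : Cub (cfg p).2.1 := by
  intro i j k l h
  have hij : i ≠ j := by rintro rfl; simp at h
  have hik : i ≠ k := by rintro rfl; simp at h
  have hil : i ≠ l := by rintro rfl; simp at h
  have hjk : j ≠ k := by rintro rfl; simp at h
  have hjl : j ≠ l := by rintro rfl; simp at h
  have hkl : k ≠ l := by rintro rfl; simp at h
  have := eq_zero_of_mem_U hp ((pv (line i l).1 {0, 2} - pv (line i j).1 {0, 2}) *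
      (pv (line k l).1 {0, 2} - pv (line i k).1 {0, 2}) *
      (pv (line j l).1 {0, 2} - pv (line j k).1 {0, 2}) -
      (pv (line k l).1 {0, 2} - pv (line j k).1 {0, 2}) *
      (pv (line j l).1 {0, 2} - pv (line i j).1 {0, 2}) *
      (pv (line i l).1 {0, 2} - pv (line i k).1 {0, 2})) fun q hq hc => by
    have := (gen_cfg hq hc).cub i j k l h
    rw [cfg_s hij, cfg_s hik, cfg_s hil, cfg_s hjk, cfg_s hjl, cfg_s hkl] at this
    simp only [map_sub, map_mul, eval_pv]
    exact sub_eq_zero.2 this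
  simp only [map_sub, map_mul, eval_pv] at this
  rw [cfg_s hij, cfg_s hik, cfg_s hil, cfg_s hjk, cfg_s hjl, cfg_s hkl]
  exact sub_eq_zero.1 this

theorem quar_cfg {p : Y} (hp : p ∈ U) : Quar (cfg p).1 (cfg p).2.2 := by
  intro i j k l h
  have := eq_zero_of_mem_U hp ((pv (vert j).1 {1} - pv (vert i).1 {1}) *
      (pv (vert l).1 {1} - pv (vert k).1 {1}) *
      (-pv (face k).1 {0, 1, 3} - -pv (face j).1 {0, 1, 3}) *
      (-pv (face i).1 {0, 1, 3} - -pv (face l).1 {0, 1, 3}) -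
      (pv (vert k).1 {1} - pv (vert j).1 {1}) * (pv (vert i).1 {1} - pv (vert l).1 {1}) *
      (-pv (face j).1 {0, 1, 3} - -pv (face i).1 {0, 1, 3}) *
      (-pv (face l).1 {0, 1, 3} - -pv (face k).1 {0, 1, 3})) fun q hq hc => by
    have := (gen_cfg hq hc).quar i j k l h
    simp only [map_sub, map_mul, map_neg, eval_pv]
    exact sub_eq_zero.2 this
  simp only [map_sub, map_mul, map_neg, eval_pv] at this
  exact sub_eq_zero.1 this

theorem mem_Lim_of_relations {z : Config} (hz : Inc z) (hc : Cub z.2.1) (hq : Quar z.1 z.2.2) :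
    z ∈ Lim := by
  by_cases hs : SConst z.2.1
  · obtain ⟨a, s, w⟩ := z
    obtain ⟨h1, h2, h3, h4, h5⟩ := SConst.eq hz hs
    have := eq_symm4 hz.symm hz.diag
    simp only at *
    rw [this, h1, h2, h3, h4, h5]
    exact const_mem_Lim _ hq
  · exact mem_Lim_of_cub hz hc hs

theorem cfg_mem_Lim {p : Y} (hp : p ∈ U) : cfg p ∈ Lim :=
  mem_Lim_of_relations (inc_cfg hp) (cub_cfg hp) (quar_cfg hp)

end Tetrahedra

namespace Tetrahedra

/-! ## Reconstruction of a tetrahedron from its configuration -/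

/-- The second affine coordinates of the vertices. -/
noncomputable def bVec (z : Config) (b : ℂ) (i : Fin 4) : ℂ := b + z.2.1 0 i * (z.1 i - z.1 0)

/-- The second slopes of the lines. -/
noncomputable def tMat (z : Config) (t : ℂ) : Fin 4 → Fin 4 → ℂ :=
  symm4 t (t - z.2.2 3 * (z.2.1 0 2 - z.2.1 0 1)) (t - z.2.2 2 * (z.2.1 0 3 - z.2.1 0 1))
    (t - z.2.2 3 * (z.2.1 1 2 - z.2.1 0 1)) (t - z.2.2 2 * (z.2.1 1 3 - z.2.1 0 1))
    (t - z.2.2 3 * (z.2.1 0 2 - z.2.1 0 1) - z.2.2 1 * (z.2.1 2 3 - z.2.1 0 2))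

/-- The third affine coordinates of the vertices. -/
noncomputable def cVec (z : Config) (c t : ℂ) (i : Fin 4) : ℂ :=
  c + tMat z t 0 i * (z.1 i - z.1 0)

/-- The affine Plücker coordinates of the vertices. -/
noncomputable def vertVal (z : Config) (b c t : ℂ) (i : Fin 4) (S : Finset (Fin 4)) : ℂ :=
  if S = {0} then 1 else if S = {1} then z.1 i else if S = {2} then bVec z b i else cVec z c t i

/-- The affine Plücker coordinates of the lines. -/
noncomputable def lineVal (z : Config) (b c t : ℂ) (i j : Fin 4) (S : Finset (Fin 4)) : ℂ :=
  if S = {0, 1} then 1 else if S = {0, 2} then z.2.1 i j else if S = {0, 3} then tMat z t i j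
  else if S = {1, 2} then -(bVec z b i - z.2.1 i j * z.1 i)
  else if S = {1, 3} then -(cVec z c t i - tMat z t i j * z.1 i)
  else z.2.1 i j * -(cVec z c t i - tMat z t i j * z.1 i) -
    -(bVec z b i - z.2.1 i j * z.1 i) * tMat z t i j

/-- The smallest two labels different from a given one. -/
def others : Fin 4 → Fin 4 × Fin 4 := ![(1, 2), (0, 2), (0, 1), (0, 1)]

/-- The affine Plücker coordinates of the faces. -/
noncomputable def faceVal (z : Config) (b c t : ℂ) (l : Fin 4) (S : Finset (Fin 4)) : ℂ :=
  if S = {0, 1, 2} then 1 else if S = {0, 1, 3} then -z.2.2 l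
  else if S = {0, 2, 3} then
    -(tMat z t (others l).1 (others l).2 + z.2.2 l * z.2.1 (others l).1 (others l).2)
  else cVec z c t (others l).1 - tMat z t (others l).1 (others l).2 * z.1 (others l).1 +
    z.2.2 l * (bVec z b (others l).1 - z.2.1 (others l).1 (others l).2 * z.1 (others l).1)

/-- The affine Plücker coordinates of a tetrahedron in terms of its configuration. -/
noncomputable def val (z : Config) (b c t : ℂ) (I S : Finset (Fin 4)) : ℂ :=
  if I.card = 1 then ∑ i ∈ I, vertVal z b c t i S
  else if I.card = 2 then ∑ i ∈ I, ∑ j ∈ I, if i < j then lineVal z b c t i j S else 0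
  else ∑ l ∈ Iᶜ, faceVal z b c t l S

theorem val_vert (z : Config) (b c t : ℂ) (i : Fin 4) (S : Finset (Fin 4)) :
    val z b c t (vert i).1 S = vertVal z b c t i S := by
  rw [val, if_pos (card_vert i)]
  exact Finset.sum_singleton _ _

theorem val_line (z : Config) (b c t : ℂ) {i j : Fin 4} (h : i < j) (S : Finset (Fin 4)) :
    val z b c t (line i j).1 S = lineVal z b c t i j S := by
  rw [val, if_neg (by rw [card_line h.ne]; decide), if_pos (card_line h.ne)]
  simp [line, Finset.sum_pair h.ne, h, h.not_gt]

theorem val_face (z : Config) (b c t : ℂ) (l : Fin 4) (S : Finset (Fin 4)) :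
    val z b c t (face l).1 S = faceVal z b c t l S := by
  rw [val, if_neg (by rw [card_face]; decide), if_neg (by rw [card_face]; decide)]
  simp [face]

theorem vertex_cases (I : Vertex) :
    (∃ i, I = vert i) ∨ (∃ i j, i < j ∧ I = line i j) ∨ ∃ l, I = face l := by
  revert I; decide

theorem minor_one_cases {S : Finset (Fin 4)} (h : S.card = 1) :
    S = {0} ∨ S = {1} ∨ S = {2} ∨ S = {3} := by
  revert S; decide

theorem minor_two_cases {S : Finset (Fin 4)} (h : S.card = 2) :
    S = {0, 1} ∨ S = {0, 2} ∨ S = {0, 3} ∨ S = {1, 2} ∨ S = {1, 3} ∨ S = {2, 3} := by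
  revert S; decide

theorem minor_three_cases {S : Finset (Fin 4)} (h : S.card = 3) :
    S = {0, 1, 2} ∨ S = {0, 1, 3} ∨ S = {0, 2, 3} ∨ S = {1, 2, 3} := by
  revert S; decide

section
variable (z : Config) (b c t : ℂ)

theorem vertVal_one (i : Fin 4) : vertVal z b c t i {1} = z.1 i := by
  rw [vertVal, if_neg (by decide), if_pos rfl]

theorem vertVal_two (i : Fin 4) : vertVal z b c t i {2} = bVec z b i := by
  rw [vertVal, if_neg (by decide), if_neg (by decide), if_pos rfl]

theorem vertVal_three (i : Fin 4) : vertVal z b c t i {3} = cVec z c t i := by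
  rw [vertVal, if_neg (by decide), if_neg (by decide), if_neg (by decide)]

theorem lineVal_zero_two (i j : Fin 4) : lineVal z b c t i j {0, 2} = z.2.1 i j := by
  rw [lineVal, if_neg (by decide), if_pos rfl]

theorem lineVal_zero_three (i j : Fin 4) : lineVal z b c t i j {0, 3} = tMat z t i j := by
  rw [lineVal, if_neg (by decide), if_neg (by decide), if_pos rfl]

theorem lineVal_one_two (i j : Fin 4) :
    lineVal z b c t i j {1, 2} = -(bVec z b i - z.2.1 i j * z.1 i) := by
  rw [lineVal, if_neg (by decide), if_neg (by decide), if_neg (by decide), if_pos rfl]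

theorem lineVal_one_three (i j : Fin 4) :
    lineVal z b c t i j {1, 3} = -(cVec z c t i - tMat z t i j * z.1 i) := by
  rw [lineVal, if_neg (by decide), if_neg (by decide), if_neg (by decide), if_neg (by decide),
    if_pos rfl]

theorem lineVal_two_three (i j : Fin 4) :
    lineVal z b c t i j {2, 3} = z.2.1 i j * -(cVec z c t i - tMat z t i j * z.1 i) -
      -(bVec z b i - z.2.1 i j * z.1 i) * tMat z t i j := by
  rw [lineVal, if_neg (by decide), if_neg (by decide), if_neg (by decide), if_neg (by decide),
    if_neg (by decide)]

theorem faceVal_zero_one_three (l : Fin 4) : faceVal z b c t l {0, 1, 3} = -z.2.2 l := by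
  rw [faceVal, if_neg (by decide), if_pos rfl]

theorem faceVal_zero_two_three (l : Fin 4) : faceVal z b c t l {0, 2, 3} =
    -(tMat z t (others l).1 (others l).2 + z.2.2 l * z.2.1 (others l).1 (others l).2) := by
  rw [faceVal, if_neg (by decide), if_neg (by decide), if_pos rfl]

theorem faceVal_one_two_three (l : Fin 4) : faceVal z b c t l {1, 2, 3} =
    cVec z c t (others l).1 - tMat z t (others l).1 (others l).2 * z.1 (others l).1 +
      z.2.2 l * (bVec z b (others l).1 - z.2.1 (others l).1 (others l).2 * z.1 (others l).1) := by
  rw [faceVal, if_neg (by decide), if_neg (by decide), if_neg (by decide)]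

end

/-- `p` lies in the big cell and has prescribed affine Plücker coordinates. -/
structure HasVal (p : Y) (z : Config) (b c t : ℂ) : Prop where
  inCells : InCells p
  eq : ∀ (I : Vertex) (S : Finset (Fin 4)), S.card = I.1.card → af p I.1 S = val z b c t I.1 S

/-- The factors of the product are chosen independently, each in its big cell, so no relation on `z`
is needed; incidences enter only later. -/
theorem exists_hasVal (z : Config) (b c t : ℂ) : ∃ p, HasVal p z b c t := by
  have key : ∀ I : Vertex, ∃ W : Gr I.1.card, InCell W ∧
      ∀ S : Finset (Fin 4), S.card = I.1.card → aff W S = val z b c t I.1 S := by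
    intro I
    rcases vertex_cases I with ⟨i, rfl⟩ | ⟨i, j, hij, rfl⟩ | ⟨l, rfl⟩
    · have aux : ∀ {k : ℕ} (_ : k = 1), ∃ W : Gr k, InCell W ∧
          ∀ S : Finset (Fin 4), S.card = k → aff W S = vertVal z b c t i S := by
        rintro k rfl
        obtain ⟨W, hW, h1, h2, h3⟩ := exists_gr_one (z.1 i) (bVec z b i) (cVec z c t i)
        refine ⟨W, hW, fun S hS => ?_⟩
        rcases minor_one_cases hS with rfl | rfl | rfl | rfl
        · exact (aff_std hW).trans (if_pos rfl).symm
        · rw [h1, vertVal_one]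
        · rw [h2, vertVal_two]
        · rw [h3, vertVal_three]
      simp only [val_vert]
      exact aux (card_vert i)
    · have aux : ∀ {k : ℕ} (_ : k = 2), ∃ W : Gr k, InCell W ∧
          ∀ S : Finset (Fin 4), S.card = k → aff W S = lineVal z b c t i j S := by
        rintro k rfl
        obtain ⟨W, hW, h1, h2, h3, h4⟩ := exists_gr_two (bVec z b i - z.2.1 i j * z.1 i)
          (cVec z c t i - tMat z t i j * z.1 i) (z.2.1 i j) (tMat z t i j)
        rw [neg_eq_iff_eq_neg] at h1 h2
        refine ⟨W, hW, fun S hS => ?_⟩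
        rcases minor_two_cases hS with rfl | rfl | rfl | rfl | rfl | rfl
        · exact (aff_std hW).trans (if_pos rfl).symm
        · rw [h3, lineVal_zero_two]
        · rw [h4, lineVal_zero_three]
        · rw [h1, lineVal_one_two]
        · rw [h2, lineVal_one_three]
        · rw [aff_two_three hW, h1, h2, h3, h4, lineVal_two_three]
      simp only [val_line _ _ _ _ hij]
      exact aux (card_line hij.ne)
    · have aux : ∀ {k : ℕ} (_ : k = 3), ∃ W : Gr k, InCell W ∧
          ∀ S : Finset (Fin 4), S.card = k → aff W S = faceVal z b c t l S := by
        rintro k rfl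
        obtain ⟨W, hW, h1, h2, h3⟩ := exists_gr_three (cVec z c t (others l).1 -
          tMat z t (others l).1 (others l).2 * z.1 (others l).1 + z.2.2 l *
          (bVec z b (others l).1 - z.2.1 (others l).1 (others l).2 * z.1 (others l).1))
          (tMat z t (others l).1 (others l).2 + z.2.2 l * z.2.1 (others l).1 (others l).2)
          (-z.2.2 l)
        rw [neg_eq_iff_eq_neg] at h2
        refine ⟨W, hW, fun S hS => ?_⟩
        rcases minor_three_cases hS with rfl | rfl | rfl | rfl
        · exact (aff_std hW).trans (if_pos rfl).symm
        · rw [h3, faceVal_zero_one_three]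
        · rw [h2, faceVal_zero_two_three]
        · rw [h1, faceVal_one_two_three]
      simp only [val_face]
      exact aux (card_face l)
  choose p hp using key
  exact ⟨p, fun I => (hp I).1, fun I S hS => (af_eq_aff p I hS).trans ((hp I).2 S hS)⟩

/-- `bVec` is defined by stepping from vertex 0; the quadric of the triangle `0ij` makes it
consistent along the edge `ij`. -/
theorem bVec_sub {z : Config} (hz : Inc z) (b : ℂ) {i j : Fin 4} (h : i ≠ j) :
    bVec z b j - bVec z b i = z.2.1 i j * (z.1 j - z.1 i) := by
  simp only [bVec]
  by_cases hi : i = 0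
  · subst hi; ring
  by_cases hj : j = 0
  · subst hj; rw [hz.symm i 0]; ring
  have := hz.quad₁ 0 i j (by simp [Ne.symm hi, Ne.symm hj, h])
  linear_combination this

/-- `tMat` is defined along chosen paths in the octahedron starting at the line `01`, reaching the
opposite line `23` through `02`. The second quadrics give independence of the path. -/
theorem tMat_sub {z : Config} (hz : Inc z) (t : ℂ) {i j k l : Fin 4} (h : [i, j, k, l].Nodup) :
    tMat z t i k - tMat z t i j = -z.2.2 l * (z.2.1 i k - z.2.1 i j) := by
  obtain ⟨f0, f1, f2, f3⟩ := hz.eqs₂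
  obtain ⟨a, s, w⟩ := z
  have hs := eq_symm4 hz.symm hz.diag
  simp only at *
  rw [hs]
  generalize s 0 1 = s01 at *
  generalize s 0 2 = s02 at *
  generalize s 0 3 = s03 at *
  generalize s 1 2 = s12 at *
  generalize s 1 3 = s13 at *
  generalize s 2 3 = s23 at *
  fin_cases i <;> fin_cases j <;> fin_cases k <;> fin_cases l <;> first
    | exact absurd h (by decide)
    | (simp only [tMat, symm4, Fin.isValue, Fin.zero_eta, Fin.mk_one, Fin.reduceFinMk,
        Matrix.cons_val]
       first
        | ring1
        | linear_combination f0 | linear_combination -f0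
        | linear_combination f1 | linear_combination -f1
        | linear_combination f2 | linear_combination -f2
        | linear_combination f3 | linear_combination -f3
        | linear_combination f0 - f3 | linear_combination f0 + f3 | linear_combination -f0 - f3
        | linear_combination f3 - f0)

end Tetrahedra

/-! ### The reconstructed tetrahedron and its nondegeneracy -/

namespace Tetrahedra

theorem tMat_symm (z : Config) (t : ℂ) (i j : Fin 4) : tMat z t i j = tMat z t j i := by
  fin_cases i <;> fin_cases j <;> rfl

/-- Within the face opposite `l`, second slopes vary as `-w_l` times first slopes. The closing
condition for `c` on a triangle thus reduces to the one for `b`. -/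
theorem cVec_sub {z : Config} (hz : Inc z) (c t : ℂ) {i j : Fin 4} (h : i ≠ j) :
    cVec z c t j - cVec z c t i = tMat z t i j * (z.1 j - z.1 i) := by
  by_cases hi : i = 0
  · subst hi; simp only [cVec]; ring
  by_cases hj : j = 0
  · subst hj; simp only [cVec]; rw [tMat_symm z t i 0]; ring
  obtain ⟨l, hl⟩ := exists_fourth (i := 0) (j := i) (k := j)
    (by simp [Ne.symm hi, Ne.symm hj, h])
  have h1 := tMat_sub hz t (i := j) (j := i) (k := 0) (l := l) (by
    clear * - hl; revert i j l; decide)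
  have h2 := tMat_sub hz t (i := i) (j := j) (k := 0) (l := l) (by
    clear * - hl; revert i j l; decide)
  have h3 := hz.quad₁ 0 i j (by simp [Ne.symm hi, Ne.symm hj, h])
  rw [tMat_symm z t j 0, tMat_symm z t j i, hz.symm j 0, hz.symm j i] at h1
  rw [tMat_symm z t i 0, hz.symm i 0] at h2
  simp only [cVec]
  linear_combination (z.1 j - z.1 0) * h1 - (z.1 i - z.1 0) * h2 - z.2.2 l * h3

/-- The vertices of the tetrahedron with a given configuration. -/
noncomputable def vertexVec (z : Config) (b c t : ℂ) (i : Fin 4) : V4 :=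
  ![1, z.1 i, bVec z b i, cVec z c t i]

/-- Lines and faces are described through one chosen vertex or line; the other vertices lie on them
by the increment formulas for `b`, `c` and `t`. -/
theorem vertexVec_mem {p : Y} {z : Config} {b c t : ℂ} (hz : Inc z) (h : HasVal p z b c t)
    {I : Vertex} {m : Fin 4} (hm : m ∈ I.1) : vertexVec z b c t m ∈ (p I).1 := by
  rcases vertex_cases I with ⟨i, rfl⟩ | ⟨i, j, hij, rfl⟩ | ⟨l, rfl⟩
  · obtain rfl : m = i := by simpa [vert] using hm
    have hc := (card_vert m).symm
    rw [mem_iff_of_card_one h.inCells hc.symm, h.eq _ {1} hc, h.eq _ {2} hc, h.eq _ {3} hc, val_vert, val_vert, val_vert,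
      vertVal_one, vertVal_two, vertVal_three]
    simp [vertexVec]
  · have hc := (card_line hij.ne).symm
    rw [mem_iff_of_card_two h.inCells hc.symm, h.eq _ {1, 2} hc, h.eq _ {0, 2} hc,
      h.eq _ {1, 3} hc, h.eq _ {0, 3} hc, val_line _ _ _ _ hij, val_line _ _ _ _ hij,
      val_line _ _ _ _ hij, val_line _ _ _ _ hij, lineVal_one_two, lineVal_zero_two,
      lineVal_one_three, lineVal_zero_three]
    have hm' : m = i ∨ m = j := by simpa [line] using hm
    rcases hm' with rfl | rfl
    · constructor <;> simp [vertexVec]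
    · have h1 := bVec_sub hz b hij.ne
      have h2 := cVec_sub hz c t hij.ne
      constructor <;> simp [vertexVec]
      · linear_combination h1
      · linear_combination h2
  · have hc := (card_face l).symm
    rw [mem_iff_of_card_three h.inCells hc.symm, h.eq _ {1, 2, 3} hc, h.eq _ {0, 2, 3} hc,
      h.eq _ {0, 1, 3} hc, val_face, val_face, val_face, faceVal_one_two_three,
      faceVal_zero_two_three, faceVal_zero_one_three]
    simp only [vertexVec, Matrix.cons_val]
    have hm' : m ≠ l := by simpa [face] using hm
    have ho : (others l).1 ≠ (others l).2 ∧ (others l).1 ≠ l ∧ (others l).2 ≠ l := by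
      clear * -; revert l; decide
    by_cases h1 : m = (others l).1
    · subst h1; ring
    have hb := bVec_sub hz b (Ne.symm h1)
    have hc := cVec_sub hz c t (Ne.symm h1)
    by_cases h2 : m = (others l).2
    · subst h2
      linear_combination hc + z.2.2 l * hb
    have ht := tMat_sub hz t (i := (others l).1) (j := (others l).2) (k := m) (l := l) (by
      simp [ho, hm', Ne.symm h1, Ne.symm h2])
    linear_combination hc + z.2.2 l * hb + (z.1 m - z.1 (others l).1) * ht

theorem linearIndependent_vertexVec {z : Config} (hz : Gen z) (b c t : ℂ) :
    LinearIndependent ℂ (vertexVec z b c t) := by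
  refine Matrix.linearIndependent_rows_of_det_ne_zero (A := Matrix.of (vertexVec z b c t)) ?_
  -- After subtracting row 0 and dividing row `i` by `a i - a 0` the rows are `(1, s 0 i, t 0 i)`.
  -- The differences of `t` are multiples of those of `s` by `-w 3` and `-w 2`, hence the
  -- factorization.
  have : (Matrix.of (vertexVec z b c t)).det =
      (z.1 1 - z.1 0) * (z.1 2 - z.1 0) * (z.1 3 - z.1 0) * (z.2.1 2 0 - z.2.1 1 0) *
        (z.2.1 3 0 - z.2.1 1 0) * (z.2.2 3 - z.2.2 2) := by
    rw [hz.symm 2 0, hz.symm 1 0, hz.symm 3 0]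
    simp [Matrix.det_succ_row_zero, Fin.sum_univ_succ, vertexVec, bVec, cVec, tMat, symm4,
      Fin.succAbove]
    ring
  rw [this]
  have ha := fun i j h => sub_ne_zero.2 (hz.a_ne i j h)
  have hw := fun i j h => sub_ne_zero.2 (hz.w_ne i j h)
  have hs := fun i j k h => sub_ne_zero.2 (hz.s_ne i j k h)
  refine mul_ne_zero (mul_ne_zero (mul_ne_zero (mul_ne_zero (mul_ne_zero ?_ ?_) ?_) ?_) ?_) ?_
  · exact ha _ _ (by decide)
  · exact ha _ _ (by decide)
  · exact ha _ _ (by decide)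
  · exact hs _ _ _ (by decide)
  · exact hs _ _ _ (by decide)
  · exact hw _ _ (by decide)

/-- The linear map taking the standard basis to the four vertices sends each coordinate subspace
into the corresponding face, and dimensions agree. -/
theorem mem_Xo_of_gen {p : Y} {z : Config} {b c t : ℂ} (hz : Gen z) (h : HasVal p z b c t) :
    p ∈ Xo := by
  let B := basisOfLinearIndependentOfCardEqFinrank (linearIndependent_vertexVec hz b c t) (by simp)
  refine ⟨(Pi.basisFun ℂ (Fin 4)).equiv B (Equiv.refl _), ?_⟩
  funext I
  refine Subtype.ext (Submodule.eq_of_le_of_finrank_eq ?_ ?_)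
  · simp only [act, p0, E, Submodule.map_span, Submodule.span_le]
    rintro _ ⟨_, ⟨i, hi, rfl⟩, rfl⟩
    have := (Pi.basisFun ℂ (Fin 4)).equiv_apply i B (Equiv.refl _)
    rw [Pi.basisFun_apply] at this
    simp only [LinearEquiv.coe_coe, this]
    simpa [B] using vertexVec_mem hz.toInc h hi
  · exact (act _ p0 I).2.trans (p I).2.symm

theorem continuous_tMat (t : ℂ) : Continuous fun z : Config => tMat z t :=
  continuous_symm4 (by fun_prop) (by fun_prop) (by fun_prop) (by fun_prop) (by fun_prop)
    (by fun_prop)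

theorem continuous_val (b c t : ℂ) (I S : Finset (Fin 4)) :
    Continuous fun z : Config => val z b c t I S := by
  have ht : ∀ i j, Continuous fun z : Config => tMat z t i j := fun i j =>
    (continuous_apply j).comp ((continuous_apply i).comp (continuous_tMat t))
  have hb : ∀ i, Continuous fun z : Config => bVec z b i := fun i => by unfold bVec; fun_prop
  have hc : ∀ i, Continuous fun z : Config => cVec z c t i := fun i => by unfold cVec; fun_prop
  unfold val
  split_ifs
  · refine continuous_finsetSum _ fun i _ => ?_
    unfold vertVal
    split_ifs <;> fun_prop
  · refine continuous_finsetSum _ fun i _ => continuous_finsetSum _ fun j _ => ?_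
    unfold lineVal
    split_ifs <;> fun_prop
  · refine continuous_finsetSum _ fun i _ => ?_
    unfold faceVal
    split_ifs <;> fun_prop

/-- For fixed `b`, `c`, `t` the affine coordinates are continuous in the configuration and over
`Gen` belong to orbit points. -/
theorem mem_U_of_mem_Lim {p : Y} {z : Config} {b c t : ℂ} (hz : z ∈ Lim) (h : HasVal p z b c t) :
    p ∈ U := by
  refine mem_U_of_closure h.inCells ?_
  have key : ∀ {q : Y} {y : Config}, HasVal q y b c t →
      affCoords q = fun v => val y b c t v.1.1 v.2.1 := fun hq => funext fun v => by
    rw [← hq.eq _ _ v.2.2, ← f_eq_af]; rfl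
  rw [key h]
  have hcont : Continuous fun (y : Config) (v : PluckerVar) => val y b c t v.1.1 v.2.1 :=
    continuous_pi fun v => continuous_val _ _ _ _ _
  refine map_mem_closure hcont hz fun y hy => ?_
  obtain ⟨q, hq⟩ := exists_hasVal y b c t
  exact ⟨q, ⟨mem_Xo_of_gen hy hq, hq.inCells⟩, key hq⟩

end Tetrahedra

/-! ### Recovering a point of the chart from its configuration -/

namespace Tetrahedra

theorem bVec_cfg {p : Y} (hp : p ∈ U) (i : Fin 4) :
    bVec (cfg p) (af p (vert 0).1 {2}) i = af p (vert i).1 {2} := by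
  rw [bVec]
  by_cases hi : i = 0
  · subst hi; ring
  linear_combination -(vert_sub_vert hp (Ne.symm hi)).1

theorem tMat_cfg {p : Y} (hp : p ∈ U) {i j : Fin 4} (h : i ≠ j) :
    tMat (cfg p) (af p (line 0 1).1 {0, 3}) i j = af p (line i j).1 {0, 3} := by
  have e02 := line_sub_line hp (i := 0) (j := 1) (k := 0) (l := 2) (m := 3)
    (by decide) (by decide) (by decide) (by decide) (by decide) (by decide)
  have e03 := line_sub_line hp (i := 0) (j := 1) (k := 0) (l := 3) (m := 2)
    (by decide) (by decide) (by decide) (by decide) (by decide) (by decide)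
  have e12 := line_sub_line hp (i := 0) (j := 1) (k := 1) (l := 2) (m := 3)
    (by decide) (by decide) (by decide) (by decide) (by decide) (by decide)
  have e13 := line_sub_line hp (i := 0) (j := 1) (k := 1) (l := 3) (m := 2)
    (by decide) (by decide) (by decide) (by decide) (by decide) (by decide)
  have e23 := line_sub_line hp (i := 0) (j := 2) (k := 2) (l := 3) (m := 1)
    (by decide) (by decide) (by decide) (by decide) (by decide) (by decide)
  have key : ∀ i j : Fin 4, i < j →
      tMat (cfg p) (af p (line 0 1).1 {0, 3}) i j = af p (line i j).1 {0, 3} := by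
    intro i j h
    fin_cases i <;> fin_cases j <;> first
      | exact absurd h (by decide)
      | (simp only [tMat, symm4, Fin.isValue, Fin.zero_eta, Fin.mk_one, Fin.reduceFinMk,
          Matrix.cons_val]
         first
          | done
          | linear_combination -e02 | linear_combination -e03 | linear_combination -e12
          | linear_combination -e13 | linear_combination -e02 - e23)
  rcases h.lt_or_gt with h | h
  · exact key i j h
  · rw [tMat_symm, line_comm i j]
    exact key _ _ h

theorem cVec_cfg {p : Y} (hp : p ∈ U) (i : Fin 4) :
    cVec (cfg p) (af p (vert 0).1 {3}) (af p (line 0 1).1 {0, 3}) i = af p (vert i).1 {3} := by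
  rw [cVec]
  by_cases hi : i = 0
  · subst hi; ring
  rw [tMat_cfg hp (Ne.symm hi)]
  linear_combination -(vert_sub_vert hp (Ne.symm hi)).2

/-- The incidence relations on `U` are exactly the recursions defining `val`; beyond the
configuration they need only two coordinates of vertex 0 and the second slope of the line `01`. -/
theorem hasVal_cfg {p : Y} (hp : p ∈ U) :
    HasVal p (cfg p) (af p (vert 0).1 {2}) (af p (vert 0).1 {3})
    (af p (line 0 1).1 {0, 3}) := by
  have hc := (mem_U_iff.1 hp).2
  refine ⟨hc, fun I S hS => ?_⟩
  rcases vertex_cases I with ⟨i, rfl⟩ | ⟨i, j, hij, rfl⟩ | ⟨l, rfl⟩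
  · rw [val_vert]
    rw [card_vert] at hS
    rcases minor_one_cases hS with rfl | rfl | rfl | rfl
    · rw [vertVal, if_pos rfl]
      exact af_std hc (vert i)
    · rw [vertVal_one]; rfl
    · rw [vertVal_two, bVec_cfg hp]
    · rw [vertVal_three, cVec_cfg hp]
  · rw [val_line _ _ _ _ hij]
    have hl := card_line hij.ne
    rw [hl] at hS
    have h12 : af p (line i j).1 {1, 2} = -(bVec (cfg p) (af p (vert 0).1 {2}) i -
        (cfg p).2.1 i j * (cfg p).1 i) := by
      rw [bVec_cfg hp]
      linear_combination (vert_line hp hij.ne).1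
    have h13 : af p (line i j).1 {1, 3} = -(cVec (cfg p) (af p (vert 0).1 {3})
        (af p (line 0 1).1 {0, 3}) i - tMat (cfg p) (af p (line 0 1).1 {0, 3}) i j *
        (cfg p).1 i) := by
      rw [cVec_cfg hp, tMat_cfg hp hij.ne]
      linear_combination (vert_line hp hij.ne).2
    rcases minor_two_cases hS with rfl | rfl | rfl | rfl | rfl | rfl
    · rw [lineVal, if_pos rfl]
      have := af_std hc (line i j)
      rwa [hl] at this
    · rw [lineVal_zero_two, cfg_s hij.ne]
    · rw [lineVal_zero_three, tMat_cfg hp hij.ne]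
    · rw [lineVal_one_two, h12]
    · rw [lineVal_one_three, h13]
    · rw [lineVal_two_three, af_two_three hc hl, h12, h13, cfg_s hij.ne, tMat_cfg hp hij.ne]
  · rw [val_face]
    have hl := card_face l
    rw [hl] at hS
    have ho : (others l).1 ≠ (others l).2 ∧ (others l).1 ≠ l ∧ (others l).2 ≠ l := by
      clear * -; revert l; decide
    obtain ⟨h1, h2⟩ := line_face hp ho.1 ho.2.1 ho.2.2
    obtain ⟨h3, h4⟩ := vert_line hp ho.1
    rcases minor_three_cases hS with rfl | rfl | rfl | rfl
    · rw [faceVal, if_pos rfl]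
      have := af_std hc (face l)
      rwa [hl] at this
    · rw [faceVal_zero_one_three]; simp [cfg]
    · rw [faceVal_zero_two_three, tMat_cfg hp ho.1]
      linear_combination h2
    · rw [faceVal_one_two_three, tMat_cfg hp ho.1, cVec_cfg hp, bVec_cfg hp]
      linear_combination -h1 - h4 - (cfg p).2.2 l * h3

end Tetrahedra

namespace Tetrahedra

/-! ## Edge coordinates -/

/-- The position of a set in the order of the sets. -/
def code (I : Finset (Fin 4)) : ℕ := 16 * I.card + 16 - ∑ i ∈ I, 2 ^ (3 - (i : ℕ))

/-- Among sets of equal size, the earlier one has the larger binary number when the smallest label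
is the leading bit. These numbers are below 16, so different sizes occupy disjoint ranges. -/
theorem precedes_iff {I J : Finset (Fin 4)} : precedes I J ↔ code I < code J := by
  revert I J; decide +kernel

theorem code_injective : Function.Injective code := by
  unfold Function.Injective; decide +kernel

/-- Two vertices of a hypersimplex that are joined by an edge. -/
def IsEdge (I J : Finset (Fin 4)) : Prop :=
  (I.Nonempty ∧ I ≠ Finset.univ) ∧ (J.Nonempty ∧ J ≠ Finset.univ) ∧ I.card = J.card ∧
    (I ∩ J).card + 1 = I.card

instance (I J : Finset (Fin 4)) : Decidable (IsEdge I J) := by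
  unfold IsEdge; infer_instance

theorem exists_joins {I J : Finset (Fin 4)} (h : IsEdge I J) : ∃ α : Edge, α.Joins I J := by
  obtain ⟨hI, hJ, hc, hi⟩ := h
  rcases lt_trichotomy (code I) (code J) with h | h | h
  · exact ⟨⟨⟨I, hI⟩, ⟨J, hJ⟩, ⟨hc, hi⟩, precedes_iff.2 h⟩, rfl⟩
  · rw [code_injective h, Finset.inter_self] at hi
    omega
  · exact ⟨⟨⟨J, hJ⟩, ⟨I, hI⟩, ⟨hc.symm, by
      change (J ∩ I).card + 1 = J.card; rw [Finset.inter_comm]; omega⟩, precedes_iff.2 h⟩,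
      Sym2.eq_swap⟩

/-- The orientation of an edge. -/
def sg (I J : Finset (Fin 4)) : ℤ := if code I < code J then 1 else -1

theorem sg_ne_zero (I J : Finset (Fin 4)) : (sg I J : ℂ) ≠ 0 := by
  unfold sg; split_ifs <;> simp

/-- The value of a configuration at a vertex of a hypersimplex. -/
noncomputable def hgt (z : Config) (I : Finset (Fin 4)) : ℂ :=
  if I.card = 1 then ∑ i ∈ I, z.1 i
  else if I.card = 2 then ∑ i ∈ I, ∑ j ∈ I, if i < j then z.2.1 i j else 0
  else -∑ l ∈ Iᶜ, z.2.2 l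

theorem hgt_singleton (z : Config) (i : Fin 4) : hgt z {i} = z.1 i := by
  simp [hgt]

theorem hgt_pair {z : Config} (hz : ∀ i j, z.2.1 i j = z.2.1 j i) {i j : Fin 4} (h : i ≠ j) :
    hgt z {i, j} = z.2.1 i j := by
  rw [hgt, if_neg (by rw [Finset.card_pair h]; decide), if_pos (Finset.card_pair h)]
  rcases h.lt_or_gt with h' | h' <;> simp [Finset.sum_pair h, h', h'.not_gt]
  exact hz _ _

theorem hgt_compl (z : Config) (l : Fin 4) : hgt z {l}ᶜ = -z.2.2 l := by
  have : ({l}ᶜ : Finset (Fin 4)).card = 3 := card_face l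
  rw [hgt, if_neg (by omega), if_neg (by omega)]
  simp

theorem hgt_triple (z : Config) {i j k l : Fin 4} (h : [i, j, k, l].Nodup) :
    hgt z {i, j, k} = -z.2.2 l := by
  rw [← hgt_compl]
  congr 1
  revert i j k l; decide

/-- The point of the affine space with given configuration and flag coordinates. -/
noncomputable def toAff (z : Config) (b c t : ℂ) : AffineSpace :=
  Sum.elim ![z.1 0, b, c, z.2.1 0 1, t, -z.2.2 3] fun α => hgt z α.hi.1 - hgt z α.lo.1

/-- The value of a point of the affine space at an edge. -/
def AffineSpace.edge (y : AffineSpace) (α : Edge) : ℂ := y (Sum.inr α)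

theorem eval_x (y : AffineSpace) (α : Edge) :
    MvPolynomial.eval (σ := CoordVar) y (x α) = y.edge α :=
  MvPolynomial.eval_X _

theorem edge_toAff {z : Config} {b c t : ℂ} {α : Edge} {I J : Finset (Fin 4)}
    (h : α.Joins I J) : (toAff z b c t).edge α = sg I J * (hgt z J - hgt z I) := by
  have hlt := precedes_iff.1 α.lt
  change hgt z α.hi.1 - hgt z α.lo.1 = _
  rcases Sym2.eq_iff.1 h with ⟨rfl, rfl⟩ | ⟨rfl, rfl⟩
  · rw [sg, if_pos hlt]; push_cast; ring
  · rw [sg, if_neg hlt.not_gt]; push_cast; ring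

theorem toAff_mem_linear (z : Config) (b c t : ℂ) : toAff z b c t ∈ zeroSet linearRelations := by
  rintro _ ⟨I, J, K, α₁, α₂, α₃, h1, h2, e1, e2, e3, rfl⟩
  rw [precedes_iff] at h1 h2
  rw [map_add, map_sub, eval_x, eval_x, eval_x, edge_toAff e1, edge_toAff e2, edge_toAff e3, sg, sg,
    sg, if_pos h1, if_pos h2, if_pos (h1.trans h2)]
  push_cast
  ring

/-- The edge coordinates are oriented by the order of the sets. In each relation the orientation
signs of the two monomials have the same product, so the relation can be stated with unoriented
differences. -/
theorem sg_quad₁ {i j k : Fin 4} (h : [i, j, k].Nodup) :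
    sg {i} {j} * sg {i, j} {i, k} = sg {j} {k} * sg {i, k} {j, k} := by
  revert i j k; decide +kernel

theorem sg_quad₂ {i j k l : Fin 4} (h : [i, j, k, l].Nodup) :
    sg {i, l} {j, l} * sg {i, j, l} {i, k, l} = sg {j, l} {k, l} * sg {i, k, l} {j, k, l} := by
  revert i j k l; decide +kernel

theorem sg_cub {i j k l : Fin 4} (h : [i, j, k, l].Nodup) :
    sg {i, j} {i, l} * sg {i, k} {k, l} * sg {j, k} {j, l} =
      sg {j, k} {k, l} * sg {i, j} {j, l} * sg {i, k} {i, l} := by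
  revert i j k l; decide +kernel

theorem sg_quar {i j k l : Fin 4} (h : [i, j, k, l].Nodup) :
    sg {i} {j} * sg {k} {l} * sg {i, j, l} {i, k, l} * sg {j, k, l} {i, j, k} =
      sg {j} {k} * sg {l} {i} * sg {i, k, l} {j, k, l} * sg {i, j, k} {i, j, l} := by
  revert i j k l; decide +kernel

end Tetrahedra

namespace Tetrahedra

open MvPolynomial

/-! ## The relations in terms of configurations -/

theorem sub_eq_zero_of_sg {e e' : ℤ} (he : (e : ℂ) ≠ 0) (h : e = e') {u v y y' : ℂ}
    (hy : y = e * u) (hy' : y' = e' * v) : y - y' = 0 ↔ u = v := by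
  subst h
  rw [hy, hy', ← mul_sub, mul_eq_zero, sub_eq_zero]
  exact or_iff_right he

section
variable {z : Config} {b c t : ℂ}

theorem quad₁_iff (hs : ∀ i j, z.2.1 i j = z.2.1 j i)
    {i j k : Fin 4} (h : [i, j, k].Nodup) {α₁ α₂ β₁ β₂ : Edge}
    (hα₁ : α₁.Joins {i} {j}) (hα₂ : α₂.Joins {j} {k})
    (hβ₁ : β₁.Joins {i, k} {j, k}) (hβ₂ : β₂.Joins {i, j} {i, k}) :
    eval (σ := CoordVar) (toAff z b c t) (x α₁ * x β₂ - x α₂ * x β₁) = 0 ↔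
      (z.1 j - z.1 i) * (z.2.1 i k - z.2.1 i j) = (z.1 k - z.1 j) * (z.2.1 j k - z.2.1 i k) := by
  have hij : i ≠ j := by rintro rfl; simp at h
  have hik : i ≠ k := by rintro rfl; simp at h
  have hjk : j ≠ k := by rintro rfl; simp at h
  rw [map_sub, map_mul, map_mul, eval_x, eval_x, eval_x, eval_x, edge_toAff hα₁, edge_toAff hα₂,
    edge_toAff hβ₁, edge_toAff hβ₂, hgt_singleton, hgt_singleton, hgt_singleton, hgt_pair hs hij,
    hgt_pair hs hik, hgt_pair hs hjk]
  refine sub_eq_zero_of_sg ?_ (sg_quad₁ h) ?_ ?_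
  · push_cast
    simp only [ne_eq, mul_eq_zero, sg_ne_zero, or_self, not_false_eq_true]
  · push_cast; ring
  · push_cast; ring

theorem quad₂_iff (hs : ∀ i j, z.2.1 i j = z.2.1 j i)
    {i j k l : Fin 4} (h : [i, j, k, l].Nodup) {α₁ α₂ β₁ β₂ : Edge}
    (hα₁ : α₁.Joins {i, l} {j, l}) (hα₂ : α₂.Joins {j, l} {k, l})
    (hβ₁ : β₁.Joins {i, k, l} {j, k, l}) (hβ₂ : β₂.Joins {i, j, l} {i, k, l}) :
    eval (σ := CoordVar) (toAff z b c t) (x α₁ * x β₂ - x α₂ * x β₁) = 0 ↔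
      (z.2.1 j l - z.2.1 i l) * (z.2.2 k - z.2.2 j) =
        (z.2.1 k l - z.2.1 j l) * (z.2.2 j - z.2.2 i) := by
  have hil : i ≠ l := by rintro rfl; simp at h
  have hjl : j ≠ l := by rintro rfl; simp at h
  have hkl : k ≠ l := by rintro rfl; simp at h
  have h1 : [i, k, l, j].Nodup := by clear * - h; revert i j k l; decide
  have h2 : [j, k, l, i].Nodup := by clear * - h; revert i j k l; decide
  have h3 : [i, j, l, k].Nodup := by clear * - h; revert i j k l; decide
  rw [map_sub, map_mul, map_mul, eval_x, eval_x, eval_x, eval_x, edge_toAff hα₁, edge_toAff hα₂,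
    edge_toAff hβ₁, edge_toAff hβ₂, hgt_pair hs hil, hgt_pair hs hjl, hgt_pair hs hkl,
    hgt_triple z h1, hgt_triple z h2, hgt_triple z h3]
  refine sub_eq_zero_of_sg ?_ (sg_quad₂ h) ?_ ?_
  · push_cast
    simp only [ne_eq, mul_eq_zero, sg_ne_zero, or_self, not_false_eq_true]
  · push_cast; ring
  · push_cast; ring

theorem cub_iff (hs : ∀ i j, z.2.1 i j = z.2.1 j i)
    {i j k l : Fin 4} (h : [i, j, k, l].Nodup) {α₁ α₂ α₃ β₁ β₂ β₃ : Edge}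
    (hα₁ : α₁.Joins {i, j} {i, l}) (hα₂ : α₂.Joins {i, k} {k, l}) (hα₃ : α₃.Joins {j, k} {j, l})
    (hβ₁ : β₁.Joins {j, k} {k, l}) (hβ₂ : β₂.Joins {i, j} {j, l}) (hβ₃ : β₃.Joins {i, k} {i, l}) :
    eval (σ := CoordVar) (toAff z b c t) (x α₁ * x α₂ * x α₃ - x β₁ * x β₂ * x β₃) = 0 ↔
      (z.2.1 i l - z.2.1 i j) * (z.2.1 k l - z.2.1 i k) * (z.2.1 j l - z.2.1 j k) =
        (z.2.1 k l - z.2.1 j k) * (z.2.1 j l - z.2.1 i j) * (z.2.1 i l - z.2.1 i k) := by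
  have hij : i ≠ j := by rintro rfl; simp at h
  have hik : i ≠ k := by rintro rfl; simp at h
  have hil : i ≠ l := by rintro rfl; simp at h
  have hjk : j ≠ k := by rintro rfl; simp at h
  have hjl : j ≠ l := by rintro rfl; simp at h
  have hkl : k ≠ l := by rintro rfl; simp at h
  simp only [map_sub, map_mul, eval_x]
  rw [edge_toAff hα₁, edge_toAff hα₂, edge_toAff hα₃, edge_toAff hβ₁, edge_toAff hβ₂,
    edge_toAff hβ₃, hgt_pair hs hij, hgt_pair hs hik, hgt_pair hs hil, hgt_pair hs hjk,
    hgt_pair hs hjl, hgt_pair hs hkl]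
  refine sub_eq_zero_of_sg ?_ (sg_cub h) ?_ ?_
  · push_cast
    simp only [ne_eq, mul_eq_zero, sg_ne_zero, or_self, not_false_eq_true]
  · push_cast; ring
  · push_cast; ring

theorem quar_iff {i j k l : Fin 4} (h : [i, j, k, l].Nodup)
    {α₁ α₂ α₃ α₄ β₁ β₂ β₃ β₄ : Edge}
    (hα₁ : α₁.Joins {i} {j}) (hα₂ : α₂.Joins {j} {k}) (hα₃ : α₃.Joins {k} {l})
    (hα₄ : α₄.Joins {l} {i})
    (hβ₁ : β₁.Joins {i, k, l} {j, k, l}) (hβ₂ : β₂.Joins {i, j, l} {i, k, l})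
    (hβ₃ : β₃.Joins {i, j, k} {i, j, l}) (hβ₄ : β₄.Joins {j, k, l} {i, j, k}) :
    eval (σ := CoordVar) (toAff z b c t)
        (x α₁ * x α₃ * x β₂ * x β₄ - x α₂ * x α₄ * x β₁ * x β₃) = 0 ↔
      (z.1 j - z.1 i) * (z.1 l - z.1 k) * (z.2.2 k - z.2.2 j) * (z.2.2 i - z.2.2 l) =
        (z.1 k - z.1 j) * (z.1 i - z.1 l) * (z.2.2 j - z.2.2 i) * (z.2.2 l - z.2.2 k) := by
  have h1 : [i, k, l, j].Nodup := by clear * - h; revert i j k l; decide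
  have h2 : [j, k, l, i].Nodup := by clear * - h; revert i j k l; decide
  have h3 : [i, j, l, k].Nodup := by clear * - h; revert i j k l; decide
  simp only [map_sub, map_mul, eval_x]
  rw [edge_toAff hα₁, edge_toAff hα₂, edge_toAff hα₃, edge_toAff hα₄, edge_toAff hβ₁,
    edge_toAff hβ₂, edge_toAff hβ₃, edge_toAff hβ₄, hgt_triple z h, hgt_triple z h1,
    hgt_triple z h2, hgt_triple z h3, hgt_singleton, hgt_singleton, hgt_singleton, hgt_singleton]
  refine sub_eq_zero_of_sg ?_ (sg_quar h) ?_ ?_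
  · push_cast
    simp only [ne_eq, mul_eq_zero, sg_ne_zero, or_self, not_false_eq_true]
  · push_cast; ring
  · push_cast; ring

theorem toAff_mem_quadric_iff (hs : ∀ i j, z.2.1 i j = z.2.1 j i)
    (hd : ∀ i, z.2.1 i i = 0) :
    toAff z b c t ∈ zeroSet quadricRelations ↔ Inc z := by
  constructor
  · refine fun h => ⟨hs, hd, fun i j k hn => ?_, fun i j k l hn => ?_⟩
    · obtain ⟨α₁, h1⟩ := exists_joins (I := {i}) (J := {j}) (by
        clear * - hn; revert i j k; decide)
      obtain ⟨α₂, h2⟩ := exists_joins (I := {j}) (J := {k}) (by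
        clear * - hn; revert i j k; decide)
      obtain ⟨β₁, h3⟩ := exists_joins (I := {i, k}) (J := {j, k}) (by
        clear * - hn; revert i j k; decide)
      obtain ⟨β₂, h4⟩ := exists_joins (I := {i, j}) (J := {i, k}) (by
        clear * - hn; revert i j k; decide)
      exact (quad₁_iff hs hn h1 h2 h3 h4).1
        (h _ (Or.inl ⟨i, j, k, α₁, α₂, β₁, β₂, hn, h1, h2, h3, h4, rfl⟩))
    · obtain ⟨α₁, h1⟩ := exists_joins (I := {i, l}) (J := {j, l}) (by
        clear * - hn; revert i j k l; decide)
      obtain ⟨α₂, h2⟩ := exists_joins (I := {j, l}) (J := {k, l}) (by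
        clear * - hn; revert i j k l; decide)
      obtain ⟨β₁, h3⟩ := exists_joins (I := {i, k, l}) (J := {j, k, l}) (by
        clear * - hn; revert i j k l; decide)
      obtain ⟨β₂, h4⟩ := exists_joins (I := {i, j, l}) (J := {i, k, l}) (by
        clear * - hn; revert i j k l; decide)
      exact (quad₂_iff hs hn h1 h2 h3 h4).1
        (h _ (Or.inr ⟨i, j, k, l, α₁, α₂, β₁, β₂, hn, h1, h2, h3, h4, rfl⟩))
  · rintro h _ (⟨i, j, k, α₁, α₂, β₁, β₂, hn, h1, h2, h3, h4, rfl⟩ |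
      ⟨i, j, k, l, α₁, α₂, β₁, β₂, hn, h1, h2, h3, h4, rfl⟩)
    · exact (quad₁_iff hs hn h1 h2 h3 h4).2 (h.quad₁ i j k hn)
    · exact (quad₂_iff hs hn h1 h2 h3 h4).2 (h.quad₂ i j k l hn)

theorem toAff_mem_cubic_iff (hs : ∀ i j, z.2.1 i j = z.2.1 j i) :
    toAff z b c t ∈ zeroSet cubicRelations ↔ Cub z.2.1 := by
  constructor
  · intro h i j k l hn
    obtain ⟨α₁, h1⟩ := exists_joins (I := {i, j}) (J := {i, l}) (by
      clear * - hn; revert i j k l; decide)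
    obtain ⟨α₂, h2⟩ := exists_joins (I := {i, k}) (J := {k, l}) (by
      clear * - hn; revert i j k l; decide)
    obtain ⟨α₃, h3⟩ := exists_joins (I := {j, k}) (J := {j, l}) (by
      clear * - hn; revert i j k l; decide)
    obtain ⟨β₁, h4⟩ := exists_joins (I := {j, k}) (J := {k, l}) (by
      clear * - hn; revert i j k l; decide)
    obtain ⟨β₂, h5⟩ := exists_joins (I := {i, j}) (J := {j, l}) (by
      clear * - hn; revert i j k l; decide)
    obtain ⟨β₃, h6⟩ := exists_joins (I := {i, k}) (J := {i, l}) (by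
      clear * - hn; revert i j k l; decide)
    exact (cub_iff hs hn h1 h2 h3 h4 h5 h6).1
      (h _ ⟨i, j, k, l, α₁, α₂, α₃, β₁, β₂, β₃, hn, h1, h2, h3, h4, h5, h6, rfl⟩)
  · rintro h _ ⟨i, j, k, l, α₁, α₂, α₃, β₁, β₂, β₃, hn, h1, h2, h3, h4, h5, h6, rfl⟩
    exact (cub_iff hs hn h1 h2 h3 h4 h5 h6).2 (h i j k l hn)

theorem toAff_mem_quartic_iff : toAff z b c t ∈ zeroSet quarticRelations ↔ Quar z.1 z.2.2 := by
  constructor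
  · intro h i j k l hn
    obtain ⟨α₁, h1⟩ := exists_joins (I := {i}) (J := {j}) (by
      clear * - hn; revert i j k l; decide)
    obtain ⟨α₂, h2⟩ := exists_joins (I := {j}) (J := {k}) (by
      clear * - hn; revert i j k l; decide)
    obtain ⟨α₃, h3⟩ := exists_joins (I := {k}) (J := {l}) (by
      clear * - hn; revert i j k l; decide)
    obtain ⟨α₄, h4⟩ := exists_joins (I := {l}) (J := {i}) (by
      clear * - hn; revert i j k l; decide)
    obtain ⟨β₁, h5⟩ := exists_joins (I := {i, k, l}) (J := {j, k, l}) (by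
      clear * - hn; revert i j k l; decide)
    obtain ⟨β₂, h6⟩ := exists_joins (I := {i, j, l}) (J := {i, k, l}) (by
      clear * - hn; revert i j k l; decide)
    obtain ⟨β₃, h7⟩ := exists_joins (I := {i, j, k}) (J := {i, j, l}) (by
      clear * - hn; revert i j k l; decide)
    obtain ⟨β₄, h8⟩ := exists_joins (I := {j, k, l}) (J := {i, j, k}) (by
      clear * - hn; revert i j k l; decide)
    exact (quar_iff hn h1 h2 h3 h4 h5 h6 h7 h8).1
      (h _ ⟨i, j, k, l, α₁, α₂, α₃, α₄, β₁, β₂, β₃, β₄, hn, h1, h2, h3, h4, h5, h6, h7, h8, rfl⟩)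
  · rintro h _ ⟨i, j, k, l, α₁, α₂, α₃, α₄, β₁, β₂, β₃, β₄, hn, h1, h2, h3, h4, h5, h6, h7, h8, rfl⟩
    exact (quar_iff hn h1 h2 h3 h4 h5 h6 h7 h8).2 (h i j k l hn)

end

end Tetrahedra

namespace Tetrahedra

open MvPolynomial

/-! ## The linear relations -/

instance (I J : Finset (Fin 4)) : Decidable (Adjacent I J) := by
  unfold Adjacent; infer_instance

theorem edge_cases (α : Edge) :
    (∃ i j, i < j ∧ α.lo = vert i ∧ α.hi = vert j) ∨
    (∃ i j k, [i, j, k].Nodup ∧ j < k ∧ α.lo = line i j ∧ α.hi = line i k) ∨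
    ∃ i j, i < j ∧ α.lo = face j ∧ α.hi = face i := by
  have key : ∀ I J : Vertex, IsEdge I.1 J.1 → precedes I.1 J.1 →
      (∃ i j, i < j ∧ I = vert i ∧ J = vert j) ∨
      (∃ i j k, [i, j, k].Nodup ∧ j < k ∧ I = line i j ∧ J = line i k) ∨
      ∃ i j, i < j ∧ I = face j ∧ J = face i := by
    decide +kernel
  exact key _ _ ⟨α.lo.2, α.hi.2, α.adjacent⟩ α.lt

/-- The value of a point of the affine space at a pair of vertices, if it is an edge. -/
noncomputable def AffineSpace.at (y : AffineSpace) (I J : Vertex) : ℂ :=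
  if h : Adjacent I.1 J.1 ∧ precedes I.1 J.1 then y.edge ⟨I, J, h.1, h.2⟩ else 0

theorem AffineSpace.at_edge (y : AffineSpace) (α : Edge) : y.at α.lo α.hi = y.edge α :=
  dif_pos ⟨α.adjacent, α.lt⟩

theorem at_triangle {y : AffineSpace} (hy : y ∈ zeroSet linearRelations) (I J K : Vertex)
    (hIJ : Adjacent I.1 J.1 ∧ precedes I.1 J.1) (hJK : Adjacent J.1 K.1 ∧ precedes J.1 K.1)
    (hIK : Adjacent I.1 K.1 ∧ precedes I.1 K.1) : y.at J K = y.at I K - y.at I J := by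
  have := hy _ ⟨I.1, J.1, K.1, ⟨J, K, hJK.1, hJK.2⟩, ⟨I, K, hIK.1, hIK.2⟩, ⟨I, J, hIJ.1, hIJ.2⟩,
    hIJ.2, hJK.2, rfl, rfl, rfl, rfl⟩
  rw [map_add, map_sub, eval_x, eval_x, eval_x] at this
  rw [AffineSpace.at, AffineSpace.at, AffineSpace.at, dif_pos hIJ, dif_pos hJK, dif_pos hIK]
  linear_combination this

/-- The configuration of a point of the affine space that satisfies the linear relations. -/
noncomputable def AffineSpace.cfg (y : AffineSpace) : Config :=
  (![y (Sum.inl 0), y (Sum.inl 0) + y.at (vert 0) (vert 1), y (Sum.inl 0) + y.at (vert 0) (vert 2),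
      y (Sum.inl 0) + y.at (vert 0) (vert 3)],
    symm4 (y (Sum.inl 3)) (y (Sum.inl 3) + y.at (line 0 1) (line 0 2))
      (y (Sum.inl 3) + y.at (line 0 1) (line 0 3)) (y (Sum.inl 3) + y.at (line 0 1) (line 1 2))
      (y (Sum.inl 3) + y.at (line 0 1) (line 1 3))
      (y (Sum.inl 3) + y.at (line 0 1) (line 0 2) + y.at (line 0 2) (line 2 3)),
    ![-(y (Sum.inl 5) + y.at (face 3) (face 0)), -(y (Sum.inl 5) + y.at (face 3) (face 1)),
      -(y (Sum.inl 5) + y.at (face 3) (face 2)), -y (Sum.inl 5)])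

theorem AffineSpace.cfg_symm (y : AffineSpace) (i j : Fin 4) : y.cfg.2.1 i j = y.cfg.2.1 j i := by
  fin_cases i <;> fin_cases j <;> rfl

theorem AffineSpace.cfg_diag (y : AffineSpace) (i : Fin 4) : y.cfg.2.1 i i = 0 := by
  fin_cases i <;> rfl

-- The linear relations say that the edge coordinates add up along triangles. As all cycles in the
-- tetrahedra and in the octahedron are filled by triangles, such coordinates are differences of a
-- function on the vertices, normalized by the flag coordinates.
set_option maxRecDepth 2000 in
theorem toAff_cfg {y : AffineSpace} (hy : y ∈ zeroSet linearRelations) :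
    toAff y.cfg (y (Sum.inl 1)) (y (Sum.inl 2)) (y (Sum.inl 4)) = y := by
  funext v
  rcases v with m | α
  · fin_cases m <;> simp [toAff, AffineSpace.cfg, symm4]
  · change hgt y.cfg α.hi.1 - hgt y.cfg α.lo.1 = y.edge α
    rw [← y.at_edge]
    have hs := y.cfg_symm
    rcases edge_cases α with ⟨i, j, h, h1, h2⟩ | ⟨i, j, k, hn, h, h1, h2⟩ | ⟨i, j, h, h1, h2⟩
    · rw [h1, h2]
      simp only [vert, hgt_singleton]
      clear h1 h2
      have e12 := at_triangle hy (vert 0) (vert 1) (vert 2) (by decide) (by decide) (by decide)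
      have e13 := at_triangle hy (vert 0) (vert 1) (vert 3) (by decide) (by decide) (by decide)
      have e23 := at_triangle hy (vert 0) (vert 2) (vert 3) (by decide) (by decide) (by decide)
      simp only [vert] at e12 e13 e23
      fin_cases i <;> fin_cases j <;> first
        | exact absurd h (by decide)
        | (simp only [AffineSpace.cfg, Fin.isValue, Fin.zero_eta, Fin.mk_one, Fin.reduceFinMk,
            Matrix.cons_val, vert]
           first
            | ring1
            | linear_combination -e12 | linear_combination -e13 | linear_combination -e23)
    · rw [h1, h2]
      have hij : i ≠ j := by rintro rfl; simp at hn
      have hik : i ≠ k := by rintro rfl; simp at hn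
      rw [show hgt y.cfg (line i k).1 = _ from hgt_pair hs hik,
        show hgt y.cfg (line i j).1 = _ from hgt_pair hs hij]
      clear h1 h2
      have e1 := at_triangle hy (line 0 1) (line 0 2) (line 0 3) (by decide) (by decide) (by decide)
      have e2 := at_triangle hy (line 0 1) (line 0 2) (line 1 2) (by decide) (by decide) (by decide)
      have e3 := at_triangle hy (line 0 1) (line 0 3) (line 1 3) (by decide) (by decide) (by decide)
      have e4 := at_triangle hy (line 0 1) (line 1 2) (line 1 3) (by decide) (by decide) (by decide)
      have e5 := at_triangle hy (line 0 2) (line 0 3) (line 2 3) (by decide) (by decide) (by decide)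
      have e6 := at_triangle hy (line 0 2) (line 1 2) (line 2 3) (by decide) (by decide) (by decide)
      have e7 := at_triangle hy (line 0 3) (line 1 3) (line 2 3) (by decide) (by decide) (by decide)
      -- Everything is reduced to the four edges at the line `01` and the edge from `02` to `23`,
      -- which is needed because `01` and `23` are opposite.
      rw [e5, e3, e1] at e7
      rw [e2] at e6
      rw [e1] at e5
      fin_cases i <;> fin_cases j <;> fin_cases k <;> first
        | exact absurd hn (by decide)
        | exact absurd h (by decide)
        | (simp only [AffineSpace.cfg, Fin.isValue, Fin.zero_eta, Fin.mk_one, Fin.reduceFinMk,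
            Matrix.cons_val, symm4, line_comm 1 0, line_comm 2 0, line_comm 3 0, line_comm 2 1,
            line_comm 3 1, line_comm 3 2]
           first
            | ring1
            | linear_combination -e1 | linear_combination -e2 | linear_combination -e3
            | linear_combination -e4 | linear_combination -e5 | linear_combination -e6
            | linear_combination -e7)
    · rw [h1, h2]
      simp only [face, hgt_compl]
      clear h1 h2
      have e1 := at_triangle hy (face 3) (face 2) (face 1) (by decide) (by decide) (by decide)
      have e2 := at_triangle hy (face 3) (face 2) (face 0) (by decide) (by decide) (by decide)
      have e3 := at_triangle hy (face 3) (face 1) (face 0) (by decide) (by decide) (by decide)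
      simp only [face] at e1 e2 e3
      fin_cases i <;> fin_cases j <;> first
        | exact absurd h (by decide)
        | (simp only [AffineSpace.cfg, Fin.isValue, Fin.zero_eta, Fin.mk_one, Fin.reduceFinMk,
            Matrix.cons_val, face]
           first
            | ring1
            | linear_combination -e1 | linear_combination -e2 | linear_combination -e3)

end Tetrahedra

namespace Tetrahedra

open MvPolynomial

/-! ## The chart in the affine space -/

/-- Edge coordinates are taken at the second minor, where the affine Plücker coordinate is just the
entry `a_i`, `s_ij` or `-w_l`. -/
theorem val_secondMinor (z : Config) (b c t : ℂ) (I : Vertex) :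
    val z b c t I.1 (secondMinor I).1 = hgt z I.1 := by
  rcases vertex_cases I with ⟨i, rfl⟩ | ⟨i, j, hij, rfl⟩ | ⟨l, rfl⟩
  · rw [show (secondMinor (vert i)).1 = {1} by revert i; decide, val_vert, vertVal_one]
    exact (hgt_singleton z i).symm
  · rw [show (secondMinor (line i j)).1 = {0, 2} by revert i j; decide, val_line _ _ _ _ hij,
      lineVal_zero_two]
    simp [hgt, line, Finset.card_pair hij.ne, Finset.sum_pair hij.ne, hij, hij.not_gt]
  · rw [show (secondMinor (face l)).1 = {0, 1, 3} by revert l; decide, val_face,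
      faceVal_zero_one_three]
    exact (hgt_compl z l).symm

theorem chartMap_eq_toAff {p : U} {z : Config} {b c t : ℂ} (h : HasVal p.1 z b c t) :
    chartMap p = toAff z b c t := by
  have hf : ∀ (I : Vertex) (J : Minor I.1.card), f p.1 I J = val z b c t I.1 J.1 := fun I J => by
    rw [f_eq_af, h.eq _ _ J.2]
  have h012 : ({0, 1, 2} : Finset (Fin 4)) = (face 3).1 := by decide
  rw [chartMap, toAff]
  congr 1
  · simp only [flagCoordinate, hf]
    rw [h012, val_face, faceVal_zero_one_three, show ({0} : Finset (Fin 4)) = (vert 0).1 from rfl,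
      val_vert, val_vert, val_vert, vertVal_one, vertVal_two, vertVal_three,
      show ({0, 1} : Finset (Fin 4)) = (line 0 1).1 from rfl, val_line _ _ _ _ (by decide),
      val_line _ _ _ _ (by decide), lineVal_zero_two, lineVal_zero_three]
    simp [bVec, cVec, tMat, symm4]
  · funext α
    rw [edgeCoordinate, hf, hf, val_secondMinor, val_secondMinor]

theorem chartMap_cfg (p : U) : chartMap p = toAff (cfg p.1) (af p.1 (vert 0).1 {2})
    (af p.1 (vert 0).1 {3}) (af p.1 (line 0 1).1 {0, 3}) :=
  chartMap_eq_toAff (hasVal_cfg p.2)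

theorem range_chartMap : Set.range chartMap = {y | ∃ z ∈ Lim, ∃ b c t, y = toAff z b c t} := by
  ext y
  constructor
  · rintro ⟨p, rfl⟩
    exact ⟨_, cfg_mem_Lim p.2, _, _, _, chartMap_cfg p⟩
  · rintro ⟨z, hz, b, c, t, rfl⟩
    obtain ⟨p, hp⟩ := exists_hasVal z b c t
    exact ⟨⟨p, mem_U_of_mem_Lim hz hp⟩, chartMap_eq_toAff hp⟩

theorem zeroSet_union (S T : Set (MvPolynomial CoordVar ℂ)) :
    zeroSet (S ∪ T) = zeroSet S ∩ zeroSet T := by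
  ext y
  simp only [zeroSet, Set.mem_union, or_imp, forall_and]
  rfl

theorem range_chartMap_eq_zeroSet : Set.range chartMap =
    zeroSet (linearRelations ∪ quadricRelations ∪ cubicRelations ∪ quarticRelations) := by
  rw [zeroSet_union, zeroSet_union, zeroSet_union]
  ext y
  constructor
  · rintro ⟨p, rfl⟩
    rw [chartMap_cfg]
    have hi := inc_cfg p.2
    exact ⟨⟨⟨toAff_mem_linear _ _ _ _, (toAff_mem_quadric_iff hi.symm hi.diag).2 hi⟩,
      (toAff_mem_cubic_iff hi.symm).2 (cub_cfg p.2)⟩, toAff_mem_quartic_iff.2 (quar_cfg p.2)⟩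
  · rintro ⟨⟨⟨h1, h2⟩, h3⟩, h4⟩
    rw [← toAff_cfg h1] at h2 h3 h4
    rw [range_chartMap]
    exact ⟨_, mem_Lim_of_relations ((toAff_mem_quadric_iff y.cfg_symm y.cfg_diag).1 h2)
      ((toAff_mem_cubic_iff y.cfg_symm).1 h3) (toAff_mem_quartic_iff.1 h4), _, _, _,
      (toAff_cfg h1).symm⟩

theorem toAff_at (z : Config) (b c t : ℂ) {I J : Vertex}
    (h : Adjacent I.1 J.1 ∧ precedes I.1 J.1) : (toAff z b c t).at I J = hgt z J.1 - hgt z I.1 :=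
  dif_pos h

set_option maxRecDepth 2000 in
theorem cfg_toAff {z : Config} (hs : ∀ i j, z.2.1 i j = z.2.1 j i) (hd : ∀ i, z.2.1 i i = 0)
    (b c t : ℂ) : (toAff z b c t).cfg = z := by
  have hv : ∀ i, hgt z (vert i).1 = z.1 i := hgt_singleton z
  have hl : ∀ i j, i ≠ j → hgt z (line i j).1 = z.2.1 i j := fun i j h => hgt_pair hs h
  have hf : ∀ l, hgt z (face l).1 = -z.2.2 l := hgt_compl z
  refine Prod.ext ?_ (Prod.ext ?_ ?_)
  · simp only [AffineSpace.cfg]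
    rw [toAff_at _ _ _ _ (by decide), toAff_at _ _ _ _ (by decide), toAff_at _ _ _ _ (by decide)]
    funext i
    fin_cases i <;> simp [hv, toAff]
  · rw [eq_symm4 hs hd]
    simp only [AffineSpace.cfg]
    rw [toAff_at _ _ _ _ (by decide), toAff_at _ _ _ _ (by decide), toAff_at _ _ _ _ (by decide),
      toAff_at _ _ _ _ (by decide), toAff_at _ _ _ _ (by decide)]
    rw [hl _ _ (by decide), hl _ _ (by decide), hl _ _ (by decide), hl _ _ (by decide),
      hl _ _ (by decide), hl _ _ (by decide)]
    simp [toAff]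
  · simp only [AffineSpace.cfg]
    rw [toAff_at _ _ _ _ (by decide), toAff_at _ _ _ _ (by decide), toAff_at _ _ _ _ (by decide)]
    funext i
    fin_cases i <;> simp [hf, toAff]

theorem hasVal_chartMap (p : U) : HasVal p.1 (chartMap p).cfg (chartMap p (Sum.inl 1))
    (chartMap p (Sum.inl 2)) (chartMap p (Sum.inl 4)) := by
  have hi := inc_cfg p.2
  rw [chartMap_cfg p, cfg_toAff hi.symm hi.diag]
  exact hasVal_cfg p.2

/-- The image point determines the configuration and `b`, `c`, `t`, hence all affine Plücker
coordinates, and these determine the subspaces. -/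
theorem chartMap_injective : Function.Injective chartMap := by
  intro p q h
  have hp := hasVal_chartMap p
  have hq := hasVal_chartMap q
  rw [← h] at hq
  have key : ∀ (I : Vertex) (S : Finset (Fin 4)), S.card = I.1.card →
      af p.1 I.1 S = af q.1 I.1 S := fun I S hS => by rw [hp.eq I S hS, hq.eq I S hS]
  refine Subtype.ext (funext fun I => Subtype.ext ?_)
  ext v
  have hI := card_vertex I
  obtain hI | hI | hI : I.1.card = 1 ∨ I.1.card = 2 ∨ I.1.card = 3 := by omega
  · rw [mem_iff_of_card_one hp.inCells hI, mem_iff_of_card_one hq.inCells hI,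
      key I {1} (by rw [hI]; rfl), key I {2} (by rw [hI]; rfl), key I {3} (by rw [hI]; rfl)]
  · rw [mem_iff_of_card_two hp.inCells hI, mem_iff_of_card_two hq.inCells hI,
      key I {1, 2} (by rw [hI]; rfl), key I {1, 3} (by rw [hI]; rfl),
      key I {0, 2} (by rw [hI]; rfl), key I {0, 3} (by rw [hI]; rfl)]
  · rw [mem_iff_of_card_three hp.inCells hI, mem_iff_of_card_three hq.inCells hI,
      key I {1, 2, 3} (by rw [hI]; rfl), key I {0, 1, 3} (by rw [hI]; rfl),
      key I {0, 2, 3} (by rw [hI]; rfl)]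

end Tetrahedra

namespace Tetrahedra

open MvPolynomial

/-! ## The coordinate ring -/

/-- The functions on `U` that are polynomial in the flag and edge coordinates. -/
noncomputable def chartRing : Subalgebra ℂ (U → ℂ) :=
  Algebra.adjoin ℂ (Set.range fun (v : CoordVar) (p : U) => (chartMap p : CoordVar → ℂ) v)

theorem coord_mem_chartRing (v : CoordVar) : (fun p : U => chartMap p v) ∈ chartRing :=
  Algebra.subset_adjoin ⟨v, rfl⟩

section
variable {T : Type*} {A : Subalgebra ℂ (T → ℂ)}

theorem fun_add_mem {u v : T → ℂ} (hu : (fun p => u p) ∈ A) (hv : (fun p => v p) ∈ A) :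
    (fun p => u p + v p) ∈ A :=
  A.add_mem hu hv

theorem fun_sub_mem {u v : T → ℂ} (hu : (fun p => u p) ∈ A) (hv : (fun p => v p) ∈ A) :
    (fun p => u p - v p) ∈ A :=
  A.sub_mem hu hv

theorem fun_mul_mem {u v : T → ℂ} (hu : (fun p => u p) ∈ A) (hv : (fun p => v p) ∈ A) :
    (fun p => u p * v p) ∈ A :=
  A.mul_mem hu hv

theorem fun_neg_mem {u : T → ℂ} (hu : (fun p => u p) ∈ A) : (fun p => -u p) ∈ A :=
  A.neg_mem hu

theorem fun_sum_mem {ι : Type*} {s : Finset ι} {u : ι → T → ℂ}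
    (hu : ∀ i ∈ s, (fun p => u i p) ∈ A) : (fun p => ∑ i ∈ s, u i p) ∈ A := by
  have : (fun p => ∑ i ∈ s, u i p) = ∑ i ∈ s, fun p => u i p := by
    funext p; simp
  rw [this]
  exact A.sum_mem hu

/-- All affine Plücker coordinates are polynomials in the configuration and in `b`, `c`, `t`. -/
theorem val_mem {Z : T → Config} {b c t : T → ℂ} (h₁ : ∀ i, (fun p => (Z p).1 i) ∈ A)
    (h₂ : ∀ i j, (fun p => (Z p).2.1 i j) ∈ A) (h₃ : ∀ i, (fun p => (Z p).2.2 i) ∈ A)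
    (hb : (fun p => b p) ∈ A) (hc : (fun p => c p) ∈ A) (ht : (fun p => t p) ∈ A)
    (I S : Finset (Fin 4)) : (fun p => val (Z p) (b p) (c p) (t p) I S) ∈ A := by
  have h0 : (fun _ : T => (0 : ℂ)) ∈ A := A.zero_mem
  have h1 : (fun _ : T => (1 : ℂ)) ∈ A := A.one_mem
  have hT : ∀ i j, (fun p => tMat (Z p) (t p) i j) ∈ A := by
    intro i j
    fin_cases i <;> fin_cases j <;>
      simp only [tMat, symm4, Fin.isValue, Fin.zero_eta, Fin.mk_one, Fin.reduceFinMk,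
        Matrix.cons_val] <;>
      repeat' first
        | exact h0 | exact ht | exact h₂ _ _ | exact h₃ _ | apply fun_sub_mem | apply fun_mul_mem
  have hB : ∀ i, (fun p => bVec (Z p) (b p) i) ∈ A := fun i =>
    fun_add_mem hb (fun_mul_mem (h₂ _ _) (fun_sub_mem (h₁ _) (h₁ _)))
  have hC : ∀ i, (fun p => cVec (Z p) (c p) (t p) i) ∈ A := fun i =>
    fun_add_mem hc (fun_mul_mem (hT _ _) (fun_sub_mem (h₁ _) (h₁ _)))
  unfold val
  split_ifs
  · refine fun_sum_mem fun i _ => ?_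
    unfold vertVal
    split_ifs
    exacts [h1, h₁ i, hB i, hC i]
  · refine fun_sum_mem fun i _ => fun_sum_mem fun j _ => ?_
    have hD := fun_neg_mem (fun_sub_mem (hB i) (fun_mul_mem (h₂ i j) (h₁ i)))
    have hE := fun_neg_mem (fun_sub_mem (hC i) (fun_mul_mem (hT i j) (h₁ i)))
    unfold lineVal
    split_ifs
    exacts [h1, h₂ i j, hT i j, hD, hE,
      fun_sub_mem (fun_mul_mem (h₂ i j) hE) (fun_mul_mem hD (hT i j)), h0]
  · refine fun_sum_mem fun l _ => ?_
    unfold faceVal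
    split_ifs
    · exact h1
    · exact fun_neg_mem (h₃ l)
    · exact fun_neg_mem (fun_add_mem (hT _ _) (fun_mul_mem (h₃ l) (h₂ _ _)))
    · exact fun_add_mem (fun_sub_mem (hC _) (fun_mul_mem (hT _ _) (h₁ _)))
        (fun_mul_mem (h₃ l) (fun_sub_mem (hB _) (fun_mul_mem (h₂ _ _) (h₁ _))))

end

theorem at_mem_chartRing (I J : Vertex) : (fun p : U => (chartMap p).at I J) ∈ chartRing := by
  unfold AffineSpace.at
  split_ifs
  · exact coord_mem_chartRing _
  · exact chartRing.zero_mem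

theorem f_mem_chartRing (I : Vertex) (J : Minor I.1.card) :
    (fun p : U => f p.1 I J) ∈ chartRing := by
  have h0 : (fun _ : U => (0 : ℂ)) ∈ chartRing := chartRing.zero_mem
  have : (fun p : U => f p.1 I J) = fun p : U => val (chartMap p).cfg (chartMap p (Sum.inl 1))
      (chartMap p (Sum.inl 2)) (chartMap p (Sum.inl 4)) I.1 J.1 := funext fun p => by
    rw [f_eq_af, (hasVal_chartMap p).eq _ _ J.2]
  rw [this]
  have hk := coord_mem_chartRing
  refine val_mem (fun i => ?_) (fun i j => ?_) (fun i => ?_) (hk _) (hk _) (hk _) _ _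
  · fin_cases i <;>
      simp only [AffineSpace.cfg, Fin.isValue, Fin.zero_eta, Fin.mk_one, Fin.reduceFinMk,
        Matrix.cons_val] <;>
      repeat' first
        | exact hk _ | exact at_mem_chartRing _ _ | apply fun_add_mem
  · fin_cases i <;> fin_cases j <;>
      simp only [AffineSpace.cfg, symm4, Fin.isValue, Fin.zero_eta, Fin.mk_one, Fin.reduceFinMk,
        Matrix.cons_val] <;>
      repeat' first
        | exact h0 | exact hk _ | exact at_mem_chartRing _ _ | apply fun_add_mem
  · fin_cases i <;>
      simp only [AffineSpace.cfg, Fin.isValue, Fin.zero_eta, Fin.mk_one, Fin.reduceFinMk,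
        Matrix.cons_val] <;>
      repeat' first
        | exact hk _ | exact at_mem_chartRing _ _ | apply fun_add_mem | apply fun_neg_mem

theorem chartRing_eq_coordinateRing : chartRing = coordinateRing := by
  have hf : ∀ I J, (fun p : U => f p.1 I J) ∈ coordinateRing := fun I J =>
    Algebra.subset_adjoin ⟨I, J, rfl⟩
  refine le_antisymm (Algebra.adjoin_le ?_) (Algebra.adjoin_le ?_)
  · rintro _ ⟨m | α, rfl⟩
    · fin_cases m
      exacts [hf _ _, hf _ _, hf _ _, hf _ _, hf _ _, hf _ _]
    · exact fun_sub_mem (hf _ _) (hf _ _)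
  · rintro _ ⟨I, J, rfl⟩
    exact f_mem_chartRing I J

end Tetrahedra

namespace Tetrahedra

open MvPolynomial

/-! ## Irreducible sets -/

theorem isIrreducible_preimage_val {T : Type*} [TopologicalSpace T] {Z A : Set T} (h : A ⊆ Z)
    (hA : IsIrreducible A) : IsIrreducible ((↑) ⁻¹' A : Set Z) := by
  have := Subtype.irreducibleSpace hA
  have h2 := (IrreducibleSpace.isIrreducible_univ A).image (Set.inclusion h)
    (continuous_inclusion h).continuousOn
  rwa [Set.image_univ, Set.range_inclusion] at h2

/-- An irreducible subset of a finite union of closed sets lies in one of them, so a component is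
one of the three. Each of these is in turn contained in a component, and the absence of inclusions
gives equality. -/
theorem components_eq_of_union {Z A B C : Set AffineSpace} (hZ : Z = A ∪ B ∪ C)
    (cA : IsClosed A) (cB : IsClosed B) (cC : IsClosed C) (iA : IsIrreducible A)
    (iB : IsIrreducible B) (iC : IsIrreducible C) (hAB : ¬ A ⊆ B) (hAC : ¬ A ⊆ C) (hBA : ¬ B ⊆ A)
    (hBC : ¬ B ⊆ C) (hCA : ¬ C ⊆ A) (hCB : ¬ C ⊆ B) : components Z = {A, B, C} := by
  have hsub : ∀ S ∈ ({A, B, C} : Set (Set AffineSpace)), S ⊆ Z ∧ IsIrreducible S := by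
    subst hZ
    rintro S (rfl | rfl | rfl)
    exacts [⟨fun y hy => Or.inl (Or.inl hy), iA⟩, ⟨fun y hy => Or.inl (Or.inr hy), iB⟩,
      ⟨fun y hy => Or.inr hy, iC⟩]
  have hmax : ∀ S ∈ ({A, B, C} : Set (Set AffineSpace)),
      ∀ T ∈ ({A, B, C} : Set (Set AffineSpace)), S ⊆ T → S = T := by
    rintro S (rfl | rfl | rfl) T (rfl | rfl | rfl) h <;> first | rfl | contradiction
  have h1 : components Z ⊆ {A, B, C} := by
    rintro _ ⟨D, hD, rfl⟩
    have hi : IsIrreducible ((↑) '' D : Set AffineSpace) :=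
      hD.1.image _ continuous_subtype_val.continuousOn
    have hp := isPreirreducible_iff_isClosed_union_isClosed.1 hi.isPreirreducible
    obtain ⟨S, hS, hDS⟩ : ∃ S ∈ ({A, B, C} : Set (Set AffineSpace)), (↑) '' D ⊆ S := by
      have hDZ : ((↑) '' D : Set AffineSpace) ⊆ A ∪ B ∪ C := by
        rw [← hZ]; exact Subtype.coe_image_subset _ _
      rcases hp _ _ (cA.union cB) cC hDZ with h | h
      · rcases hp _ _ cA cB h with h | h
        · exact ⟨A, by simp, h⟩
        · exact ⟨B, by simp, h⟩
      · exact ⟨C, by simp, h⟩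
    obtain ⟨hSZ, hSi⟩ := hsub S hS
    have hle : D ⊆ (↑) ⁻¹' S := Set.image_subset_iff.1 hDS
    have := hD.2 (isIrreducible_preimage_val hSZ hSi) hle
    have heq : D = (↑) ⁻¹' S := subset_antisymm hle this
    change Subtype.val '' D ∈ _
    rw [heq, Subtype.image_preimage_coe, Set.inter_eq_right.2 hSZ]
    exact hS
  refine subset_antisymm h1 fun S hS => ?_
  obtain ⟨hSZ, hSi⟩ := hsub S hS
  obtain ⟨D, hD, hSD⟩ := exists_mem_irreducibleComponents_subset_of_isIrreducible _
    (isIrreducible_preimage_val hSZ hSi)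
  have hDc : ((↑) '' D : Set AffineSpace) ∈ components Z := ⟨D, hD, rfl⟩
  have : S ⊆ (↑) '' D := fun y hy => ⟨⟨y, hSZ hy⟩, hSD hy, rfl⟩
  rwa [hmax S hS _ (h1 hDc) this]

theorem isClosed_zeroSet (S : Set (MvPolynomial CoordVar ℂ)) : IsClosed (zeroSet S) :=
  (isClosed_iff_zeroSet _).2 ⟨S, rfl⟩

section
variable {T : Type*} [NormedAddCommGroup T] [NormedSpace ℂ T]

theorem differentiable_eval {φ : T → CoordVar → ℂ} (hφ : ∀ v, Differentiable ℂ fun u => φ u v)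
    (P : MvPolynomial CoordVar ℂ) : Differentiable ℂ fun u => eval (φ u) P := by
  induction P using MvPolynomial.induction_on with
  | C a => simp
  | add P Q hP hQ => simpa using hP.fun_add hQ
  | mul_X P v hP => simpa using hP.fun_mul (hφ v)

theorem eq_zero_or_eq_zero_of_differentiable {g h : T → ℂ} (hg : Differentiable ℂ g)
    (hh : Differentiable ℂ h) (hgh : ∀ u, g u * h u = 0) : (∀ u, g u = 0) ∨ ∀ u, h u = 0 := by
  by_contra! hne
  obtain ⟨⟨u, hu⟩, v, hv⟩ := hne
  -- Restriction to the complex line through a point with `g ≠ 0` and a point with `h ≠ 0` reduces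
  -- the claim to analytic functions of one variable.
  have hl : Differentiable ℂ fun t : ℂ => u + t • (v - u) := by fun_prop
  rcases AnalyticOnNhd.eq_zero_or_eq_zero_of_mul_eq_zero
    (fun t _ => (hg.comp hl).analyticAt t) (fun t _ => (hh.comp hl).analyticAt t)
    (fun t _ => hgh _) isPreconnected_univ with h0 | h0
  · exact hu (by simpa using h0 0 trivial)
  · exact hv (by simpa using h0 1 trivial)

/-- A set is irreducible if the polynomials that vanish on it are those that vanish on the image
of an entire map. -/
theorem isIrreducible_of_differentiable {S : Set AffineSpace} (φ : T → AffineSpace)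
    (hφ : ∀ v, Differentiable ℂ fun u => φ u v) (hS : ∀ u, φ u ∈ S)
    (hd : ∀ P : MvPolynomial CoordVar ℂ, (∀ u, eval (σ := CoordVar) (φ u) P = 0) →
      ∀ y ∈ S, eval (σ := CoordVar) y P = 0) : IsIrreducible S := by
  refine ⟨⟨φ 0, hS 0⟩, isPreirreducible_iff_isClosed_union_isClosed.2 fun Z₁ Z₂ h₁ h₂ hcov => ?_⟩
  obtain ⟨S₁, rfl⟩ := (isClosed_iff_zeroSet _).1 h₁
  obtain ⟨S₂, rfl⟩ := (isClosed_iff_zeroSet _).1 h₂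
  by_contra! hne
  simp only [zeroSet, Set.not_subset, Set.mem_ofPred_eq, not_forall] at hne
  obtain ⟨⟨y₁, hy₁, P₁, hP₁, e₁⟩, y₂, hy₂, P₂, hP₂, e₂⟩ := hne
  rcases eq_zero_or_eq_zero_of_differentiable (differentiable_eval hφ P₁)
    (differentiable_eval hφ P₂) (fun u => by
      rcases hcov (hS u) with h | h
      · exact mul_eq_zero_of_left (h P₁ hP₁) _
      · exact mul_eq_zero_of_right _ (h P₂ hP₂)) with h | h
  · exact e₁ (hd P₁ h y₁ hy₁)
  · exact e₂ (hd P₂ h y₂ hy₂)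

theorem differentiable_symm4 {f1 f2 f3 f4 f5 f6 : T → ℂ} (h1 : Differentiable ℂ f1)
    (h2 : Differentiable ℂ f2) (h3 : Differentiable ℂ f3) (h4 : Differentiable ℂ f4)
    (h5 : Differentiable ℂ f5) (h6 : Differentiable ℂ f6) :
    Differentiable ℂ fun u => symm4 (f1 u) (f2 u) (f3 u) (f4 u) (f5 u) (f6 u) := by
  refine differentiable_pi.2 fun i => differentiable_pi.2 fun j => ?_
  fin_cases i <;> fin_cases j <;> simp [symm4] <;> assumption

theorem differentiable_toAff {Z : T → Config} {b c t : T → ℂ} (hZ : Differentiable ℂ Z)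
    (hb : Differentiable ℂ b) (hc : Differentiable ℂ c) (ht : Differentiable ℂ t) (v : CoordVar) :
    Differentiable ℂ fun u => toAff (Z u) (b u) (c u) (t u) v := by
  have hI : ∀ I, Differentiable ℂ fun u => hgt (Z u) I := by
    intro I
    unfold hgt
    split_ifs
    · fun_prop
    · refine Differentiable.fun_sum fun i _ => Differentiable.fun_sum fun j _ => ?_
      split_ifs <;> fun_prop
    · fun_prop
  rcases v with m | α
  · fin_cases m <;> simp only [toAff, Sum.elim_inl, Fin.isValue, Fin.zero_eta, Fin.mk_one,
      Fin.reduceFinMk, Matrix.cons_val] <;> fun_prop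
  · exact (hI _).sub (hI _)

end

end Tetrahedra

namespace Tetrahedra

open MvPolynomial

/-! ## The variety of the linear and quadric relations -/

theorem inc_of_sConst {z : Config} (hs : ∀ i j, z.2.1 i j = z.2.1 j i) (hd : ∀ i, z.2.1 i i = 0)
    (h : SConst z.2.1) : Inc z where
  symm := hs
  diag := hd
  quad₁ i j k hn := by
    have h1 := h k j i (by clear * - hn; revert i j k; decide)
    linear_combination (z.1 j - z.1 i) * (hs i k - hs i j - h1) - (z.1 k - z.1 j) * h i j k hn
  quad₂ i j k l hn := by
    have h1 := h i j l (by clear * - hn; revert i j k l; decide)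
    have h2 := h j k l (by clear * - hn; revert i j k l; decide)
    linear_combination (z.2.2 k - z.2.2 j) * h1 - (z.2.2 j - z.2.2 i) * h2

theorem eq_of_sConst {z : Config} (hs : ∀ i j, z.2.1 i j = z.2.1 j i) (hd : ∀ i, z.2.1 i i = 0)
    (h : SConst z.2.1) : z = (z.1, symm4 (z.2.1 0 1) (z.2.1 0 1) (z.2.1 0 1) (z.2.1 0 1)
      (z.2.1 0 1) (z.2.1 0 1), z.2.2) := by
  obtain ⟨e1, e2, e3, e4, e5⟩ := h.eq (inc_of_sConst hs hd h)
  have e := eq_symm4 hs hd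
  rw [e1, e2, e3, e4, e5] at e
  exact Prod.ext rfl (Prod.ext e rfl)

/-- The polynomials of the second component. -/
noncomputable def rankTwo : Set (MvPolynomial CoordVar ℂ) :=
  {P | ∃ α : Edge, α.rank = 2 ∧ P = x α}

/-- The polynomials of the third component. -/
noncomputable def rankOneThree : Set (MvPolynomial CoordVar ℂ) :=
  {P | ∃ α : Edge, (α.rank = 1 ∨ α.rank = 3) ∧ P = x α}

theorem Edge.Joins.rank_eq {α : Edge} {I J : Finset (Fin 4)} (h : α.Joins I J) :
    α.rank = I.card := by
  rcases Sym2.eq_iff.1 h with ⟨rfl, rfl⟩ | ⟨rfl, rfl⟩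
  · rfl
  · exact α.adjacent.1

theorem toAff_mem_rankTwo_iff {z : Config} (hs : ∀ i j, z.2.1 i j = z.2.1 j i) {b c t : ℂ} :
    toAff z b c t ∈ zeroSet rankTwo ↔ SConst z.2.1 := by
  constructor
  · intro h i j k hn
    have hik : i ≠ k := by rintro rfl; simp at hn
    have hjk : j ≠ k := by rintro rfl; simp at hn
    obtain ⟨α, e⟩ := exists_joins (I := {i, k}) (J := {j, k}) (by
      clear * - hn; revert i j k; decide)
    have := h _ ⟨α, e.rank_eq.trans (Finset.card_pair hik), rfl⟩
    rw [eval_x, edge_toAff e, mul_eq_zero, hgt_pair hs hik, hgt_pair hs hjk] at this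
    exact sub_eq_zero.1 (this.resolve_left (sg_ne_zero _ _))
  · rintro h _ ⟨α, hr, rfl⟩
    rw [eval_x]
    change hgt z α.hi.1 - hgt z α.lo.1 = 0
    rcases edge_cases α with ⟨i, j, -, h1, h2⟩ | ⟨i, j, k, hn, -, h1, h2⟩ | ⟨i, j, -, h1, h2⟩
    · rw [Edge.rank, h1, card_vert] at hr; omega
    · have hij : i ≠ j := by rintro rfl; simp at hn
      have hik : i ≠ k := by rintro rfl; simp at hn
      rw [h1, h2, show hgt z (line i k).1 = _ from hgt_pair hs hik,
        show hgt z (line i j).1 = _ from hgt_pair hs hij, hs i k, hs i j,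
        h j k i (by clear * - hn; revert i j k; decide), sub_self]
    · rw [Edge.rank, h1, card_face] at hr; omega

theorem toAff_mem_rankOneThree_iff {z : Config} {b c t : ℂ} :
    toAff z b c t ∈ zeroSet rankOneThree ↔
      (∀ i j, z.1 i = z.1 j) ∧ ∀ i j, z.2.2 i = z.2.2 j := by
  constructor
  · refine fun h => ⟨fun i j => ?_, fun i j => ?_⟩
    · rcases eq_or_ne i j with rfl | hij
      · rfl
      obtain ⟨α, e⟩ := exists_joins (I := {j}) (J := {i}) (by
        clear * - hij; revert i j; decide)
      have := h _ ⟨α, Or.inl e.rank_eq, rfl⟩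
      rw [eval_x, edge_toAff e, mul_eq_zero, hgt_singleton, hgt_singleton] at this
      exact sub_eq_zero.1 (this.resolve_left (sg_ne_zero _ _))
    · rcases eq_or_ne i j with rfl | hij
      · rfl
      obtain ⟨α, e⟩ := exists_joins (I := {j}ᶜ) (J := {i}ᶜ) (by
        clear * - hij; revert i j; decide)
      have := h _ ⟨α, Or.inr (e.rank_eq.trans (card_face j)), rfl⟩
      rw [eval_x, edge_toAff e, mul_eq_zero, hgt_compl, hgt_compl] at this
      exact neg_injective (sub_eq_zero.1 (this.resolve_left (sg_ne_zero _ _)))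
  · rintro ⟨ha, hw⟩ _ ⟨α, hr, rfl⟩
    rw [eval_x]
    change hgt z α.hi.1 - hgt z α.lo.1 = 0
    rcases edge_cases α with ⟨i, j, -, h1, h2⟩ | ⟨i, j, k, hn, -, h1, h2⟩ | ⟨i, j, -, h1, h2⟩
    · rw [h1, h2, show hgt z (vert j).1 = _ from hgt_singleton z j,
        show hgt z (vert i).1 = _ from hgt_singleton z i, ha i j, sub_self]
    · have hij : i ≠ j := by rintro rfl; simp at hn
      rw [Edge.rank, h1, card_line hij] at hr
      omega
    · rw [h1, h2, show hgt z (face i).1 = _ from hgt_compl z i,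
        show hgt z (face j).1 = _ from hgt_compl z j, hw i j, sub_self]

theorem eq_of_mem_rankTwo {y : AffineSpace} (hy : y ∈ zeroSet (linearRelations ∪ rankTwo)) :
    ∃ a w s b c t, y = toAff (a, symm4 s s s s s s, w) b c t := by
  rw [zeroSet_union] at hy
  obtain ⟨h1, h2⟩ := hy
  rw [← toAff_cfg h1, toAff_mem_rankTwo_iff y.cfg_symm] at h2
  exact ⟨y.cfg.1, y.cfg.2.2, y.cfg.2.1 0 1, _, _, _, (toAff_cfg h1).symm.trans
    (congrArg (fun z => toAff z _ _ _) (eq_of_sConst y.cfg_symm y.cfg_diag h2))⟩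

theorem eq_of_mem_rankOneThree {y : AffineSpace}
    (hy : y ∈ zeroSet (linearRelations ∪ rankOneThree)) :
    ∃ (α β : ℂ) (s : Fin 6 → ℂ) (b c t : ℂ),
      y = toAff (fun _ => α, symm4 (s 0) (s 1) (s 2) (s 3) (s 4) (s 5), fun _ => β) b c t := by
  rw [zeroSet_union] at hy
  obtain ⟨h1, h2⟩ := hy
  rw [← toAff_cfg h1, toAff_mem_rankOneThree_iff] at h2
  have e := eq_symm4 y.cfg_symm y.cfg_diag
  refine ⟨y.cfg.1 0, y.cfg.2.2 0, ![y.cfg.2.1 0 1, y.cfg.2.1 0 2, y.cfg.2.1 0 3, y.cfg.2.1 1 2,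
    y.cfg.2.1 1 3, y.cfg.2.1 2 3], _, _, _,
    (toAff_cfg h1).symm.trans (congrArg (fun z => toAff z _ _ _) ?_)⟩
  exact Prod.ext (funext fun i => h2.1 i 0) (Prod.ext e (funext fun i => h2.2 i 0))

theorem const_mem_rankTwo (a w : Fin 4 → ℂ) (s b c t : ℂ) :
    toAff (a, symm4 s s s s s s, w) b c t ∈ zeroSet (linearRelations ∪ rankTwo) := by
  have hi := inc_const a w s
  rw [zeroSet_union]
  exact ⟨toAff_mem_linear _ _ _ _, (toAff_mem_rankTwo_iff hi.symm).2 (SConst.of_eqs hi rfl rfl rfl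
    rfl rfl)⟩

theorem const_mem_rankOneThree (α β : ℂ) (s : Fin 4 → Fin 4 → ℂ) (b c t : ℂ) :
    toAff (fun _ => α, s, fun _ => β) b c t ∈ zeroSet (linearRelations ∪ rankOneThree) := by
  rw [zeroSet_union]
  exact ⟨toAff_mem_linear _ _ _ _, toAff_mem_rankOneThree_iff.2 ⟨fun _ _ => rfl, fun _ _ => rfl⟩⟩

/-- A point lies in the second piece if `s` is constant and in `U` if `s` is nonconstant and
satisfies the cubic. If the cubic fails, `a` and `w` are both constant. -/
theorem uinc_eq : Uinc = Set.range chartMap ∪ zeroSet (linearRelations ∪ rankTwo) ∪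
    zeroSet (linearRelations ∪ rankOneThree) := by
  rw [Uinc]
  ext y
  constructor
  · rw [zeroSet_union]
    rintro ⟨h1, h2⟩
    have hy := toAff_cfg h1
    rw [← hy, toAff_mem_quadric_iff y.cfg_symm y.cfg_diag] at h2
    rw [← hy]
    by_cases hs : SConst y.cfg.2.1
    · refine Or.inl (Or.inr ?_)
      rw [zeroSet_union]
      exact ⟨toAff_mem_linear _ _ _ _, (toAff_mem_rankTwo_iff y.cfg_symm).2 hs⟩
    by_cases hc : Cub y.cfg.2.1
    · refine Or.inl (Or.inl ?_)
      rw [range_chartMap]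
      exact ⟨_, mem_Lim_of_cub h2 hc hs, _, _, _, rfl⟩
    · refine Or.inr ?_
      rw [zeroSet_union]
      refine ⟨toAff_mem_linear _ _ _ _, toAff_mem_rankOneThree_iff.2 ⟨fun i j => ?_, fun i j => ?_⟩⟩
      · by_contra h
        exact hc (cub_of_a_ne h2 h)
      · by_contra h
        exact hc (cub_of_w_ne h2 h)
  · rintro ((h | h) | h)
    · rw [range_chartMap_eq_zeroSet, zeroSet_union, zeroSet_union] at h
      exact h.1.1
    · obtain ⟨a, w, s, b, c, t, rfl⟩ := eq_of_mem_rankTwo h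
      have hi := inc_const a w s
      rw [zeroSet_union]
      exact ⟨toAff_mem_linear _ _ _ _, (toAff_mem_quadric_iff hi.symm hi.diag).2 hi⟩
    · obtain ⟨α, β, s, b, c, t, rfl⟩ := eq_of_mem_rankOneThree h
      have hi : Inc (fun _ => α, symm4 (s 0) (s 1) (s 2) (s 3) (s 4) (s 5), fun _ => β) := by
        refine inc_of ?_ ?_ ?_ ?_ ?_ ?_ ?_ ?_ <;> simp
      rw [zeroSet_union]
      exact ⟨toAff_mem_linear _ _ _ _, (toAff_mem_quadric_iff hi.symm hi.diag).2 hi⟩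

theorem isIrreducible_rankTwo : IsIrreducible (zeroSet (linearRelations ∪ rankTwo)) := by
  refine isIrreducible_of_differentiable
    (T := (Fin 4 → ℂ) × (Fin 4 → ℂ) × (Fin 4 → ℂ))
    (fun u => toAff (u.1, symm4 (u.2.2 0) (u.2.2 0) (u.2.2 0) (u.2.2 0) (u.2.2 0) (u.2.2 0), u.2.1)
      (u.2.2 1) (u.2.2 2) (u.2.2 3))
    (fun v => differentiable_toAff ?_ (by fun_prop) (by fun_prop) (by fun_prop) v)
    (fun u => const_mem_rankTwo _ _ _ _ _ _) fun P hP y hy => ?_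
  · exact Differentiable.prodMk (by fun_prop) (Differentiable.prodMk
      (differentiable_symm4 (by fun_prop) (by fun_prop) (by fun_prop) (by fun_prop) (by fun_prop)
      (by fun_prop)) (by fun_prop))
  · obtain ⟨a, w, s, b, c, t, rfl⟩ := eq_of_mem_rankTwo hy
    exact hP (a, w, ![s, b, c, t])

theorem isIrreducible_rankOneThree :
    IsIrreducible (zeroSet (linearRelations ∪ rankOneThree)) := by
  refine isIrreducible_of_differentiable
    (T := (Fin 5 → ℂ) × (Fin 6 → ℂ))
    (fun u => toAff (fun _ => u.1 0, symm4 (u.2 0) (u.2 1) (u.2 2) (u.2 3) (u.2 4) (u.2 5),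
      fun _ => u.1 1) (u.1 2) (u.1 3) (u.1 4))
    (fun v => differentiable_toAff ?_ (by fun_prop) (by fun_prop) (by fun_prop) v)
    (fun u => const_mem_rankOneThree _ _ _ _ _ _) fun P hP y hy => ?_
  · exact Differentiable.prodMk (by fun_prop) (Differentiable.prodMk
      (differentiable_symm4 (by fun_prop) (by fun_prop) (by fun_prop) (by fun_prop) (by fun_prop)
      (by fun_prop)) (by fun_prop))
  · obtain ⟨α, β, s, b, c, t, rfl⟩ := eq_of_mem_rankOneThree hy
    exact hP (![α, β, b, c, t], s)

theorem differentiable_fam : Differentiable ℂ fun u : (Fin 4 → ℂ) × (Fin 8 → ℂ) =>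
    fam u.1 (u.2 0) (u.2 1) (u.2 2) 1 (u.2 3) (u.2 4) := by
  unfold fam
  refine Differentiable.prodMk (by fun_prop) (Differentiable.prodMk
    (differentiable_symm4 (by fun_prop) (by fun_prop) (by fun_prop) (by fun_prop) (by fun_prop)
      (by fun_prop)) (differentiable_pi.2 fun i => ?_))
  fin_cases i <;> simp only [Fin.isValue, Fin.zero_eta, Fin.mk_one, Fin.reduceFinMk,
    Matrix.cons_val] <;> fun_prop

/-- The parameters are `a`, the five numbers `p, q, K, c, d` of the family with `Y = 1`, and the
three free coordinates. The parametrization reaches every point over `Gen`, though it need not reach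
every limit. -/
theorem isIrreducible_range_chartMap : IsIrreducible (Set.range chartMap) := by
  rw [range_chartMap]
  refine isIrreducible_of_differentiable (T := (Fin 4 → ℂ) × (Fin 8 → ℂ))
    (fun u => toAff (fam u.1 (u.2 0) (u.2 1) (u.2 2) 1 (u.2 3) (u.2 4)) (u.2 5) (u.2 6) (u.2 7))
    (fun v => differentiable_toAff differentiable_fam (by fun_prop) (by fun_prop) (by fun_prop) v)
    (fun u => ⟨_, fam_mem_Lim _ _ _ _ _ _ _, _, _, _, rfl⟩) fun P hP y hy => ?_
  obtain ⟨z, hz, b, c, t, rfl⟩ := hy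
  have hcont : Continuous fun z : Config => eval (σ := CoordVar) (toAff z b c t) P :=
    (differentiable_eval (fun v => differentiable_toAff (Z := fun z : Config => z)
      differentiable_id (differentiable_const b) (differentiable_const c)
      (differentiable_const t) v) P).continuous
  -- A polynomial vanishing over `Gen` vanishes over `Lim` by continuity, so the parametrized part
  -- suffices.
  refine closure_minimal (t := {z : Config | eval (σ := CoordVar) (toAff z b c t) P = 0})
    (fun z hz => ?_) (isClosed_eq hcont continuous_const) hz
  obtain ⟨p, q, K, d, e, h⟩ := Gen.exists_eq_fam hz
  rw [h]
  exact hP (z.1, ![p, q, K, d, e, b, c, t])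

theorem components_uinc : components Uinc = {Set.range chartMap,
    zeroSet (linearRelations ∪ rankTwo), zeroSet (linearRelations ∪ rankOneThree)} ∧
    (components Uinc).ncard = 3 := by
  have hsep : ∀ i j : Fin 4, i ≠ j → (![0, 1, 2, 3] : Fin 4 → ℂ) i ≠ ![0, 1, 2, 3] j := by
    intro i j h
    fin_cases i <;> fin_cases j <;> first
      | exact absurd rfl h
      | norm_num
  have hgen : Gen (fam ![0, 1, 2, 3] 1 1 1 1 0 0) := by
    refine gen_fam hsep (fun i => ?_) one_ne_zero one_ne_zero
    fin_cases i <;> simp <;> norm_num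
  have hV : toAff (fam ![0, 1, 2, 3] 1 1 1 1 0 0) 0 0 0 ∈ Set.range chartMap := by
    rw [range_chartMap]
    exact ⟨_, subset_closure hgen, _, _, _, rfl⟩
  -- Here `a` is distinct but only `w` has coincidences, in two pairs: the cross-ratios differ and
  -- the quartic fails.
  have h2 := const_mem_rankTwo ![0, 1, 2, 3] ![0, 0, 1, 1] 0 0 0 0
  -- For these slopes one side of the cubic is `-1`, while the other vanishes because `s 2 3 = s 1
  -- 2`.
  have h3 := const_mem_rankOneThree 0 0 (symm4 0 0 1 1 0 1) 0 0 0
  have hi := inc_const ![0, 1, 2, 3] ![0, 0, 1, 1] 0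
  have hs : ∀ i j, symm4 (0 : ℂ) 0 1 1 0 1 i j = symm4 0 0 1 1 0 1 j i := by
    intro i j; fin_cases i <;> fin_cases j <;> rfl
  have hAB : ¬ Set.range chartMap ⊆ zeroSet (linearRelations ∪ rankTwo) := fun h => by
    have := h hV
    rw [zeroSet_union] at this
    exact hgen.s_ne 0 1 2 (by decide)
      (((toAff_mem_rankTwo_iff hgen.symm).1 this.2) 1 0 2 (by decide))
  have hAC : ¬ Set.range chartMap ⊆ zeroSet (linearRelations ∪ rankOneThree) := fun h => by
    have := h hV
    rw [zeroSet_union] at this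
    exact hgen.a_ne 0 1 (by decide) ((toAff_mem_rankOneThree_iff.1 this.2).1 0 1)
  have hBA : ¬ zeroSet (linearRelations ∪ rankTwo) ⊆ Set.range chartMap := fun h => by
    have := h h2
    rw [range_chartMap_eq_zeroSet, zeroSet_union] at this
    have := toAff_mem_quartic_iff.1 this.2 0 1 2 3 (by decide)
    simp only [Fin.isValue, Matrix.cons_val] at this
    norm_num at this
  have hBC : ¬ zeroSet (linearRelations ∪ rankTwo) ⊆ zeroSet (linearRelations ∪ rankOneThree) :=
    fun h => by
      have := h h2
      rw [zeroSet_union] at this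
      exact hsep 0 1 (by decide) ((toAff_mem_rankOneThree_iff.1 this.2).1 0 1)
  have hCA : ¬ zeroSet (linearRelations ∪ rankOneThree) ⊆ Set.range chartMap := fun h => by
    have := h h3
    rw [range_chartMap_eq_zeroSet, zeroSet_union, zeroSet_union] at this
    have := (toAff_mem_cubic_iff hs).1 this.1.2 0 1 2 3 (by decide)
    simp [symm4] at this
  have hCB : ¬ zeroSet (linearRelations ∪ rankOneThree) ⊆ zeroSet (linearRelations ∪ rankTwo) :=
    fun h => by
      have := h h3
      rw [zeroSet_union] at this
      have := (toAff_mem_rankTwo_iff hs).1 this.2 0 1 2 (by decide)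
      simp [symm4] at this
  have key := components_eq_of_union uinc_eq
    (by rw [range_chartMap_eq_zeroSet]; exact isClosed_zeroSet _) (isClosed_zeroSet _)
    (isClosed_zeroSet _) isIrreducible_range_chartMap isIrreducible_rankTwo
    isIrreducible_rankOneThree hAB hAC hBA hBC hCA hCB
  refine ⟨key, ?_⟩
  rw [key, Set.ncard_eq_three]
  exact ⟨_, _, _, fun h => hAB h.subset, fun h => hAC h.subset, fun h => hBC h.subset, rfl⟩

end Tetrahedra

theorem mainTheorem3 :
    -- the flag and edge coordinates embed the affine variety `U` in the affine space
    Function.Injective Tetrahedra.chartMap ∧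
    Algebra.adjoin ℂ
        (Set.range fun (v : Tetrahedra.CoordVar) (p : Tetrahedra.U) =>
          (Tetrahedra.chartMap p : Tetrahedra.CoordVar → ℂ) v) =
      Tetrahedra.coordinateRing ∧
    -- the image is cut out by the linear, quadric, cubic and quartic relations
    Set.range Tetrahedra.chartMap =
      Tetrahedra.zeroSet
        (Tetrahedra.linearRelations ∪ Tetrahedra.quadricRelations ∪
          Tetrahedra.cubicRelations ∪ Tetrahedra.quarticRelations) ∧
    -- the linear and quadric relations alone define a variety with three irreducible components
    (Tetrahedra.components Tetrahedra.Uinc).ncard = 3 ∧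
    Tetrahedra.components Tetrahedra.Uinc =
      {Set.range Tetrahedra.chartMap,
        Tetrahedra.zeroSet (Tetrahedra.linearRelations ∪
          {P | ∃ α : Tetrahedra.Edge, α.rank = 2 ∧ P = Tetrahedra.x α}),
        Tetrahedra.zeroSet (Tetrahedra.linearRelations ∪
          {P | ∃ α : Tetrahedra.Edge, (α.rank = 1 ∨ α.rank = 3) ∧ P = Tetrahedra.x α})} :=
  ⟨Tetrahedra.chartMap_injective, Tetrahedra.chartRing_eq_coordinateRing,
    Tetrahedra.range_chartMap_eq_zeroSet, Tetrahedra.components_uinc.2,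
    Tetrahedra.components_uinc.1⟩
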